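/- **Conventions.** For a diffeological space $X$: $\Omega^1(X)$ is the space of differential 1-forms (families $\eta=(\eta(p))_p$ of smooth 1-forms on the domains of the plots $p$ with $\eta(p\circ g)=g^*\eta(p)$) with its functional diffeology; $\Lambda^1_x(X)$ is the quotient of $\Omega^1(X)$ by the forms vanishing at $x$ (those with $\eta(p)(0)=0$ for all plots $p$ with $p(0)=x$); $\Lambda^1(X)=\bigsqcup_x\Lambda_x^1(X)$ has the quotient diffeology of $X\times\Omega^1(X)$. A smooth map $\varphi:A\to B$ induces linear maps $\Lambda^1_{\varphi(a)}(B)\to\Lambda^1_a(A)$. A (diffeological vector) pseudo-bundle is a family of vector spaces with a diffeology on the total space for which the projection, the fibrewise operations and the zero section are smooth; tensor products, duals (smooth functionals on the fibres, with the dual diffeology) and Clifford algebras of pseudo-bundles have their standard diffeologies. A *pseudo-metric* on a pseudo-bundle $E$ with finite-dimensional fibres is a smooth section $g$ of $E^*\otimes E^*$ such that each $g(x)$ is symmetric, positive semidefinite, and of rank $\dim (E^*)_x$. If $\Lambda^1(X)$ has finite-dimensional fibres and a pseudo-metric $g^\Lambda$, a smooth *Clifford action* $c$ of $C\ell(\Lambda^1(X),g^\Lambda)$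 on $E$ is a family of linear maps $c:\Lambda^1_x(X)\to\mathrm{End}(E_x)$ which extends to a family of algebra homomorphisms $C\ell(\Lambda^1_x(X),g^\Lambda(x))\to \mathrm{End}(E_x)$ (with $v\cdot v=-g^\Lambda(v,v)$) for which the evaluation $(a,e)\mapsto a\cdot e$ is smooth on the fibre product. A *connection* on $E$ is a linear operator $\nabla:C^\infty(X,E)\to C^\infty(X,\Lambda^1(X)\otimes E)$, smooth for the functional diffeologies, with $\nabla(hs)=dh\otimes s+h\nabla s$. For a section $t$ of $(\Lambda^1(X))^*$, $\nabla_ts$ is the contraction of $\nabla s$ with $t$. A connection $\nabla^\Lambda$ on $\Lambda^1(X)$ is *Levi-Civita* for $g^\Lambda$ if $d(g^\Lambda(s,t))=g^\Lambda(\nabla^\Lambda s,t)+g^\Lambda(s,\nabla^\Lambda t)$ for all smooth sections $s,t$, and $\nabla^\Lambda_{s_1}s_2-\nabla^\Lambda_{s_2}s_1=[s_1,s_2]$ for all smooth sections $s_1,s_2$; here a section $s$ of $\Lambda^1(X)$ is identified with the section $g^\Lambda(s,\cdot)$ of the dual, $t(h)=t(dh)$ for a section $t$ of the dual and a smooth function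 $h$, and $[t_1,t_2](h)=t_1(t_2(h))-t_2(t_1(h))$ for all smooth $h$. Finally, a connection $\nabla$ on a finite-dimensional pseudo-bundle $E$ with a smooth Clifford action $c$ of $C\ell(\Lambda^1(X),g^\Lambda)$ is a *Clifford connection* (with respect to $g^\Lambda$, $c$ and a Levi-Civita connection $\nabla^\Lambda$ of $(\Lambda^1(X),g^\Lambda)$) if for all smooth sections $t$ of $(\Lambda^1(X))^*$, $s$ of $\Lambda^1(X)$ and $r$ of $E$ $$\nabla_t(c(s)r)=c(\nabla^\Lambda_ts)(r)+c(s)(\nabla_tr).$$ **Gluing.** Let $X_1,X_2$ be diffeological spaces, $Y\subseteq X_1$, and let $f:Y\to X_2$ be a diffeomorphism onto its image (subset diffeologies). $X_1\cup_fX_2$ is the quotient of $X_1\sqcup X_2$ by $y\sim f(y)$, with natural maps $\tilde i_1:X_1\to X_1\cup_fX_2$, $i_2:X_2\to X_1\cup_fX_2$, whose plots are locally the compositions of plots of $X_1$ with $\tilde i_1$ or of plots of $X_2$ with $i_2$. Let $\tilde\rho_1:\Lambda^1_{\tilde i_1(x)}(X_1\cup_fX_2)\to\Lambda^1_x(X_1)$,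 $\tilde\rho_2:\Lambda^1_{i_2(x)}(X_1\cup_fX_2)\to\Lambda^1_x(X_2)$, and, for $y\in Y$, $\iota_1:\Lambda^1_y(X_1)\to\Lambda^1_y(Y)$, $\iota_2:\Lambda^1_{f(y)}(X_2)\to\Lambda^1_y(Y)$ be the maps induced by $\tilde i_1$, $i_2$, by the inclusion $Y\hookrightarrow X_1$ and by $f:Y\to X_2$. Elements $\alpha_1\in\Lambda^1_y(X_1)$, $\alpha_2\in\Lambda^1_{f(y)}(X_2)$ are *compatible* if $\iota_1\alpha_1=\iota_2\alpha_2$. Let $\mathcal D_1^\Omega$ (respectively $\mathcal D_2^\Omega$) be the set of maps into $\Omega^1(Y)$ that are locally of the form (pullback to $Y$ along the inclusion, respectively along $f$) $\circ$ (a plot of $\Omega^1(X_1)$, respectively $\Omega^1(X_2)$). Assume $\mathcal D_1^\Omega=\mathcal D_2^\Omega$. For $i=1,2$ let $\Lambda^1(X_i)$ have finite-dimensional fibres, a pseudo-metric $g_i^\Lambda$, and a Levi-Civita connection $\nabla^{\Lambda,i}$, and let $E_i\to X_i$ be a finite-dimensional pseudo-bundle with a smooth Clifford action $c_i$ of $C\ell(\Lambda^1(X_i),g_i^\Lambda)$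 and a Clifford connection $\nabla^i$. Let $\tilde f'$ be a fibrewise linear diffeomorphism, covering $f$, from the restriction of $E_1$ to $Y$ onto the restriction of $E_2$ to $f(Y)$, and let $E_1\cup_{\tilde f'}E_2\to X_1\cup_fX_2$ be the glued pseudo-bundle. Assume that, for all $y\in Y$: 1. $g_1^\Lambda(y)(\alpha_1,\beta_1)=g_2^\Lambda(f(y))(\alpha_2,\beta_2)$ whenever $(\alpha_1,\alpha_2)$ and $(\beta_1,\beta_2)$ are compatible pairs over $y$; 2. $c_2(\tilde\rho_2\alpha)(\tilde f'(e))=\tilde f'(c_1(\tilde\rho_1\alpha)(e))$ for all $\alpha\in\Lambda^1_{i_2(f(y))}(X_1\cup_fX_2)$ and $e\in (E_1)_y$; 3. $(\iota_1\otimes\tilde f')((\nabla^1s_1)(y))=(\iota_2\otimes\mathrm{Id})((\nabla^2s_2)(f(y)))$ for all smooth sections $s_1$ of $E_1$, $s_2$ of $E_2$ with $s_2\circ f=\tilde f'\circ s_1$ on $Y$; 4. $(\iota_1\otimes\iota_1)((\nabla^{\Lambda,1}s_1)(y))=(\iota_2\otimes\iota_2)((\nabla^{\Lambda,2}s_2)(f(y)))$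 for all smooth sections $s_1$ of $\Lambda^1(X_1)$, $s_2$ of $\Lambda^1(X_2)$ such that $s_1(y')$ and $s_2(f(y'))$ are compatible for all $y'\in Y$. **Induced objects.** The induced form $g^\Lambda$ on $\Lambda^1(X_1\cup_fX_2)$ is $g_1^\Lambda(\tilde\rho_1\cdot,\tilde\rho_1\cdot)$ over $X_1\setminus Y$, $g_2^\Lambda(\tilde\rho_2\cdot,\tilde\rho_2\cdot)$ over $X_2\setminus f(Y)$, and $\frac12\big(g_1^\Lambda(\tilde\rho_1\cdot,\tilde\rho_1\cdot)+g_2^\Lambda(\tilde\rho_2\cdot,\tilde\rho_2\cdot)\big)$ over $f(Y)$. The induced action $\tilde c$ is $\tilde c(\alpha)=c_1(\tilde\rho_1\alpha)$ over $X_1\setminus Y$ and $\tilde c(\alpha)=c_2(\tilde\rho_2\alpha)$ over $X_2$. A smooth section $s$ of $E_1\cup_{\tilde f'}E_2$ corresponds to a pair of smooth sections $s_1$ of $E_1$, $s_2$ of $E_2$ with $s_2\circ f=\tilde f'\circ s_1$. An induced connection $\nabla^\cup$ on $E_1\cup_{\tilde f'}E_2$ is determined by: $(\tilde\rho_1\otimes\mathrm{Id})(\nabla^\cup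 s)=\nabla^1s_1$ over $X_1\setminus Y$; $(\tilde\rho_2\otimes\mathrm{Id})(\nabla^\cup s)=\nabla^2s_2$ over $X_2\setminus f(Y)$; and, at $i_2(f(y))$ for $y\in Y$, both $(\tilde\rho_1\otimes\mathrm{Id})(\nabla^\cup s)=(\mathrm{Id}\otimes\tilde f')((\nabla^1s_1)(y))$ and $(\tilde\rho_2\otimes\mathrm{Id})(\nabla^\cup s)=(\nabla^2s_2)(f(y))$. Likewise, the induced connection $\nabla^\Lambda$ on $\Lambda^1(X_1\cup_fX_2)$ is determined by $(\tilde\rho_1\otimes\tilde\rho_1)(\nabla^\Lambda s)=\nabla^{\Lambda,1}(\tilde\rho_1\circ s\circ\tilde i_1)$ at all points of $\tilde i_1(X_1)$ and $(\tilde\rho_2\otimes\tilde\rho_2)(\nabla^\Lambda s)=\nabla^{\Lambda,2}(\tilde\rho_2\circ s\circ i_2)$ at all points of $i_2(X_2)$. **Theorem.** The induced connections $\nabla^\Lambda$ and $\nabla^\cup$ exist, and $\nabla^\cup$ is a Clifford connection on $E_1\cup_{\tilde f'}E_2$ for the induced action $\tilde c$ of $C\ell(\Lambda^1(X_1\cup_fX_2),g^\Lambda)$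 and the connection $\nabla^\Lambda$. (In particular, $\Lambda^1(X_1\cup_f X_2)$ has finite-dimensional fibres, $g^\Lambda$ is a pseudo-metric on it, $\nabla^\Lambda$ is Levi-Civita for $g^\Lambda$, $\tilde c$ is a smooth Clifford action on the finite-dimensional pseudo-bundle $E_1\cup_{\tilde f'}E_2$, $\nabla^\cup$ is a connection, and $\nabla^\cup_t(\tilde c(s)r)=\tilde c(\nabla^\Lambda_ts)(r)+\tilde c(s)(\nabla^\cup_tr)$ for all smooth sections $t$ of $(\Lambda^1(X_1\cup_fX_2))^*$, $s$ of $\Lambda^1(X_1\cup_fX_2)$ and $r$ of $E_1\cup_{\tilde f'}E_2$.) -/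

import Mathlib

open Set Topology Diffeology
open scoped ContDiff TensorProduct

universe u u₁ u₂ v w

noncomputable section

set_option linter.unusedSectionVars false

namespace DiffGlue

/-- The standard Euclidean space of dimension `n`, the domain of the `n`-plots. -/
abbrev Eu (n : ℕ) : Type := EuclideanSpace ℝ (Fin n)

/-! ### Constructing diffeologies -/

/-- Every point of an open set `U` has a neighbourhood that is a smooth "retract" of the whole
space, through a map with values in `U`. -/
theorem exists_cutoff {n : ℕ} {U : Set (Eu n)} (hU : IsOpen U) {x : Eu n} (hx : x ∈ U) :
    ∃ χ : Eu n → Eu n, ContDiff ℝ ∞ χ ∧ (∀ y, χ y ∈ U) ∧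
      ∃ V : Set (Eu n), IsOpen V ∧ x ∈ V ∧ ∀ y ∈ V, χ y = y := by
  obtain ⟨ε, hε, hb⟩ := Metric.isOpen_iff.1 hU x hx
  let B : ContDiffBump x := ⟨ε / 2, ε, by positivity, by linarith⟩
  refine ⟨fun y => x + B y • (y - x), ?_, ?_, Metric.ball x (ε / 2), Metric.isOpen_ball,
    Metric.mem_ball_self (by positivity), ?_⟩
  · exact contDiff_const.add (B.contDiff.smul (contDiff_id.sub contDiff_const))
  · intro y
    apply hb
    rw [Metric.mem_ball, dist_eq_norm, add_sub_cancel_left, norm_smul]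
    by_cases hy : dist y x < ε
    · have h1 : ‖B y‖ ≤ 1 := by
        rw [Real.norm_of_nonneg B.nonneg]
        exact B.le_one
      have h2 : ‖y - x‖ < ε := by rwa [← dist_eq_norm]
      nlinarith [norm_nonneg (y - x), norm_nonneg (B y)]
    · have h0 : B y = 0 := B.zero_of_le_dist (not_lt.1 hy)
      simpa [h0] using hε
  · intro y hy
    have h1 : B y = 1 := B.one_of_mem_closedBall (Metric.ball_subset_closedBall hy)
    simp [h1]

/-- The diffeology whose plots are the maps that coincide locally with a map satisfying `P`. -/
abbrev ofLocal {X : Type*} (P : ∀ n : ℕ, (Eu n → X) → Prop)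
    (hc : ∀ (n : ℕ) (x : X), P n (fun _ => x))
    (hr : ∀ (n m : ℕ) (p : Eu m → X) (g : Eu n → Eu m), P m p → ContDiff ℝ ∞ g → P n (p ∘ g)) :
    DiffeologicalSpace X where
  plots n := {p | ∀ x, ∃ U : Set (Eu n), IsOpen U ∧ x ∈ U ∧ ∃ q, P n q ∧ EqOn p q U}
  constant_plots x _ := ⟨univ, isOpen_univ, mem_univ _, _, hc _ x, fun _ _ => rfl⟩
  plot_reparam := by
    intro n m p g hp hg x
    obtain ⟨U, hU, hxU, q, hq, he⟩ := hp (g x)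
    exact ⟨g ⁻¹' U, hU.preimage hg.continuous, hxU, q ∘ g, hr _ _ _ _ hq hg,
      fun y hy => he hy⟩
  locality := by
    intro n p hp x
    obtain ⟨U, hU, hxU, h⟩ := hp x
    obtain ⟨χ, hχ, hχU, V, hV, hxV, hVχ⟩ := exists_cutoff hU hxU
    obtain ⟨W, hW, hxW, q, hq, he⟩ := h hχU hχ x
    refine ⟨W ∩ V, hW.inter hV, ⟨hxW, hxV⟩, q, hq, fun y hy => ?_⟩
    have := he hy.1
    simpa [hVχ y hy.2] using this

/-- The subset diffeology. -/
instance instSubtype {X : Type u} [DiffeologicalSpace X] (S : Set X) : DiffeologicalSpace S where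
  plots n := {p | IsPlot (fun z => (p z : X))}
  constant_plots x := isPlot_const
  plot_reparam := by
    intro n m p g hp hg
    exact isPlot_reparam (p := fun z => (p z : X)) hp hg
  locality := by
    intro n p hp
    exact DiffeologicalSpace.locality fun x => hp x

theorem dSmooth_val {X : Type u} [DiffeologicalSpace X] (S : Set X) :
    DSmooth (Subtype.val : S → X) := fun _ _ hp => hp

/-! ### Differential 1-forms and the pseudo-bundle `Λ¹(X)` -/

section Forms

variable (X : Type u) [DiffeologicalSpace X]

/-- The `n`-plots of `X`. -/
abbrev Plot (n : ℕ) : Type u := {p : Eu n → X // IsPlot p}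

variable {X} in
/-- The plot `p ∘ g`, for `g` smooth. -/
def Plot.comp {n m : ℕ} (p : Plot X m) (g : Eu n → Eu m) (hg : ContDiff ℝ ∞ g) : Plot X n :=
  ⟨p.1 ∘ g, isPlot_reparam p.2 hg⟩

/-- The assignments of a 1-form on `ℝⁿ`, not necessarily smooth, to each plot `ℝⁿ → X`. -/
def PreForm : Type u := ∀ n : ℕ, Plot X n → Eu n → (Eu n →L[ℝ] ℝ)

instance : AddCommGroup (PreForm X) :=
  inferInstanceAs (AddCommGroup (∀ n : ℕ, Plot X n → Eu n → (Eu n →L[ℝ] ℝ)))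
instance : Module ℝ (PreForm X) :=
  inferInstanceAs (Module ℝ (∀ n : ℕ, Plot X n → Eu n → (Eu n →L[ℝ] ℝ)))

/-- `Ω¹(X)`: a differential 1-form assigns to each plot `p : ℝⁿ → X` a smooth 1-form on `ℝⁿ`,
in such a way that `η (p ∘ g) = g^* (η p)` for all smooth `g`. -/
def Form : Submodule ℝ (PreForm X) where
  carrier := {η | (∀ n (p : Plot X n), ContDiff ℝ ∞ (η n p)) ∧
    ∀ n m (p : Plot X m) (g : Eu n → Eu m) (hg : ContDiff ℝ ∞ g) (z : Eu n),
      η n (p.comp g hg) z = (η m p (g z)).comp (fderiv ℝ g z)}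
  add_mem' := by
    rintro a b ⟨ha, ha'⟩ ⟨hb, hb'⟩
    refine ⟨fun n p => (ha n p).add (hb n p), fun n m p g hg z => ?_⟩
    change a n (p.comp g hg) z + b n (p.comp g hg) z = (a m p (g z) + b m p (g z)).comp _
    rw [ha' n m p g hg z, hb' n m p g hg z, ContinuousLinearMap.add_comp]
  zero_mem' := ⟨fun _ _ => contDiff_const, fun _ _ _ _ _ _ => (ContinuousLinearMap.zero_comp _).symm⟩
  smul_mem' := by
    rintro c a ⟨ha, ha'⟩
    refine ⟨fun n p => (ha n p).const_smul c, fun n m p g hg z => ?_⟩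
    change c • a n (p.comp g hg) z = (c • a m p (g z)).comp _
    rw [ha' n m p g hg z, ContinuousLinearMap.smul_comp]

/-- The functional diffeology on `Ω¹(X)`. -/
instance instForm : DiffeologicalSpace (Form X) where
  plots k := {φ | ∀ n (p : Plot X n),
    ContDiff ℝ ∞ (fun z : Eu k × Eu n => (φ z.1).1 n p z.2)}
  constant_plots η n p := (η.2.1 n p).comp contDiff_snd
  plot_reparam := by
    intro k m φ g hφ hg n p
    exact (hφ n p).comp ((hg.comp contDiff_fst).prodMk contDiff_snd)
  locality := by
    intro k φ hφ n p
    rw [contDiff_iff_contDiffAt]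
    rintro ⟨s, r⟩
    obtain ⟨U, hU, hsU, h⟩ := hφ s
    obtain ⟨χ, hχ, hχU, V, hV, hsV, hVχ⟩ := exists_cutoff hU hsU
    refine ((h hχU hχ n p).contDiffAt (x := (s, r))).congr_of_eventuallyEq ?_
    have : ∀ᶠ z : Eu k × Eu n in 𝓝 (s, r), z.1 ∈ V :=
      continuous_fst.continuousAt.eventually (hV.mem_nhds hsV)
    filter_upwards [this] with z hz
    simp [hVχ z.1 hz]

/-- The 1-forms vanishing at `x`. -/
def Vanish (x : X) : Submodule ℝ (Form X) where
  carrier := {η | ∀ n (p : Plot X n), p.1 0 = x → η.1 n p 0 = 0}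
  add_mem' := by
    intro a b ha hb n p hp
    change a.1 n p 0 + b.1 n p 0 = 0
    rw [ha n p hp, hb n p hp, add_zero]
  zero_mem' := fun _ _ _ => rfl
  smul_mem' := by
    intro c a ha n p hp
    change c • a.1 n p 0 = 0
    rw [ha n p hp, smul_zero]

/-- The fibre at `x` of the pseudo-bundle `Λ¹(X)` of values of 1-forms. -/
def Lam (x : X) : Type u := Form X ⧸ Vanish X x

instance (x : X) : AddCommGroup (Lam X x) := inferInstanceAs (AddCommGroup (Form X ⧸ Vanish X x))
instance (x : X) : Module ℝ (Lam X x) := inferInstanceAs (Module ℝ (Form X ⧸ Vanish X x))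

variable {X}

/-- The value at `x` of a 1-form. -/
def Lam.mk (x : X) : Form X →ₗ[ℝ] Lam X x := (Vanish X x).mkQ

/-- The diffeology of the total space of `Λ¹(X)`: the quotient diffeology for the projection of
`X × Ω¹(X)`. -/
instance instLam : DiffeologicalSpace (Sigma (Lam X)) :=
  ofLocal (fun n q => ∃ (b : Eu n → X) (η : Eu n → Form X), IsPlot b ∧ IsPlot η ∧
      q = fun z => ⟨b z, Lam.mk (b z) (η z)⟩)
    (by
      rintro n ⟨x, a⟩
      obtain ⟨η, rfl⟩ := Submodule.mkQ_surjective _ a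
      exact ⟨fun _ => x, fun _ => η, isPlot_const, isPlot_const, rfl⟩)
    (by
      rintro n m _ g ⟨b, η, hb, hη, rfl⟩ hg
      exact ⟨b ∘ g, η ∘ g, isPlot_reparam hb hg, isPlot_reparam hη hg, rfl⟩)

/-- The pullback of 1-forms by a smooth map. -/
def Form.pull {A : Type u₁} {B : Type u₂} [DiffeologicalSpace A] [DiffeologicalSpace B]
    (φ : A → B) (hφ : DSmooth φ) : Form B →ₗ[ℝ] Form A where
  toFun η := ⟨fun n p => η.1 n ⟨φ ∘ p.1, hφ _ _ p.2⟩, fun n _ => η.2.1 n _,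
    fun n m p g hg z => η.2.2 n m ⟨φ ∘ p.1, hφ _ _ p.2⟩ g hg z⟩
  map_add' _ _ := rfl
  map_smul' _ _ := rfl

/-- The map `Λ¹_b(B) → Λ¹_a(A)` induced by the pullback of 1-forms by a smooth map `φ : A → B`
with `φ a = b`. -/
def Lam.pull {A : Type u₁} {B : Type u₂} [DiffeologicalSpace A] [DiffeologicalSpace B]
    (φ : A → B) (hφ : DSmooth φ) {a : A} {b : B} (h : φ a = b) : Lam B b →ₗ[ℝ] Lam A a :=
  Submodule.mapQ _ _ (Form.pull φ hφ) (by
    intro η hη n p hp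
    exact hη n ⟨φ ∘ p.1, hφ _ _ p.2⟩ (by simp [hp, h]))

/-- The differential `dh ∈ Ω¹(X)` of a smooth function `h : X → ℝ`. -/
def Form.d (h : X → ℝ) (hh : DSmooth h) : Form X :=
  ⟨fun n p => fderiv ℝ (h ∘ p.1), by
    have key : ∀ n (p : Plot X n), ContDiff ℝ ∞ (h ∘ p.1) := fun n p =>
      isPlot_iff_contDiff.1 (hh _ _ p.2)
    refine ⟨fun n p => (key n p).fderiv_right (by simp), fun n m p g hg z => ?_⟩
    have h1 : DifferentiableAt ℝ (h ∘ p.1) (g z) :=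
      ((key m p).differentiable (by simp)).differentiableAt
    have h2 : DifferentiableAt ℝ g z := (hg.differentiable (by simp)).differentiableAt
    exact fderiv_comp z h1 h2⟩

open Classical in
/-- The section `dh` of `Λ¹(X)`; the value `0` for a function `h` that is not smooth is
irrelevant. -/
def dLam (h : X → ℝ) (x : X) : Lam X x :=
  if hh : DSmooth h then Lam.mk x (Form.d h hh) else 0

end Forms

/-! ### Pseudo-bundles, given by a family of vector spaces and a diffeology on the total space -/

section Bundles

variable {X : Type u} [DiffeologicalSpace X]

/-- The map `z ↦ (b z, s z)` is a plot of the total space of the family `E`. -/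
def PlotOver (E : X → Type v) [DiffeologicalSpace (Sigma E)] {n : ℕ} (b : Eu n → X)
    (s : ∀ z, E (b z)) : Prop :=
  IsPlot (fun z => (⟨b z, s z⟩ : Sigma E))

theorem PlotOver.comp {E : X → Type v} [DiffeologicalSpace (Sigma E)] {n m : ℕ} {b : Eu m → X}
    {s : ∀ z, E (b z)} (h : PlotOver E b s) {g : Eu n → Eu m} (hg : ContDiff ℝ ∞ g) :
    PlotOver E (fun z => b (g z)) (fun z => s (g z)) :=
  isPlot_reparam h hg

/-- Diffeological vector pseudo-bundles: the projection is smooth, and so are the fibrewise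
addition on the fibre product, the multiplication by scalars and the zero section. -/
structure IsPseudoBundle (E : X → Type v) [∀ x, AddCommGroup (E x)] [∀ x, Module ℝ (E x)]
    [DiffeologicalSpace (Sigma E)] : Prop where
  proj : DSmooth (Sigma.fst : Sigma E → X)
  add : ∀ (n : ℕ) (b : Eu n → X) (s t : ∀ z, E (b z)), PlotOver E b s → PlotOver E b t →
    PlotOver E b (fun z => s z + t z)
  smul : ∀ (n : ℕ) (b : Eu n → X) (a : Eu n → ℝ) (s : ∀ z, E (b z)), ContDiff ℝ ∞ a →
    PlotOver E b s → PlotOver E b (fun z => a z • s z)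
  zero : DSmooth (fun x => (⟨x, 0⟩ : Sigma E))

/-- Smooth sections. -/
def IsSmoothSection {E : X → Type v} [DiffeologicalSpace (Sigma E)] (s : ∀ x, E x) : Prop :=
  DSmooth (fun x => (⟨x, s x⟩ : Sigma E))

/-- Plots, for the functional diffeology, of the space of smooth sections. -/
def IsSectionPlot {E : X → Type v} [DiffeologicalSpace (Sigma E)] {k : ℕ}
    (q : Eu k → ∀ x, E x) : Prop :=
  ∀ (n : ℕ) (r : Eu n → Eu k) (p : Eu n → X), ContDiff ℝ ∞ r → IsPlot p →
    PlotOver E p (fun z => q (r z) (p z))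

/-! #### Tensor products -/

section Tensor

variable (E : X → Type v) (F : X → Type w) [∀ x, AddCommGroup (E x)] [∀ x, Module ℝ (E x)]
  [∀ x, AddCommGroup (F x)] [∀ x, Module ℝ (F x)]

/-- The fibres of the tensor product of two pseudo-bundles. -/
def Tens (x : X) : Type (max v w) := E x ⊗[ℝ] F x

instance (x : X) : AddCommGroup (Tens E F x) := inferInstanceAs (AddCommGroup (E x ⊗[ℝ] F x))
instance (x : X) : Module ℝ (Tens E F x) := inferInstanceAs (Module ℝ (E x ⊗[ℝ] F x))

variable {E F} in
/-- Pure tensors. -/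
def Tens.tmul {x : X} (a : E x) (b : F x) : Tens E F x := a ⊗ₜ[ℝ] b

variable [DiffeologicalSpace (Sigma E)] [DiffeologicalSpace (Sigma F)]

/-- The diffeology of the tensor product: its plots are locally the finite sums of the tensor
products of plots of the two factors that have the same projection to the base. -/
instance instTens : DiffeologicalSpace (Sigma (Tens E F)) :=
  ofLocal (fun n q => ∃ (b : Eu n → X) (L : List ((∀ z, E (b z)) × (∀ z, F (b z)))), IsPlot b ∧
      (∀ s ∈ L, PlotOver E b s.1 ∧ PlotOver F b s.2) ∧
      q = fun z => ⟨b z, (L.map fun s => Tens.tmul (s.1 z) (s.2 z)).sum⟩)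
    (by
      rintro n ⟨x, t⟩
      refine ⟨fun _ => x, ?_⟩
      suffices h : ∃ L : List (E x × F x), t = (L.map fun s => Tens.tmul s.1 s.2).sum by
        obtain ⟨L, rfl⟩ := h
        refine ⟨L.map fun s => (fun _ => s.1, fun _ => s.2), isPlot_const, ?_, ?_⟩
        · intro s hs
          obtain ⟨a, _, rfl⟩ := List.mem_map.1 hs
          exact ⟨isPlot_const (x := (⟨x, a.1⟩ : Sigma E)), isPlot_const (x := (⟨x, a.2⟩ : Sigma F))⟩
        · simp [List.map_map, Function.comp_def]
      induction t using TensorProduct.induction_on with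
      | zero => exact ⟨[], rfl⟩
      | tmul a b => exact ⟨[(a, b)], (add_zero _).symm⟩
      | add a b ha hb =>
        obtain ⟨L, hL⟩ := ha
        obtain ⟨M, hM⟩ := hb
        exact ⟨L ++ M, by rw [List.map_append, List.sum_append, ← hL, ← hM]; rfl⟩)
    (by
      rintro n m _ g ⟨b, L, hb, hL, rfl⟩ hg
      refine ⟨b ∘ g, L.map fun s => (fun z => s.1 (g z), fun z => s.2 (g z)),
        isPlot_reparam hb hg, ?_, ?_⟩
      · intro s hs
        obtain ⟨a, ha, rfl⟩ := List.mem_map.1 hs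
        exact ⟨(hL a ha).1.comp hg, (hL a ha).2.comp hg⟩
      · funext z
        simp [List.map_map, Function.comp_def])

end Tensor

/-! #### Duals -/

section Dual

variable (E : X → Type v) [∀ x, AddCommGroup (E x)] [∀ x, Module ℝ (E x)]
  [DiffeologicalSpace (Sigma E)]

/-- The smooth linear functionals on the fibre at `x`, for its subset diffeology. -/
def smoothDual (x : X) : Submodule ℝ (Module.Dual ℝ (E x)) where
  carrier := {ℓ | ∀ (n : ℕ) (s : Eu n → E x), PlotOver E (fun _ => x) s →
    ContDiff ℝ ∞ (fun z => ℓ (s z))}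
  add_mem' := fun ha hb n s hs => (ha n s hs).add (hb n s hs)
  zero_mem' := fun _ _ _ => contDiff_const
  smul_mem' := fun c _ ha n s hs => (ha n s hs).const_smul c

/-- The fibres of the dual pseudo-bundle. -/
def DualFam (x : X) : Type v := smoothDual E x

instance (x : X) : AddCommGroup (DualFam E x) := inferInstanceAs (AddCommGroup (smoothDual E x))
instance (x : X) : Module ℝ (DualFam E x) := inferInstanceAs (Module ℝ (smoothDual E x))

variable {E} in
/-- The functional given by an element of the dual pseudo-bundle. -/
def DualFam.toDual (x : X) : DualFam E x →ₗ[ℝ] Module.Dual ℝ (E x) := (smoothDual E x).subtype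

/-- The dual diffeology: `p` is a plot if it covers a plot of the base and if its evaluation on
any plot of `E` is smooth wherever it makes sense. -/
instance instDual : DiffeologicalSpace (Sigma (DualFam E)) where
  plots n := {p | IsPlot (fun z => (p z).1) ∧
    ∀ (k : ℕ) (r : Eu k → Eu n) (s : ∀ z, E (p (r z)).1), ContDiff ℝ ∞ r →
      PlotOver E (fun z => (p (r z)).1) s →
      ContDiff ℝ ∞ (fun z => DualFam.toDual _ (p (r z)).2 (s z))}
  constant_plots ℓ := ⟨isPlot_const, fun k _ s _ hs => ℓ.2.2 k s hs⟩
  plot_reparam := by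
    rintro n m p g ⟨h1, h2⟩ hg
    exact ⟨isPlot_reparam h1 hg, fun k r s hr hs => h2 k (g ∘ r) s (hg.comp hr) hs⟩
  locality := by
    intro n p hp
    refine ⟨DiffeologicalSpace.locality fun x => ?_, fun k r s hr hs => ?_⟩
    · obtain ⟨U, hU, hxU, h⟩ := hp x
      exact ⟨U, hU, hxU, fun hf hf' => (h hf hf').1⟩
    · rw [contDiff_iff_contDiffAt]
      intro x
      obtain ⟨U, hU, hxU, h⟩ := hp (r x)
      obtain ⟨χ, hχ, hχU, V, hV, hxV, hVχ⟩ :=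
        exists_cutoff (hU.preimage hr.continuous) (x := x) hxU
      have h1 := (h (f := r ∘ χ) hχU (hr.comp hχ)).2 k id (fun z => s (χ z)) contDiff_id
        (hs.comp hχ)
      refine (h1.contDiffAt (x := x)).congr_of_eventuallyEq ?_
      filter_upwards [hV.mem_nhds hxV] with z hz
      have hc : χ z = z := hVχ z hz
      change DualFam.toDual _ (p (r z)).2 (s z) = DualFam.toDual _ (p (r (χ z))).2 (s (χ z))
      congr! <;> exact hc.symm

end Dual

/-! #### Pseudo-metrics -/

section Metric

variable {E : X → Type v} [∀ x, AddCommGroup (E x)] [∀ x, Module ℝ (E x)]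
  [DiffeologicalSpace (Sigma E)]

/-- The value on the pair `(a, b)` of the bilinear form given by an element of `E^* ⊗ E^*`. -/
def evalPair {x : X} (T : Tens (DualFam E) (DualFam E) x) (a b : E x) : ℝ :=
  LinearMap.mul' ℝ ℝ (TensorProduct.map
    ((LinearMap.applyₗ (R := ℝ) a).comp (DualFam.toDual x))
    ((LinearMap.applyₗ (R := ℝ) b).comp (DualFam.toDual x)) T)

/-- Pseudo-metrics: smooth sections of `E^* ⊗ E^*` that are, on each fibre, symmetric and positive
semidefinite, and whose rank is the dimension of the fibre of the dual pseudo-bundle. -/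
structure IsPseudoMetric (g : ∀ x, E x →ₗ[ℝ] E x →ₗ[ℝ] ℝ) : Prop where
  smooth : ∃ T : ∀ x, Tens (DualFam E) (DualFam E) x, IsSmoothSection T ∧
    ∀ x a b, g x a b = evalPair (T x) a b
  symm : ∀ x a b, g x a b = g x b a
  nonneg : ∀ x a, 0 ≤ g x a a
  rank : ∀ x, Module.finrank ℝ (LinearMap.ker (g x)) + Module.finrank ℝ (DualFam E x) =
    Module.finrank ℝ (E x)

end Metric

/-! #### Clifford algebras and Clifford actions -/

section Clifford

variable {V : X → Type v} [∀ x, AddCommGroup (V x)] [∀ x, Module ℝ (V x)]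

/-- The fibre at `x` of `Cl(V, g)`, with the sign convention `v * v = - g (v, v)`. -/
def Cliff (g : ∀ x, V x →ₗ[ℝ] V x →ₗ[ℝ] ℝ) (x : X) : Type v :=
  CliffordAlgebra (-(LinearMap.BilinMap.toQuadraticMap (g x)))

instance (g : ∀ x, V x →ₗ[ℝ] V x →ₗ[ℝ] ℝ) (x : X) : Ring (Cliff g x) :=
  inferInstanceAs (Ring (CliffordAlgebra (-(LinearMap.BilinMap.toQuadraticMap (g x)))))
instance (g : ∀ x, V x →ₗ[ℝ] V x →ₗ[ℝ] ℝ) (x : X) : Algebra ℝ (Cliff g x) :=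
  inferInstanceAs (Algebra ℝ (CliffordAlgebra (-(LinearMap.BilinMap.toQuadraticMap (g x)))))

/-- The inclusion of `V` in `Cl(V, g)`. -/
def Cliff.ι (g : ∀ x, V x →ₗ[ℝ] V x →ₗ[ℝ] ℝ) (x : X) : V x →ₗ[ℝ] Cliff g x :=
  CliffordAlgebra.ι (-(LinearMap.BilinMap.toQuadraticMap (g x)))

theorem Cliff.exists_list (g : ∀ x, V x →ₗ[ℝ] V x →ₗ[ℝ] ℝ) (x : X) (a : Cliff g x) :
    ∃ L : List (ℝ × List (V x)),
      a = (L.map fun s => s.1 • (s.2.map (Cliff.ι g x)).prod).sum := by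
  have h1 : a ∈ Submodule.span ℝ
      (Submonoid.closure (range (Cliff.ι g x)) : Set (Cliff g x)) := by
    rw [← Algebra.adjoin_eq_span]
    have h2 : Algebra.adjoin ℝ (range (Cliff.ι g x)) = ⊤ := CliffordAlgebra.adjoin_range_ι
    rw [h2]
    trivial
  induction h1 using Submodule.span_induction with
  | mem b hb =>
    obtain ⟨l, hl, rfl⟩ := Submonoid.exists_list_of_mem_closure hb
    have : ∃ l' : List (V x), l = l'.map (Cliff.ι g x) := by
      clear hb
      induction l with
      | nil => exact ⟨[], rfl⟩
      | cons c l ih =>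
        obtain ⟨l', rfl⟩ := ih fun y hy => hl y (List.mem_cons_of_mem _ hy)
        obtain ⟨c', rfl⟩ := hl c List.mem_cons_self
        exact ⟨c' :: l', rfl⟩
    obtain ⟨l', rfl⟩ := this
    exact ⟨[(1, l')], by simp⟩
  | zero => exact ⟨[], by simp⟩
  | add b c _ _ hb hc =>
    obtain ⟨L, hL⟩ := hb
    obtain ⟨M, hM⟩ := hc
    exact ⟨L ++ M, by rw [List.map_append, List.sum_append, ← hL, ← hM]⟩
  | smul r b _ hb =>
    obtain ⟨L, rfl⟩ := hb
    refine ⟨L.map fun s => (r * s.1, s.2), ?_⟩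
    simp [List.smul_sum, List.map_map, Function.comp_def, mul_smul]

variable [DiffeologicalSpace (Sigma V)]

/-- The diffeology of the pseudo-bundle `Cl(V, g)`: its plots are locally the linear combinations,
with smooth coefficients, of products of plots of `V` that have the same projection to the base. -/
instance instCliff (g : ∀ x, V x →ₗ[ℝ] V x →ₗ[ℝ] ℝ) : DiffeologicalSpace (Sigma (Cliff g)) :=
  ofLocal (fun n q => ∃ (b : Eu n → X) (L : List ((Eu n → ℝ) × List (∀ z, V (b z)))), IsPlot b ∧
      (∀ s ∈ L, ContDiff ℝ ∞ s.1 ∧ ∀ t ∈ s.2, PlotOver V b t) ∧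
      q = fun z => ⟨b z,
        (L.map fun s => s.1 z • (s.2.map fun t => Cliff.ι g (b z) (t z)).prod).sum⟩)
    (by
      rintro n ⟨x, a⟩
      obtain ⟨L, rfl⟩ := Cliff.exists_list g x a
      refine ⟨fun _ => x, L.map fun s => (fun _ => s.1, s.2.map fun t _ => t), isPlot_const,
        ?_, ?_⟩
      · intro s hs
        obtain ⟨a, _, rfl⟩ := List.mem_map.1 hs
        refine ⟨contDiff_const, fun t ht => ?_⟩
        obtain ⟨c, _, rfl⟩ := List.mem_map.1 ht
        exact isPlot_const (x := (⟨x, c⟩ : Sigma V))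
      · simp [List.map_map, Function.comp_def])
    (by
      rintro n m _ g' ⟨b, L, hb, hL, rfl⟩ hg
      refine ⟨b ∘ g', L.map fun s => (fun z => s.1 (g' z), s.2.map fun t z => t (g' z)),
        isPlot_reparam hb hg, ?_, ?_⟩
      · intro s hs
        obtain ⟨a, ha, rfl⟩ := List.mem_map.1 hs
        refine ⟨(hL a ha).1.comp hg, fun t ht => ?_⟩
        obtain ⟨c, hc, rfl⟩ := List.mem_map.1 ht
        exact ((hL a ha).2 c hc).comp hg
      · funext z
        simp [List.map_map, Function.comp_def])

/-- `c` (defined on `V`) extends to a smooth action of `Cl(V, g)` on the pseudo-bundle `E`. -/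
def IsCliffordAction {E : X → Type w} [∀ x, AddCommGroup (E x)] [∀ x, Module ℝ (E x)]
    [DiffeologicalSpace (Sigma E)] (g : ∀ x, V x →ₗ[ℝ] V x →ₗ[ℝ] ℝ)
    (c : ∀ x, V x →ₗ[ℝ] Module.End ℝ (E x)) : Prop :=
  ∃ C : ∀ x, Cliff g x →ₐ[ℝ] Module.End ℝ (E x),
    (∀ x a, C x (Cliff.ι g x a) = c x a) ∧
    ∀ (n : ℕ) (b : Eu n → X) (a : ∀ z, Cliff g (b z)) (e : ∀ z, E (b z)),
      PlotOver (Cliff g) b a → PlotOver E b e → PlotOver E b (fun z => C (b z) (a z) (e z))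

end Clifford

/-! #### Connections -/

section Connection

variable {E : X → Type v} [∀ x, AddCommGroup (E x)] [∀ x, Module ℝ (E x)]
  [DiffeologicalSpace (Sigma E)]

/-- Diffeological connections: smooth linear operators `C^∞(X, E) → C^∞(X, Λ¹(X) ⊗ E)` that satisfy
the Leibniz rule. The values on sections that are not smooth are irrelevant. -/
structure IsConnection (D : (∀ x, E x) → ∀ x, Tens (Lam X) E x) : Prop where
  smooth : ∀ (k : ℕ) (q : Eu k → ∀ x, E x), IsSectionPlot q → IsSectionPlot (fun z => D (q z))
  add : ∀ s t : ∀ x, E x, IsSmoothSection s → IsSmoothSection t → ∀ x,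
    D (fun x => s x + t x) x = D s x + D t x
  smul : ∀ (a : ℝ) (s : ∀ x, E x), IsSmoothSection s → ∀ x, D (fun x => a • s x) x = a • D s x
  leibniz : ∀ (h : X → ℝ) (s : ∀ x, E x), DSmooth h → IsSmoothSection s → ∀ x,
    D (fun x => h x • s x) x = Tens.tmul (dLam h x) (s x) + h x • D s x

/-- Contraction of an element of `Λ¹(X) ⊗ E` with a functional on `Λ¹(X)`. -/
def contract {x : X} (ℓ : Module.Dual ℝ (Lam X x)) : Tens (Lam X) E x →ₗ[ℝ] E x :=
  (TensorProduct.lid ℝ (E x)).toLinearMap.comp (TensorProduct.map ℓ LinearMap.id)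

/-- Contraction of an element of `Λ¹(X) ⊗ E` with a functional on `E`. -/
def contractRight {x : X} (ℓ : Module.Dual ℝ (E x)) : Tens (Lam X) E x →ₗ[ℝ] Lam X x :=
  (TensorProduct.rid ℝ (Lam X x)).toLinearMap.comp (TensorProduct.map LinearMap.id ℓ)

/-- The covariant derivative along `t`. -/
def cov (D : (∀ x, E x) → ∀ x, Tens (Lam X) E x) (t : ∀ x, Module.Dual ℝ (Lam X x))
    (s : ∀ x, E x) (x : X) : E x :=
  contract (t x) (D s x)

/-- The connection is compatible with the pseudo-metric:
`d (g(s, t)) = g(∇ s, t) + g(s, ∇ t)`. -/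
def IsMetricConnection (g : ∀ x, E x →ₗ[ℝ] E x →ₗ[ℝ] ℝ)
    (D : (∀ x, E x) → ∀ x, Tens (Lam X) E x) : Prop :=
  ∀ s t : ∀ x, E x, IsSmoothSection s → IsSmoothSection t → ∀ x,
    dLam (fun x => g x (s x) (t x)) x =
      contractRight ((g x).flip (t x)) (D s x) + contractRight (g x (s x)) (D t x)

/-- The action of a section of the dual of `Λ¹(X)` on functions: `t(h) = t(dh)`. -/
def act (t : ∀ x, Module.Dual ℝ (Lam X x)) (h : X → ℝ) (x : X) : ℝ := t x (dLam h x)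

/-- `b` is the Lie bracket of `t₁` and `t₂`: it acts on functions as their commutator. -/
def IsLieBracket (t₁ t₂ b : ∀ x, Module.Dual ℝ (Lam X x)) : Prop :=
  ∀ h : X → ℝ, DSmooth h → ∀ x, act b h x = act t₁ (act t₂ h) x - act t₂ (act t₁ h) x

/-- `D` is a Levi-Civita connection on `(Λ¹(X), g)`: it is compatible with `g` and symmetric,
`∇_{s₁} s₂ - ∇_{s₂} s₁ = [s₁, s₂]`, where sections of `Λ¹(X)` are identified with sections of the
dual by means of the pairing map `s ↦ g(s, ·)`. -/
structure IsLeviCivita (g : ∀ x, Lam X x →ₗ[ℝ] Lam X x →ₗ[ℝ] ℝ)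
    (D : (∀ x, Lam X x) → ∀ x, Tens (Lam X) (Lam X) x) : Prop where
  connection : IsConnection D
  metric : IsMetricConnection g D
  symmetric : ∀ s₁ s₂ : ∀ x, Lam X x, IsSmoothSection s₁ → IsSmoothSection s₂ →
    IsLieBracket (fun x => g x (s₁ x)) (fun x => g x (s₂ x))
      (fun x => g x (cov D (fun x => g x (s₁ x)) s₂ x - cov D (fun x => g x (s₂ x)) s₁ x))

/-- `D` is a Clifford connection on `E`, where `Λ¹(X)` has finite-dimensional fibres and carries the
pseudo-metric `g` with Levi-Civita connection `DΛ`, and `E` is a finite-dimensional pseudo-bundle of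
Clifford modules over `Cl(Λ¹(X), g)` with Clifford action `c`. -/
structure IsCliffordConnection (g : ∀ x, Lam X x →ₗ[ℝ] Lam X x →ₗ[ℝ] ℝ)
    (DΛ : (∀ x, Lam X x) → ∀ x, Tens (Lam X) (Lam X) x)
    (c : ∀ x, Lam X x →ₗ[ℝ] Module.End ℝ (E x))
    (D : (∀ x, E x) → ∀ x, Tens (Lam X) E x) : Prop where
  finite_lam : ∀ x, FiniteDimensional ℝ (Lam X x)
  metric : IsPseudoMetric g
  leviCivita : IsLeviCivita g DΛ
  bundle : IsPseudoBundle E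
  finite : ∀ x, FiniteDimensional ℝ (E x)
  action : IsCliffordAction g c
  connection : IsConnection D
  clifford : ∀ (t : ∀ x, DualFam (Lam X) x) (s : ∀ x, Lam X x) (r : ∀ x, E x),
    IsSmoothSection t → IsSmoothSection s → IsSmoothSection r → ∀ x,
      cov D (fun x => DualFam.toDual x (t x)) (fun x => c x (s x) (r x)) x =
        c x (cov DΛ (fun x => DualFam.toDual x (t x)) s x) (r x) +
        c x (s x) (cov D (fun x => DualFam.toDual x (t x)) r x)

end Connection

end Bundles

/-! ### Gluing -/

section Glue

variable {X₁ : Type u₁} {X₂ : Type u₂} [DiffeologicalSpace X₁] [DiffeologicalSpace X₂] {Y : Set X₁}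

/-- `f` is a diffeomorphism of `Y` with its image in `X₂`, for the subset diffeologies. -/
structure IsGluingMap (f : Y → X₂) : Prop where
  injective : Function.Injective f
  isPlot_iff : ∀ (n : ℕ) (p : Eu n → Y), IsPlot p ↔ IsPlot (f ∘ p)

theorem IsGluingMap.dSmooth {f : Y → X₂} (hf : IsGluingMap f) : DSmooth f :=
  fun n p hp => (hf.isPlot_iff n p).1 hp

/-- The glued space `X₁ ∪_f X₂`, realized as the set `(X₁ ∖ Y) ⊔ X₂` of canonical representatives
of the quotient of `X₁ ⊔ X₂` by `y ~ f y`. -/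
inductive Glue (f : Y → X₂) : Type (max u₁ u₂)
  | left (x : X₁) (h : x ∉ Y)
  | right (z : X₂)

open Classical in
/-- The natural map `X₁ → X₁ ∪_f X₂`. -/
def Glue.i₁ (f : Y → X₂) (x : X₁) : Glue f :=
  if h : x ∈ Y then Glue.right (f ⟨x, h⟩) else Glue.left x h

/-- The natural map `X₂ → X₁ ∪_f X₂`. -/
def Glue.i₂ (f : Y → X₂) (z : X₂) : Glue f := Glue.right z

theorem Glue.i₁_of_mem (f : Y → X₂) (y : Y) : Glue.i₁ f y = Glue.right (f y) := dif_pos y.2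

theorem Glue.i₁_of_notMem (f : Y → X₂) {x : X₁} (h : x ∉ Y) : Glue.i₁ f x = Glue.left x h :=
  dif_neg h

/-- The glued space is the quotient of `X₁ ⊔ X₂` by the equivalence relation generated by
`y ~ f y`. -/
theorem Glue.elim_eq_iff (f : Y → X₂) (a b : X₁ ⊕ X₂) :
    Sum.elim (Glue.i₁ f) (Glue.i₂ f) a = Sum.elim (Glue.i₁ f) (Glue.i₂ f) b ↔
      Relation.EqvGen (fun a b => ∃ y : Y, a = Sum.inl (y : X₁) ∧ b = Sum.inr (f y)) a b := by
  constructor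
  · let rep : Glue f → X₁ ⊕ X₂ := fun g => match g with
      | Glue.left x _ => Sum.inl x
      | Glue.right z => Sum.inr z
    have key : ∀ c : X₁ ⊕ X₂, Relation.EqvGen
        (fun a b : X₁ ⊕ X₂ => ∃ y : Y, a = Sum.inl (y : X₁) ∧ b = Sum.inr (f y)) c
        (rep (Sum.elim (Glue.i₁ f) (Glue.i₂ f) c)) := by
      rintro (x | z)
      · by_cases h : x ∈ Y
        · rw [Sum.elim_inl, Glue.i₁_of_mem f ⟨x, h⟩]
          exact .rel _ _ ⟨⟨x, h⟩, rfl, rfl⟩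
        · rw [Sum.elim_inl, Glue.i₁_of_notMem f h]
          exact .refl _
      · exact .refl _
    intro h
    have h1 := key a
    rw [h] at h1
    exact h1.trans _ _ _ ((key b).symm _ _)
  · intro h
    induction h with
    | rel a b h =>
      obtain ⟨y, rfl, rfl⟩ := h
      exact Glue.i₁_of_mem f y
    | refl => rfl
    | symm _ _ _ ih => exact ih.symm
    | trans _ _ _ _ _ ih ih' => exact ih.trans ih'

/-- The gluing diffeology: the plots are locally compositions of plots of `X₁` or of `X₂` with the
natural map. -/
instance instGlue (f : Y → X₂) : DiffeologicalSpace (Glue f) :=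
  ofLocal (fun n q => (∃ p : Eu n → X₁, IsPlot p ∧ q = Glue.i₁ f ∘ p) ∨
      ∃ p : Eu n → X₂, IsPlot p ∧ q = Glue.i₂ f ∘ p)
    (by
      rintro n (⟨x, h⟩ | z)
      · exact .inl ⟨fun _ => x, isPlot_const, funext fun _ => (Glue.i₁_of_notMem f h).symm⟩
      · exact .inr ⟨fun _ => z, isPlot_const, rfl⟩)
    (by
      rintro n m _ g (⟨p, hp, rfl⟩ | ⟨p, hp, rfl⟩) hg
      · exact .inl ⟨p ∘ g, isPlot_reparam hp hg, rfl⟩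
      · exact .inr ⟨p ∘ g, isPlot_reparam hp hg, rfl⟩)

theorem Glue.dSmooth_i₁ (f : Y → X₂) : DSmooth (Glue.i₁ f) := fun _ p hp _ =>
  ⟨univ, isOpen_univ, mem_univ _, _, .inl ⟨p, hp, rfl⟩, fun _ _ => rfl⟩

theorem Glue.dSmooth_i₂ (f : Y → X₂) : DSmooth (Glue.i₂ f) := fun _ p hp _ =>
  ⟨univ, isOpen_univ, mem_univ _, _, .inr ⟨p, hp, rfl⟩, fun _ _ => rfl⟩

/-- The map `Λ¹(X₁ ∪_f X₂) → Λ¹(X₁)` over the image of `X₁`, on the fibre at `z = i₁ x`. -/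
def rho₁ (f : Y → X₂) {x : X₁} {z : Glue f} (h : Glue.i₁ f x = z) :
    Lam (Glue f) z →ₗ[ℝ] Lam X₁ x :=
  Lam.pull (Glue.i₁ f) (Glue.dSmooth_i₁ f) h

/-- The map `Λ¹(X₁ ∪_f X₂) → Λ¹(X₂)` over the image of `X₂`, on the fibre at `z = i₂ x`. -/
def rho₂ (f : Y → X₂) {x : X₂} {z : Glue f} (h : Glue.i₂ f x = z) :
    Lam (Glue f) z →ₗ[ℝ] Lam X₂ x :=
  Lam.pull (Glue.i₂ f) (Glue.dSmooth_i₂ f) h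

/-- The map `Λ¹_y(X₁) → Λ¹_y(Y)` given by the restriction of forms. -/
def resY₁ (y : Y) : Lam X₁ (y : X₁) →ₗ[ℝ] Lam Y y := Lam.pull Subtype.val (dSmooth_val Y) rfl

/-- The map `Λ¹_{f(y)}(X₂) → Λ¹_y(Y)` given by the pullback of forms by `f`. -/
def resY₂ {f : Y → X₂} (hf : DSmooth f) (y : Y) : Lam X₂ (f y) →ₗ[ℝ] Lam Y y := Lam.pull f hf rfl

/-- The condition `𝒟₁^Ω = 𝒟₂^Ω`: the local compositions of plots of `Ω¹(X₁)` with the restriction to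
`Y` are the same as the local compositions of plots of `Ω¹(X₂)` with the pullback by `f`. -/
def OmegaCondition {f : Y → X₂} (hf : DSmooth f) : Prop :=
  ∀ (n : ℕ) (θ : Eu n → Form Y),
    (∀ z, ∃ U : Set (Eu n), IsOpen U ∧ z ∈ U ∧ ∃ φ : Eu n → Form X₁, IsPlot φ ∧
      ∀ z' ∈ U, θ z' = Form.pull Subtype.val (dSmooth_val Y) (φ z')) ↔
    (∀ z, ∃ U : Set (Eu n), IsOpen U ∧ z ∈ U ∧ ∃ φ : Eu n → Form X₂, IsPlot φ ∧
      ∀ z' ∈ U, θ z' = Form.pull f hf (φ z'))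

/-- Compatibility of an element of `Λ¹_y(X₁)` with an element of `Λ¹_{f(y)}(X₂)`. -/
def CompatibleValues {f : Y → X₂} (hf : DSmooth f) (y : Y) (α : Lam X₁ (y : X₁))
    (β : Lam X₂ (f y)) : Prop :=
  resY₁ y α = resY₂ hf y β

/-- Compatibility of pseudo-metrics on `Λ¹(X₁)` and `Λ¹(X₂)`. -/
def CompatibleMetrics {f : Y → X₂} (hf : DSmooth f)
    (g₁ : ∀ x, Lam X₁ x →ₗ[ℝ] Lam X₁ x →ₗ[ℝ] ℝ) (g₂ : ∀ x, Lam X₂ x →ₗ[ℝ] Lam X₂ x →ₗ[ℝ] ℝ) :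
    Prop :=
  ∀ (y : Y) (α α' : Lam X₁ (y : X₁)) (β β' : Lam X₂ (f y)),
    CompatibleValues hf y α β → CompatibleValues hf y α' β' → g₁ y α α' = g₂ (f y) β β'

open Classical in
/-- The pseudo-metric on `Λ¹(X₁ ∪_f X₂)` induced by `g₁` and `g₂`. -/
def glueMetric (f : Y → X₂) (g₁ : ∀ x, Lam X₁ x →ₗ[ℝ] Lam X₁ x →ₗ[ℝ] ℝ)
    (g₂ : ∀ x, Lam X₂ x →ₗ[ℝ] Lam X₂ x →ₗ[ℝ] ℝ) :
    ∀ z : Glue f, Lam (Glue f) z →ₗ[ℝ] Lam (Glue f) z →ₗ[ℝ] ℝ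
  | Glue.left x h => (g₁ x).compl₁₂ (rho₁ f (Glue.i₁_of_notMem f h)) (rho₁ f (Glue.i₁_of_notMem f h))
  | Glue.right z =>
    if h : ∃ y : Y, Glue.i₁ f y = Glue.right z then
      (1 / 2 : ℝ) • (g₁ h.choose).compl₁₂ (rho₁ f h.choose_spec) (rho₁ f h.choose_spec) +
        (1 / 2 : ℝ) • (g₂ z).compl₁₂ (rho₂ f (z := Glue.right z) rfl) (rho₂ f (z := Glue.right z) rfl)
    else (g₂ z).compl₁₂ (rho₂ f (z := Glue.right z) rfl) (rho₂ f (z := Glue.right z) rfl)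

/-! #### Gluing of connections on `Λ¹` -/

/-- The section of `Λ¹(X₁)` given by a section of `Λ¹(X₁ ∪_f X₂)`. -/
def lamPart₁ (f : Y → X₂) (s : ∀ z, Lam (Glue f) z) (x : X₁) : Lam X₁ x :=
  rho₁ f rfl (s (Glue.i₁ f x))

/-- The section of `Λ¹(X₂)` given by a section of `Λ¹(X₁ ∪_f X₂)`. -/
def lamPart₂ (f : Y → X₂) (s : ∀ z, Lam (Glue f) z) (x : X₂) : Lam X₂ x :=
  rho₂ f rfl (s (Glue.i₂ f x))

/-- Compatibility of connections on `Λ¹(X₁)` and `Λ¹(X₂)`. -/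
def CompatibleLamConnections {f : Y → X₂} (hf : DSmooth f)
    (D₁ : (∀ x, Lam X₁ x) → ∀ x, Tens (Lam X₁) (Lam X₁) x)
    (D₂ : (∀ x, Lam X₂ x) → ∀ x, Tens (Lam X₂) (Lam X₂) x) : Prop :=
  ∀ (s₁ : ∀ x, Lam X₁ x) (s₂ : ∀ x, Lam X₂ x), IsSmoothSection s₁ → IsSmoothSection s₂ →
    (∀ y : Y, CompatibleValues hf y (s₁ y) (s₂ (f y))) → ∀ y : Y,
      TensorProduct.map (resY₁ y) (resY₁ y) (D₁ s₁ y) =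
        TensorProduct.map (resY₂ hf y) (resY₂ hf y) (D₂ s₂ (f y))

/-- `D` is the connection on `Λ¹(X₁ ∪_f X₂)` induced by `D₁` and `D₂`: at each point in the image of
`X₁` (respectively `X₂`), the value of `D s` is taken by the map `Λ¹(X₁ ∪_f X₂) → Λ¹(X₁)`
(respectively `Λ¹(X₂)`) in both factors to the value of `D₁` (respectively `D₂`) on the corresponding
section. -/
structure IsInducedLamConnection (f : Y → X₂)
    (D₁ : (∀ x, Lam X₁ x) → ∀ x, Tens (Lam X₁) (Lam X₁) x)
    (D₂ : (∀ x, Lam X₂ x) → ∀ x, Tens (Lam X₂) (Lam X₂) x)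
    (D : (∀ z, Lam (Glue f) z) → ∀ z, Tens (Lam (Glue f)) (Lam (Glue f)) z) : Prop where
  left : ∀ s, IsSmoothSection s → ∀ (x : X₁) (h : x ∉ Y),
    TensorProduct.map (rho₁ f (Glue.i₁_of_notMem f h)) (rho₁ f (Glue.i₁_of_notMem f h))
      (D s (Glue.left x h)) = D₁ (lamPart₁ f s) x
  right : ∀ s, IsSmoothSection s → ∀ z : X₂, z ∉ range f →
    TensorProduct.map (rho₂ f (z := Glue.right z) rfl) (rho₂ f (z := Glue.right z) rfl)
      (D s (Glue.right z)) = D₂ (lamPart₂ f s) z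
  middle : ∀ s, IsSmoothSection s → ∀ y : Y,
    TensorProduct.map (rho₁ f (Glue.i₁_of_mem f y)) (rho₁ f (Glue.i₁_of_mem f y))
      (D s (Glue.right (f y))) = D₁ (lamPart₁ f s) y ∧
    TensorProduct.map (rho₂ f (z := Glue.right (f y)) rfl) (rho₂ f (z := Glue.right (f y)) rfl)
      (D s (Glue.right (f y))) = D₂ (lamPart₂ f s) (f y)

/-! #### Gluing of pseudo-bundles, actions and connections -/

variable {E₁ : X₁ → Type v} {E₂ : X₂ → Type v}
  [∀ x, AddCommGroup (E₁ x)] [∀ x, Module ℝ (E₁ x)]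
  [∀ x, AddCommGroup (E₂ x)] [∀ x, Module ℝ (E₂ x)]

/-- The fibres of `E₁ ∪_{F} E₂`, where `F` covers `f`. -/
def GlueFam (f : Y → X₂) (_F : ∀ y : Y, E₁ y ≃ₗ[ℝ] E₂ (f y)) : Glue f → Type v
  | Glue.left x _ => E₁ x
  | Glue.right z => E₂ z

instance (f : Y → X₂) (F : ∀ y : Y, E₁ y ≃ₗ[ℝ] E₂ (f y)) :
    ∀ z, AddCommGroup (GlueFam f F z)
  | Glue.left x _ => inferInstanceAs (AddCommGroup (E₁ x))
  | Glue.right z => inferInstanceAs (AddCommGroup (E₂ z))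

instance (f : Y → X₂) (F : ∀ y : Y, E₁ y ≃ₗ[ℝ] E₂ (f y)) :
    ∀ z, Module ℝ (GlueFam f F z)
  | Glue.left x _ => inferInstanceAs (Module ℝ (E₁ x))
  | Glue.right z => inferInstanceAs (Module ℝ (E₂ z))

open Classical in
/-- The natural map `E₁ → E₁ ∪_F E₂`, which is `F` followed by `E₂ → E₁ ∪_F E₂` over `Y`. -/
def GlueFam.j₁ (f : Y → X₂) (F : ∀ y : Y, E₁ y ≃ₗ[ℝ] E₂ (f y)) (e : Sigma E₁) :
    Sigma (GlueFam f F) :=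
  if h : e.1 ∈ Y then ⟨Glue.right (f ⟨e.1, h⟩), F ⟨e.1, h⟩ e.2⟩ else ⟨Glue.left e.1 h, e.2⟩

/-- The natural map `E₂ → E₁ ∪_F E₂`. -/
def GlueFam.j₂ (f : Y → X₂) (F : ∀ y : Y, E₁ y ≃ₗ[ℝ] E₂ (f y)) (e : Sigma E₂) :
    Sigma (GlueFam f F) :=
  ⟨Glue.right e.1, e.2⟩

/-- The gluing diffeology on `E₁ ∪_F E₂`. -/
instance instGlueFam [DiffeologicalSpace (Sigma E₁)] [DiffeologicalSpace (Sigma E₂)] (f : Y → X₂)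
    (F : ∀ y : Y, E₁ y ≃ₗ[ℝ] E₂ (f y)) : DiffeologicalSpace (Sigma (GlueFam f F)) :=
  ofLocal (fun n q => (∃ p : Eu n → Sigma E₁, IsPlot p ∧ q = GlueFam.j₁ f F ∘ p) ∨
      ∃ p : Eu n → Sigma E₂, IsPlot p ∧ q = GlueFam.j₂ f F ∘ p)
    (by
      rintro n ⟨⟨x, h⟩ | z, e⟩
      · exact .inl ⟨fun _ => ⟨x, e⟩, isPlot_const, funext fun _ => by
          simp [GlueFam.j₁, h]⟩
      · exact .inr ⟨fun _ => ⟨z, e⟩, isPlot_const, rfl⟩)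
    (by
      rintro n m _ g (⟨p, hp, rfl⟩ | ⟨p, hp, rfl⟩) hg
      · exact .inl ⟨p ∘ g, isPlot_reparam hp hg, rfl⟩
      · exact .inr ⟨p ∘ g, isPlot_reparam hp hg, rfl⟩)

/-- The fibrewise linear bijection `F`, which covers `f`, is a diffeomorphism between the restrictions
of `E₁` to `Y` and of `E₂` to `f(Y)`. -/
def IsGluingLift [DiffeologicalSpace (Sigma E₁)] [DiffeologicalSpace (Sigma E₂)] (f : Y → X₂)
    (F : ∀ y : Y, E₁ y ≃ₗ[ℝ] E₂ (f y)) : Prop :=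
  ∀ (n : ℕ) (b : Eu n → Y) (e : ∀ z, E₁ (b z)),
    PlotOver E₁ (fun z => (b z : X₁)) e ↔
      PlotOver E₂ (fun z => f (b z)) (fun z => F (b z) (e z))

open Classical in
/-- The section of `E₁` given by a section of `E₁ ∪_F E₂`. -/
def part₁ (f : Y → X₂) (F : ∀ y : Y, E₁ y ≃ₗ[ℝ] E₂ (f y)) (s : ∀ z, GlueFam f F z) (x : X₁) :
    E₁ x :=
  if h : x ∈ Y then (F ⟨x, h⟩).symm (s (Glue.right (f ⟨x, h⟩))) else s (Glue.left x h)

/-- The section of `E₂` given by a section of `E₁ ∪_F E₂`. -/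
def part₂ (f : Y → X₂) (F : ∀ y : Y, E₁ y ≃ₗ[ℝ] E₂ (f y)) (s : ∀ z, GlueFam f F z) (x : X₂) :
    E₂ x :=
  s (Glue.right x)

/-- Compatibility of the actions of `Λ¹(X₁)` on `E₁` and of `Λ¹(X₂)` on `E₂`. -/
def CompatibleActions (f : Y → X₂) (F : ∀ y : Y, E₁ y ≃ₗ[ℝ] E₂ (f y))
    (c₁ : ∀ x, Lam X₁ x →ₗ[ℝ] Module.End ℝ (E₁ x))
    (c₂ : ∀ x, Lam X₂ x →ₗ[ℝ] Module.End ℝ (E₂ x)) : Prop :=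
  ∀ (y : Y) (α : Lam (Glue f) (Glue.right (f y))) (e : E₁ (y : X₁)),
    c₂ (f y) (rho₂ f rfl α) (F y e) = F y (c₁ y (rho₁ f (Glue.i₁_of_mem f y) α) e)

/-- The induced action of `Λ¹(X₁ ∪_f X₂)` on `E₁ ∪_F E₂`. -/
def glueAction (f : Y → X₂) (F : ∀ y : Y, E₁ y ≃ₗ[ℝ] E₂ (f y))
    (c₁ : ∀ x, Lam X₁ x →ₗ[ℝ] Module.End ℝ (E₁ x))
    (c₂ : ∀ x, Lam X₂ x →ₗ[ℝ] Module.End ℝ (E₂ x)) :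
    ∀ z : Glue f, Lam (Glue f) z →ₗ[ℝ] Module.End ℝ (GlueFam f F z)
  | Glue.left x h => (c₁ x).comp (rho₁ f (Glue.i₁_of_notMem f h))
  | Glue.right z => (c₂ z).comp (rho₂ f (z := Glue.right z) rfl)

/-- Compatibility of connections on `E₁` and `E₂`: the values on compatible sections have the same
image in `Λ¹_y(Y) ⊗ E₂`. -/
def CompatibleConnections [DiffeologicalSpace (Sigma E₁)] [DiffeologicalSpace (Sigma E₂)]
    {f : Y → X₂} (hf : DSmooth f) (F : ∀ y : Y, E₁ y ≃ₗ[ℝ] E₂ (f y))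
    (D₁ : (∀ x, E₁ x) → ∀ x, Tens (Lam X₁) E₁ x)
    (D₂ : (∀ x, E₂ x) → ∀ x, Tens (Lam X₂) E₂ x) : Prop :=
  ∀ (s₁ : ∀ x, E₁ x) (s₂ : ∀ x, E₂ x), IsSmoothSection s₁ → IsSmoothSection s₂ →
    (∀ y : Y, s₂ (f y) = F y (s₁ y)) → ∀ y : Y,
      TensorProduct.map (resY₁ y) (F y).toLinearMap (D₁ s₁ y) =
        TensorProduct.map (resY₂ hf y) LinearMap.id (D₂ s₂ (f y))

/-- `D` is the connection on `E₁ ∪_F E₂` induced by `D₁` and `D₂`: away from the domain of gluing, the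
value of `D s` corresponds to that of `D₁` or `D₂` on the corresponding section; at a point of `f(Y)`,
its two components along `Λ¹(X₁)` and `Λ¹(X₂)` are the values of `D₁` (carried over by `F`) and of
`D₂`. -/
structure IsInducedConnection [DiffeologicalSpace (Sigma E₁)] [DiffeologicalSpace (Sigma E₂)]
    (f : Y → X₂) (F : ∀ y : Y, E₁ y ≃ₗ[ℝ] E₂ (f y))
    (D₁ : (∀ x, E₁ x) → ∀ x, Tens (Lam X₁) E₁ x)
    (D₂ : (∀ x, E₂ x) → ∀ x, Tens (Lam X₂) E₂ x)
    (D : (∀ z, GlueFam f F z) → ∀ z, Tens (Lam (Glue f)) (GlueFam f F) z) : Prop where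
  left : ∀ s, IsSmoothSection s → ∀ (x : X₁) (h : x ∉ Y),
    TensorProduct.map (rho₁ f (Glue.i₁_of_notMem f h)) (LinearMap.id (M := E₁ x))
      (D s (Glue.left x h)) = D₁ (part₁ f F s) x
  right : ∀ s, IsSmoothSection s → ∀ z : X₂, z ∉ range f →
    TensorProduct.map (rho₂ f (z := Glue.right z) rfl) (LinearMap.id (M := E₂ z))
      (D s (Glue.right z)) = D₂ (part₂ f F s) z
  middle : ∀ s, IsSmoothSection s → ∀ y : Y,
    TensorProduct.map (rho₁ f (Glue.i₁_of_mem f y)) (LinearMap.id (M := E₂ (f y)))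
      (D s (Glue.right (f y))) =
        TensorProduct.map LinearMap.id (F y).toLinearMap (D₁ (part₁ f F s) y) ∧
    TensorProduct.map (rho₂ f (z := Glue.right (f y)) rfl) (LinearMap.id (M := E₂ (f y)))
      (D s (Glue.right (f y))) = D₂ (part₂ f F s) (f y)

end Glue

end DiffGlue

end

open DiffGlue

/-!
The proof shows that the gluing hypotheses make all the objects over `X₁ ∪_f X₂` restrict, without
loss, to the given ones over `X₁` and over `X₂`; every assertion about `X₁ ∪_f X₂` is then checked
on the two pieces.

The key point is that the natural maps `Λ¹(X₁ ∪_f X₂) → Λ¹(Xᵢ)` are isomorphisms on all fibres,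
also over `f(Y)`. The evaluations of 1-forms on plots through `x` are smooth functionals on
`Λ¹_x(X)` that separate its points (`Lam.smoothDual_eq_top`), so the smooth dual of a
finite-dimensional fibre is its full dual, and the rank condition makes a pseudo-metric
nondegenerate (`IsPseudoMetric.ker_eq_bot`). An element of the kernel of `Λ¹_y(X₁) → Λ¹_y(Y)` is
compatible with `0`; by the compatibility of the pseudo-metrics it is orthogonal to everything,
hence it vanishes (`CompatibleMetrics.resY₁_injective`, `CompatibleMetrics.resY₂_injective`). A
1-form on the glued space is a pair of 1-forms on `X₁` and `X₂` that agree on `Y` (`Form.glue`),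
and the condition `𝒟₁^Ω = 𝒟₂^Ω` extends each 1-form, and locally each plot of 1-forms, from `Xᵢ` to
the glued space. Together these facts give `restricts_rho₁` and `restricts_rho₂`: the maps to
`Λ¹(Xᵢ)` are bijective and identify the plots over a plot of `Xᵢ`. The same holds for the glued
bundle (`GlueFam.restricts_toLeft`, `GlueFam.restricts_toRight`), and it passes to tensor products
(`Restricts.tens`).

Consequently the values of an induced connection are the preimages of those of the given
connections. The two prescriptions over `f(Y)` agree because the connections are compatible and
restriction to `Y` is injective, so that induced connections exist (`Glue.exists_value`). Since
every plot of the glued space lifts locally to `X₁` or to `X₂` (`Glue.isCover`), the axioms of a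
Clifford connection may be verified on `X₁` and `X₂`, where they are hypotheses; this is
`IsCover.isCliffordConnection`.
-/

noncomputable section

set_option linter.unusedSectionVars false

namespace DiffGlue

/-! ### Localization of plots -/

/-- A map is a plot as soon as, near each point, its composition with a cutoff map that is the
identity near this point is a plot. In contrast with the locality axiom, no open subset of the
domain appears, so that for maps into the total space of a family no equality between elements of
different fibres has to be stated. -/
theorem isPlot_of_cutoff {W : Type*} [DiffeologicalSpace W] {n : ℕ} {q : Eu n → W}
    (h : ∀ x, ∃ χ : Eu n → Eu n, ContDiff ℝ ∞ χ ∧ (∀ᶠ y in 𝓝 x, χ y = y) ∧ IsPlot (q ∘ χ)) :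
    IsPlot q := by
  refine DiffeologicalSpace.locality fun x => ?_
  obtain ⟨χ, -, hχ', hq⟩ := h x
  obtain ⟨U, hU, hUo, hxU⟩ := eventually_nhds_iff.1 hχ'
  refine ⟨U, hUo, hxU, fun {m g} hg hg' => ?_⟩
  have : q ∘ g = (q ∘ χ) ∘ g := funext fun z => by simp [hU _ (hg z)]
  rw [this]
  exact isPlot_reparam hq hg'

/-- A plot for a diffeology defined by local models is such a model after composition with a cutoff
map. The diffeology is given through the equation `hd`, so that the model predicate can be read off
from the definition of an instance. -/
theorem exists_cutoff_ofLocal {X : Type*} {P : ∀ n : ℕ, (Eu n → X) → Prop}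
    {hc : ∀ (n : ℕ) (x : X), P n (fun _ => x)}
    {hr : ∀ (n m : ℕ) (p : Eu m → X) (g : Eu n → Eu m), P m p → ContDiff ℝ ∞ g → P n (p ∘ g)}
    {d : DiffeologicalSpace X} (hd : d = ofLocal P hc hr) {n : ℕ} {q : Eu n → X} (hq : IsPlot q)
    (x : Eu n) :
    ∃ χ : Eu n → Eu n, ContDiff ℝ ∞ χ ∧ (∀ᶠ y in 𝓝 x, χ y = y) ∧ P n (q ∘ χ) := by
  subst hd
  obtain ⟨U, hU, hxU, q₀, hq₀, he⟩ := hq x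
  obtain ⟨χ, hχ, hχU, V, hV, hxV, hVχ⟩ := exists_cutoff hU hxU
  refine ⟨χ, hχ, eventually_nhds_iff.2 ⟨V, hVχ, hV, hxV⟩, ?_⟩
  have : q ∘ χ = q₀ ∘ χ := funext fun z => he (hχU z)
  rw [this]
  exact hr _ _ _ _ hq₀ hχ

/-- A property that holds near `x` holds everywhere after composition with a suitable cutoff map. -/
theorem exists_cutoff_of_eventually {n : ℕ} {P : Eu n → Prop} {x : Eu n} (h : ∀ᶠ y in 𝓝 x, P y) :
    ∃ χ : Eu n → Eu n, ContDiff ℝ ∞ χ ∧ (∀ᶠ y in 𝓝 x, χ y = y) ∧ ∀ y, P (χ y) := by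
  obtain ⟨U, hU, hUo, hxU⟩ := eventually_nhds_iff.1 h
  obtain ⟨χ, hχ, hχU, V, hV, hxV, hVχ⟩ := exists_cutoff hUo hxU
  exact ⟨χ, hχ, eventually_nhds_iff.2 ⟨V, hVχ, hV, hxV⟩, fun y => hU _ (hχU y)⟩

section

variable {X : Type u} [DiffeologicalSpace X]

theorem PlotOver.of_cutoff {E : X → Type v} [DiffeologicalSpace (Sigma E)] {n : ℕ} {b : Eu n → X}
    {s : ∀ z, E (b z)}
    (h : ∀ x, ∃ χ : Eu n → Eu n, ContDiff ℝ ∞ χ ∧ (∀ᶠ y in 𝓝 x, χ y = y) ∧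
      PlotOver E (fun z => b (χ z)) (fun z => s (χ z))) : PlotOver E b s :=
  isPlot_of_cutoff h

theorem contDiff_of_cutoff {n : ℕ} {V : Type*} [NormedAddCommGroup V] [NormedSpace ℝ V]
    {q : Eu n → V}
    (h : ∀ x, ∃ χ : Eu n → Eu n, ContDiff ℝ ∞ χ ∧ (∀ᶠ y in 𝓝 x, χ y = y) ∧
      ContDiff ℝ ∞ (q ∘ χ)) : ContDiff ℝ ∞ q := by
  rw [contDiff_iff_contDiffAt]
  intro x
  obtain ⟨χ, -, hχ', hq⟩ := h x
  refine (hq.contDiffAt (x := x)).congr_of_eventuallyEq ?_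
  filter_upwards [hχ'] with y hy
  simp [hy]

/-! ### Values of 1-forms -/

/-- The value of a 1-form on a plot at a point depends only on the germ of the plot. -/
theorem Form.congr_of_eventuallyEq (η : Form X) {n : ℕ} {p q : Plot X n} {z : Eu n}
    (h : p.1 =ᶠ[𝓝 z] q.1) : η.1 n p z = η.1 n q z := by
  obtain ⟨χ, hχ, hχ', he⟩ := exists_cutoff_of_eventually h
  have hfd : fderiv ℝ χ z = ContinuousLinearMap.id ℝ (Eu n) := by
    rw [Filter.EventuallyEq.fderiv_eq (f₁ := χ) (f := id) hχ', fderiv_id]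
  have key : ∀ p : Plot X n, η.1 n (p.comp χ hχ) z = η.1 n p z := fun p => by
    rw [η.2.2, hfd, hχ'.self_of_nhds, ContinuousLinearMap.comp_id]
  have : p.comp χ hχ = q.comp χ hχ := Subtype.ext (funext he)
  rw [← key p, ← key q, this]

theorem Form.isPlot_pull {A : Type u₁} {B : Type u₂} [DiffeologicalSpace A] [DiffeologicalSpace B]
    (φ : A → B) (hφ : DSmooth φ) {k : ℕ} {η : Eu k → Form B} (hη : IsPlot η) :
    IsPlot (fun z => Form.pull φ hφ (η z)) :=
  fun n p => hη n ⟨φ ∘ p.1, hφ _ _ p.2⟩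

theorem Lam.mk_surjective (x : X) : Function.Surjective (Lam.mk x) := Submodule.mkQ_surjective _

theorem Lam.mk_eq_zero_iff {x : X} {η : Form X} :
    Lam.mk x η = 0 ↔ ∀ n (p : Plot X n), p.1 0 = x → η.1 n p 0 = 0 :=
  Submodule.Quotient.mk_eq_zero (Vanish X x)

theorem Lam.pull_mk {A : Type u₁} {B : Type u₂} [DiffeologicalSpace A] [DiffeologicalSpace B]
    (φ : A → B) (hφ : DSmooth φ) {a : A} {b : B} (h : φ a = b) (η : Form B) :
    Lam.pull φ hφ h (Lam.mk b η) = Lam.mk a (Form.pull φ hφ η) := rfl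

theorem Lam.plotOver_mk {n : ℕ} {b : Eu n → X} {η : Eu n → Form X} (hb : IsPlot b)
    (hη : IsPlot η) : PlotOver (Lam X) b (fun z => Lam.mk (b z) (η z)) :=
  fun _ => ⟨univ, isOpen_univ, mem_univ _, _, ⟨b, η, hb, hη, rfl⟩, fun _ _ => rfl⟩

theorem Lam.exists_cutoff_of_plotOver {n : ℕ} {b : Eu n → X} {s : ∀ z, Lam X (b z)}
    (h : PlotOver (Lam X) b s) (x : Eu n) :
    ∃ χ : Eu n → Eu n, ContDiff ℝ ∞ χ ∧ (∀ᶠ y in 𝓝 x, χ y = y) ∧ IsPlot (fun z => b (χ z)) ∧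
      ∃ η : Eu n → Form X, IsPlot η ∧ ∀ z, s (χ z) = Lam.mk (b (χ z)) (η z) := by
  obtain ⟨χ, hχ, hχ', b', η, hb, hη, he⟩ := exists_cutoff_ofLocal (by unfold instLam; rfl) h x
  have hbb : b' = fun z => b (χ z) := funext fun z => (congrArg Sigma.fst (congrFun he z)).symm
  subst hbb
  exact ⟨χ, hχ, hχ', hb, η, hη, fun z => eq_of_heq (Sigma.mk.inj (congrFun he z)).2⟩

theorem Lam.isPlot_base {n : ℕ} {b : Eu n → X} {s : ∀ z, Lam X (b z)}
    (h : PlotOver (Lam X) b s) : IsPlot b :=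
  isPlot_of_cutoff fun x =>
    let ⟨χ, hχ, hχ', hb, _⟩ := Lam.exists_cutoff_of_plotOver h x
    ⟨χ, hχ, hχ', hb⟩

theorem Lam.plotOver_pull {A : Type u₁} {B : Type u₂} [DiffeologicalSpace A]
    [DiffeologicalSpace B] {φ : A → B} (hφ : DSmooth φ) {n : ℕ} {a : Eu n → A} {b : Eu n → B}
    (h : ∀ z, φ (a z) = b z) (ha : IsPlot a) {s : ∀ z, Lam B (b z)} (hs : PlotOver (Lam B) b s) :
    PlotOver (Lam A) a (fun z => Lam.pull φ hφ (h z) (s z)) := by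
  refine .of_cutoff fun x => ?_
  obtain ⟨χ, hχ, hχ', -, η, hη, he⟩ := Lam.exists_cutoff_of_plotOver hs x
  refine ⟨χ, hχ, hχ', ?_⟩
  have := Lam.plotOver_mk (isPlot_reparam ha hχ) (Form.isPlot_pull φ hφ hη)
  simp only [he, Lam.pull_mk]
  exact this

/-! ### Differentials of functions -/

theorem Lam.pull_dLam {A : Type u₁} {B : Type u₂} [DiffeologicalSpace A] [DiffeologicalSpace B]
    {φ : A → B} (hφ : DSmooth φ) {h : B → ℝ} (hh : DSmooth h) {a : A} {b : B} (hab : φ a = b) :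
    Lam.pull φ hφ hab (dLam h b) = dLam (h ∘ φ) a := by
  rw [dLam, dif_pos hh, dLam, dif_pos (hh.comp hφ)]
  rfl

theorem isSmoothSection_dLam {h : X → ℝ} (hh : DSmooth h) : IsSmoothSection (dLam h) := by
  intro n p hp
  have : (fun x => (⟨x, dLam h x⟩ : Sigma (Lam X))) ∘ p =
      fun z => ⟨p z, Lam.mk (p z) (Form.d h hh)⟩ := funext fun z => by
    simp [dLam, dif_pos hh]
  rw [this]
  exact Lam.plotOver_mk hp isPlot_const

/-! ### Nondegeneracy of pseudo-metrics on `Λ¹` -/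

/-- The evaluation of 1-forms on a plot through `x` and a tangent vector. -/
def Lam.eval {x : X} {n : ℕ} (p : Plot X n) (hp : p.1 0 = x) (v : Eu n) :
    Module.Dual ℝ (Lam X x) :=
  (Vanish X x).liftQ
    { toFun := fun η => η.1 n p 0 v
      map_add' := fun _ _ => rfl
      map_smul' := fun _ _ => rfl }
    (fun η hη => by
      change η.1 n p 0 v = 0
      rw [hη n p hp]
      rfl)

theorem Lam.eval_mem_smoothDual {x : X} {n : ℕ} (p : Plot X n) (hp : p.1 0 = x) (v : Eu n) :
    Lam.eval p hp v ∈ smoothDual (Lam X) x := by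
  intro k s hs
  refine contDiff_of_cutoff fun y => ?_
  obtain ⟨χ, hχ, hχ', -, η, hη, he⟩ := Lam.exists_cutoff_of_plotOver hs y
  refine ⟨χ, hχ, hχ', ?_⟩
  have h1 : (fun z => Lam.eval p hp v (s z)) ∘ χ = fun z => (η z).1 n p 0 v :=
    funext fun z => by
      change Lam.eval p hp v (s (χ z)) = _
      rw [he]
      rfl
  rw [h1]
  have h2 : ContDiff ℝ ∞ (fun z => (η z).1 n p 0) :=
    (hη n p).comp (contDiff_id.prodMk contDiff_const)
  exact h2.clm_apply contDiff_const

/-- Every linear functional on a finite-dimensional fibre of `Λ¹(X)` is smooth, because the smooth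
functionals `Lam.eval` separate the points of the fibre. -/
theorem Lam.smoothDual_eq_top (x : X) [FiniteDimensional ℝ (Lam X x)] :
    smoothDual (Lam X) x = ⊤ := by
  have h : (smoothDual (Lam X) x).dualCoannihilator = ⊥ := by
    rw [eq_bot_iff]
    intro a ha
    obtain ⟨η, rfl⟩ := Lam.mk_surjective x a
    refine Lam.mk_eq_zero_iff.2 fun n p hp => ContinuousLinearMap.ext fun v => ?_
    exact (Submodule.mem_dualCoannihilator _).1 ha _ (Lam.eval_mem_smoothDual p hp v)
  rw [← Subspace.dualCoannihilator_dualAnnihilator_eq (W := smoothDual (Lam X) x), h,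
    Submodule.dualAnnihilator_bot]

theorem Lam.finrank_dualFam (x : X) [FiniteDimensional ℝ (Lam X x)] :
    Module.finrank ℝ (DualFam (Lam X) x) = Module.finrank ℝ (Lam X x) := by
  change Module.finrank ℝ (smoothDual (Lam X) x) = _
  rw [Lam.smoothDual_eq_top, finrank_top, Subspace.dual_finrank_eq]

/-- Pseudo-metrics on `Λ¹(X)` are nondegenerate. -/
theorem IsPseudoMetric.ker_eq_bot [∀ x, FiniteDimensional ℝ (Lam X x)]
    {g : ∀ x, Lam X x →ₗ[ℝ] Lam X x →ₗ[ℝ] ℝ} (hg : IsPseudoMetric g) (x : X) :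
    LinearMap.ker (g x) = ⊥ := by
  have h := hg.rank x
  rw [Lam.finrank_dualFam] at h
  exact Submodule.finrank_eq_zero.1 (by omega)

end

/-! ### Plots of tensor products -/

section

variable {X : Type u} [DiffeologicalSpace X]

section Tensor

variable {E : X → Type v} {F : X → Type w} [∀ x, AddCommGroup (E x)] [∀ x, Module ℝ (E x)]
  [∀ x, AddCommGroup (F x)] [∀ x, Module ℝ (F x)] [DiffeologicalSpace (Sigma E)]
  [DiffeologicalSpace (Sigma F)]

theorem Tens.plotOver_sum {n : ℕ} {b : Eu n → X} (hb : IsPlot b)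
    (L : List ((∀ z, E (b z)) × (∀ z, F (b z))))
    (hL : ∀ s ∈ L, PlotOver E b s.1 ∧ PlotOver F b s.2) :
    PlotOver (Tens E F) b (fun z => (L.map fun s => Tens.tmul (s.1 z) (s.2 z)).sum) :=
  fun _ => ⟨univ, isOpen_univ, mem_univ _, _, ⟨b, L, hb, hL, rfl⟩, fun _ _ => rfl⟩

theorem Tens.exists_cutoff_of_plotOver {n : ℕ} {b : Eu n → X} {s : ∀ z, Tens E F (b z)}
    (h : PlotOver (Tens E F) b s) (x : Eu n) :
    ∃ χ : Eu n → Eu n, ContDiff ℝ ∞ χ ∧ (∀ᶠ y in 𝓝 x, χ y = y) ∧ IsPlot (fun z => b (χ z)) ∧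
      ∃ L : List ((∀ z, E (b (χ z))) × (∀ z, F (b (χ z)))),
        (∀ s ∈ L, PlotOver E (fun z => b (χ z)) s.1 ∧ PlotOver F (fun z => b (χ z)) s.2) ∧
        ∀ z, s (χ z) = (L.map fun s => Tens.tmul (s.1 z) (s.2 z)).sum := by
  obtain ⟨χ, hχ, hχ', b', L, hb, hL, he⟩ := exists_cutoff_ofLocal (by unfold instTens; rfl) h x
  have hbb : b' = fun z => b (χ z) := funext fun z => (congrArg Sigma.fst (congrFun he z)).symm
  subst hbb
  exact ⟨χ, hχ, hχ', hb, L, hL, fun z => eq_of_heq (Sigma.mk.inj (congrFun he z)).2⟩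

theorem Tens.isPlot_base {n : ℕ} {b : Eu n → X} {s : ∀ z, Tens E F (b z)}
    (h : PlotOver (Tens E F) b s) : IsPlot b :=
  isPlot_of_cutoff fun x =>
    let ⟨χ, hχ, hχ', hb, _⟩ := Tens.exists_cutoff_of_plotOver h x
    ⟨χ, hχ, hχ', hb⟩

section Map

variable {X' : Type u₁} {E' : X' → Type u₂} {F' : X' → Type*} [∀ x, AddCommGroup (E' x)]
  [∀ x, Module ℝ (E' x)] [∀ x, AddCommGroup (F' x)] [∀ x, Module ℝ (F' x)]

/-- The tensor product of two linear maps between fibres of pseudo-bundles. -/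
def Tens.map {x : X} {x' : X'} (φ : E x →ₗ[ℝ] E' x') (ψ : F x →ₗ[ℝ] F' x') :
    Tens E F x →ₗ[ℝ] Tens E' F' x' :=
  TensorProduct.map φ ψ

theorem Tens.map_tmul {x : X} {x' : X'} (φ : E x →ₗ[ℝ] E' x') (ψ : F x →ₗ[ℝ] F' x') (a : E x)
    (b : F x) : Tens.map φ ψ (Tens.tmul a b) = Tens.tmul (φ a) (ψ b) := rfl

theorem Tens.map_bijective {x : X} {x' : X'} {φ : E x →ₗ[ℝ] E' x'} {ψ : F x →ₗ[ℝ] F' x'}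
    (hφ : Function.Bijective φ) (hψ : Function.Bijective ψ) :
    Function.Bijective (Tens.map (E := E) (F := F) φ ψ) :=
  (TensorProduct.congr (.ofBijective φ hφ) (.ofBijective ψ hψ)).bijective

theorem Tens.ext_hom {x : X} {W : Type*} [AddCommGroup W] [Module ℝ W]
    {φ ψ : Tens E F x →ₗ[ℝ] W} (h : ∀ a b, φ (Tens.tmul a b) = ψ (Tens.tmul a b)) : φ = ψ :=
  TensorProduct.ext' h

end Map

/-- The tensor product of two families of linear maps takes plots to plots if each of the two
families does so, also after a change of parameters. -/
theorem Tens.plotOver_map {X' : Type u₁} [DiffeologicalSpace X'] {E' : X' → Type u₂}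
    {F' : X' → Type*} [∀ x, AddCommGroup (E' x)] [∀ x, Module ℝ (E' x)]
    [∀ x, AddCommGroup (F' x)] [∀ x, Module ℝ (F' x)] [DiffeologicalSpace (Sigma E')]
    [DiffeologicalSpace (Sigma F')] {n : ℕ} {b : Eu n → X} {b' : Eu n → X'} (hb' : IsPlot b')
    (φ : ∀ z, E (b z) →ₗ[ℝ] E' (b' z)) (ψ : ∀ z, F (b z) →ₗ[ℝ] F' (b' z))
    (hφ : ∀ χ : Eu n → Eu n, ContDiff ℝ ∞ χ → ∀ s : ∀ z, E (b (χ z)),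
      PlotOver E (fun z => b (χ z)) s → PlotOver E' (fun z => b' (χ z)) (fun z => φ (χ z) (s z)))
    (hψ : ∀ χ : Eu n → Eu n, ContDiff ℝ ∞ χ → ∀ s : ∀ z, F (b (χ z)),
      PlotOver F (fun z => b (χ z)) s → PlotOver F' (fun z => b' (χ z)) (fun z => ψ (χ z) (s z)))
    {s : ∀ z, Tens E F (b z)} (hs : PlotOver (Tens E F) b s) :
    PlotOver (Tens E' F') b' (fun z => Tens.map (φ z) (ψ z) (s z)) := by
  refine .of_cutoff fun x => ?_
  obtain ⟨χ, hχ, hχ', -, L, hL, he⟩ := Tens.exists_cutoff_of_plotOver hs x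
  refine ⟨χ, hχ, hχ', ?_⟩
  have key := Tens.plotOver_sum (E := E') (F := F') (b := fun z => b' (χ z)) (isPlot_reparam hb' hχ)
    (L.map fun s => (fun z => φ (χ z) (s.1 z), fun z => ψ (χ z) (s.2 z))) (by
      intro s hs
      obtain ⟨t, ht, rfl⟩ := List.mem_map.1 hs
      exact ⟨hφ χ hχ _ (hL t ht).1, hψ χ hχ _ (hL t ht).2⟩)
  refine (congrArg (PlotOver (Tens E' F') (fun z => b' (χ z))) (funext fun z => ?_)).mpr key
  rw [he z]
  rw [map_list_sum, List.map_map, List.map_map]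
  rfl

end Tensor

/-! ### Smoothness of pseudo-metrics and of Clifford actions -/

variable {E : X → Type v} [∀ x, AddCommGroup (E x)] [∀ x, Module ℝ (E x)]
  [DiffeologicalSpace (Sigma E)]

theorem IsSmoothSection.plotOver {s : ∀ x, E x} (hs : IsSmoothSection s) {n : ℕ} {p : Eu n → X}
    (hp : IsPlot p) : PlotOver E p (fun z => s (p z)) := hs n p hp

theorem evalPair_list_sum {x : X} (L : List (DualFam E x × DualFam E x)) (a b : E x) :
    evalPair ((L.map fun s => Tens.tmul s.1 s.2).sum : Tens (DualFam E) (DualFam E) x) a b =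
      (L.map fun s => DualFam.toDual x s.1 a * DualFam.toDual x s.2 b).sum := by
  induction L with
  | nil => exact (congrArg (LinearMap.mul' ℝ ℝ) (map_zero _)).trans (map_zero _)
  | cons s L ih =>
    rw [List.map_cons, List.sum_cons, List.map_cons, List.sum_cons, ← ih]
    refine (congrArg (LinearMap.mul' ℝ ℝ) (map_add _ _ _)).trans ((map_add _ _ _).trans ?_)
    rfl

theorem contDiff_list_sum {ι : Type*} {n : ℕ} (L : List ι) (φ : ι → Eu n → ℝ)
    (h : ∀ i ∈ L, ContDiff ℝ ∞ (φ i)) : ContDiff ℝ ∞ (fun z => (L.map fun i => φ i z).sum) := by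
  induction L with
  | nil => exact contDiff_const
  | cons i L ih =>
    simp only [List.map_cons, List.sum_cons]
    exact (h i List.mem_cons_self).add (ih fun j hj => h j (List.mem_cons_of_mem _ hj))

theorem DualFam.contDiff_toDual {n : ℕ} {p : Eu n → X} {ℓ : ∀ z, DualFam E (p z)}
    {a : ∀ z, E (p z)} (hℓ : PlotOver (DualFam E) p ℓ) (ha : PlotOver E p a) :
    ContDiff ℝ ∞ (fun z => DualFam.toDual (p z) (ℓ z) (a z)) :=
  hℓ.2 n id a contDiff_id ha

/-- A pseudo-metric is smooth on plots, being locally a sum of products of smooth functionals. -/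
theorem IsPseudoMetric.contDiff {g : ∀ x, E x →ₗ[ℝ] E x →ₗ[ℝ] ℝ} (hg : IsPseudoMetric g) {n : ℕ}
    {p : Eu n → X} {a b : ∀ z, E (p z)} (hp : IsPlot p) (ha : PlotOver E p a)
    (hb : PlotOver E p b) : ContDiff ℝ ∞ (fun z => g (p z) (a z) (b z)) := by
  obtain ⟨T, hT, hgT⟩ := hg.smooth
  refine contDiff_of_cutoff fun x => ?_
  obtain ⟨χ, hχ, hχ', -, L, hL, he⟩ := Tens.exists_cutoff_of_plotOver (hT.plotOver hp) x
  refine ⟨χ, hχ, hχ', ?_⟩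
  have h1 : (fun z => g (p z) (a z) (b z)) ∘ χ = fun z => (L.map fun s =>
      DualFam.toDual (p (χ z)) (s.1 z) (a (χ z)) *
        DualFam.toDual (p (χ z)) (s.2 z) (b (χ z))).sum := by
    funext z
    change g (p (χ z)) (a (χ z)) (b (χ z)) = _
    rw [hgT, he]
    have := evalPair_list_sum (L.map fun s => (s.1 z, s.2 z)) (a (χ z)) (b (χ z))
    simpa only [List.map_map, Function.comp_def] using this
  rw [h1]
  exact contDiff_list_sum L _ fun s hs =>
    (DualFam.contDiff_toDual (hL s hs).1 (ha.comp hχ)).mul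
      (DualFam.contDiff_toDual (hL s hs).2 (hb.comp hχ))

theorem IsPseudoMetric.dSmooth {g : ∀ x, E x →ₗ[ℝ] E x →ₗ[ℝ] ℝ} (hg : IsPseudoMetric g)
    {s t : ∀ x, E x} (hs : IsSmoothSection s) (ht : IsSmoothSection t) :
    DSmooth (fun x => g x (s x) (t x)) := fun _ _ hp =>
  isPlot_iff_contDiff.2 (hg.contDiff hp (hs.plotOver hp) (ht.plotOver hp))

section Clifford

variable {V : X → Type w} [∀ x, AddCommGroup (V x)] [∀ x, Module ℝ (V x)]
  [DiffeologicalSpace (Sigma V)]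

theorem Cliff.plotOver_ι (g : ∀ x, V x →ₗ[ℝ] V x →ₗ[ℝ] ℝ) {n : ℕ} {b : Eu n → X}
    (hb : IsPlot b) {t : ∀ z, V (b z)} (ht : PlotOver V b t) :
    PlotOver (Cliff g) b (fun z => Cliff.ι g (b z) (t z)) := by
  refine fun _ => ⟨univ, isOpen_univ, mem_univ _, _,
    ⟨b, [(fun _ => 1, [t])], hb, ?_, rfl⟩, fun z _ => ?_⟩
  · simpa using ⟨contDiff_const, ht⟩
  · simp

theorem Cliff.exists_cutoff_of_plotOver {g : ∀ x, V x →ₗ[ℝ] V x →ₗ[ℝ] ℝ} {n : ℕ} {b : Eu n → X}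
    {a : ∀ z, Cliff g (b z)} (h : PlotOver (Cliff g) b a) (x : Eu n) :
    ∃ χ : Eu n → Eu n, ContDiff ℝ ∞ χ ∧ (∀ᶠ y in 𝓝 x, χ y = y) ∧ IsPlot (fun z => b (χ z)) ∧
      ∃ L : List ((Eu n → ℝ) × List (∀ z, V (b (χ z)))),
        (∀ s ∈ L, ContDiff ℝ ∞ s.1 ∧ ∀ t ∈ s.2, PlotOver V (fun z => b (χ z)) t) ∧
        ∀ z, a (χ z) =
          (L.map fun s => s.1 z • (s.2.map fun t => Cliff.ι g (b (χ z)) (t z)).prod).sum := by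
  obtain ⟨χ, hχ, hχ', b', L, hb, hL, he⟩ := exists_cutoff_ofLocal (by unfold instCliff; rfl) h x
  have hbb : b' = fun z => b (χ z) := funext fun z => (congrArg Sigma.fst (congrFun he z)).symm
  subst hbb
  exact ⟨χ, hχ, hχ', hb, L, hL, fun z => eq_of_heq (Sigma.mk.inj (congrFun he z)).2⟩

/-- The Clifford relation `c(a)² = -g(a, a)`. -/
theorem IsCliffordAction.sq {g : ∀ x, V x →ₗ[ℝ] V x →ₗ[ℝ] ℝ}
    {c : ∀ x, V x →ₗ[ℝ] Module.End ℝ (E x)} (h : IsCliffordAction g c) (x : X) (a : V x)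
    (e : E x) : c x a (c x a e) = -g x a a • e := by
  obtain ⟨C, hC, -⟩ := h
  have h1 : Cliff.ι g x a * Cliff.ι g x a = algebraMap ℝ (Cliff g x) (-g x a a) :=
    CliffordAlgebra.ι_sq_scalar _ a
  have h2 := congrArg (C x) h1
  rw [map_mul, hC, AlgHom.commutes] at h2
  exact LinearMap.congr_fun h2 e

theorem IsCliffordAction.plotOver {g : ∀ x, V x →ₗ[ℝ] V x →ₗ[ℝ] ℝ}
    {c : ∀ x, V x →ₗ[ℝ] Module.End ℝ (E x)} (h : IsCliffordAction g c) {n : ℕ} {b : Eu n → X}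
    (hb : IsPlot b) {a : ∀ z, V (b z)} {e : ∀ z, E (b z)} (ha : PlotOver V b a)
    (he : PlotOver E b e) : PlotOver E b (fun z => c (b z) (a z) (e z)) := by
  obtain ⟨C, hC, hC'⟩ := h
  have := hC' n b _ e (Cliff.plotOver_ι g hb ha) he
  simpa only [hC] using this

/-- A family of linear maps `c` with `c(a)² = -g(a, a)` extends to a smooth Clifford action as soon
as the evaluation `(a, e) ↦ c(a) e` is smooth, because the plots of the Clifford algebra are
locally combinations of products of plots of `V`. -/
theorem IsPseudoBundle.isCliffordAction (hE : IsPseudoBundle E)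
    {g : ∀ x, V x →ₗ[ℝ] V x →ₗ[ℝ] ℝ} {c : ∀ x, V x →ₗ[ℝ] Module.End ℝ (E x)}
    (hsq : ∀ x a e, c x a (c x a e) = -g x a a • e)
    (hc : ∀ (n : ℕ) (b : Eu n → X) (a : ∀ z, V (b z)) (e : ∀ z, E (b z)), IsPlot b →
      PlotOver V b a → PlotOver E b e → PlotOver E b (fun z => c (b z) (a z) (e z))) :
    IsCliffordAction g c := by
  let C : ∀ x, Cliff g x →ₐ[ℝ] Module.End ℝ (E x) := fun x =>
    CliffordAlgebra.lift (-(LinearMap.BilinMap.toQuadraticMap (g x)))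
      ⟨c x, fun a => LinearMap.ext fun e => hsq x a e⟩
  have hC : ∀ x a, C x (Cliff.ι g x a) = c x a := fun x a =>
    CliffordAlgebra.lift_ι_apply _ _ _
  refine ⟨C, hC, fun n b a e ha he => .of_cutoff fun x => ?_⟩
  obtain ⟨χ, hχ, hχ', hb, L, hL, haL⟩ := Cliff.exists_cutoff_of_plotOver ha x
  refine ⟨χ, hχ, hχ', ?_⟩
  have heχ : PlotOver E (fun z => b (χ z)) (fun z => e (χ z)) := he.comp hχ
  have hprod : ∀ l : List (∀ z, V (b (χ z))), (∀ t ∈ l, PlotOver V (fun z => b (χ z)) t) →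
      PlotOver E (fun z => b (χ z)) (fun z =>
        C _ (l.map fun t => Cliff.ι g (b (χ z)) (t z)).prod (e (χ z))) := by
    intro l hl
    induction l with
    | nil => simpa using heχ
    | cons t l ih =>
      simp only [List.map_cons, List.prod_cons, map_mul, Module.End.mul_apply, hC]
      exact hc n _ _ _ hb (hl t List.mem_cons_self)
        (ih fun r hr => hl r (List.mem_cons_of_mem _ hr))
  have hsum : PlotOver E (fun z => b (χ z)) (fun z =>
      C _ (L.map fun s => s.1 z • (s.2.map fun t => Cliff.ι g (b (χ z)) (t z)).prod).sum
        (e (χ z))) := by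
    clear haL
    induction L with
    | nil =>
      simp only [List.map_nil, List.sum_nil, map_zero, LinearMap.zero_apply]
      exact hE.zero n _ hb
    | cons s L ih =>
      simp only [List.map_cons, List.sum_cons, map_add, LinearMap.add_apply, map_smul,
        LinearMap.smul_apply]
      exact hE.add n _ _ _
        (hE.smul n _ _ _ (hL s List.mem_cons_self).1 (hprod s.2 (hL s List.mem_cons_self).2))
        (ih fun r hr => hL r (List.mem_cons_of_mem _ hr))
  simpa only [haL] using hsum

end Clifford

end

/-! ### Restriction of pseudo-bundles along a smooth map -/

section

variable {X : Type u₁} {Z : Type u₂} [DiffeologicalSpace X] [DiffeologicalSpace Z]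

/-- The family `A` over `X` is the pullback along `i : X → Z` of the family `G` over `Z`: the maps
`L : G (i x) → A x` are bijective, and over a plot `p` of `X` they identify the plots of `G` over
`i ∘ p` with those of `A` over `p`. The point `i x` is replaced by a point `z` equal to it, in order
to avoid transport between fibres. -/
structure Restricts (i : X → Z) {G : Z → Type v} {A : X → Type w} [∀ z, AddCommGroup (G z)]
    [∀ z, Module ℝ (G z)] [∀ x, AddCommGroup (A x)] [∀ x, Module ℝ (A x)]
    [DiffeologicalSpace (Sigma G)] [DiffeologicalSpace (Sigma A)]
    (L : ∀ ⦃x z⦄, i x = z → G z →ₗ[ℝ] A x) : Prop where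
  bijective : ∀ {x z} (h : i x = z), Function.Bijective (L h)
  plot_iff : ∀ {n : ℕ} {p : Eu n → X} {b : Eu n → Z} (h : ∀ z, i (p z) = b z) {s : ∀ z, G (b z)},
    IsPlot p → (PlotOver G b s ↔ PlotOver A p (fun z => L (h z) (s z)))

/-- The section of `A` given by a section of `G`. -/
def restrictSection {i : X → Z} {G : Z → Type v} {A : X → Type w} [∀ z, AddCommGroup (G z)]
    [∀ z, Module ℝ (G z)] [∀ x, AddCommGroup (A x)] [∀ x, Module ℝ (A x)]
    (L : ∀ ⦃x z⦄, i x = z → G z →ₗ[ℝ] A x) (s : ∀ z, G z) (x : X) : A x :=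
  L rfl (s (i x))

/-- The maps `Λ¹_z(Z) → Λ¹_x(X)`, for `z = i x`, induced by a smooth map `i : X → Z`. -/
abbrev Lam.pulls {i : X → Z} (hi : DSmooth i) : ∀ ⦃x z⦄, i x = z → Lam Z z →ₗ[ℝ] Lam X x :=
  fun _ _ h => Lam.pull i hi h

section Families

variable {i : X → Z} {G : Z → Type v} {A : X → Type w} [∀ z, AddCommGroup (G z)]
    [∀ z, Module ℝ (G z)] [∀ x, AddCommGroup (A x)] [∀ x, Module ℝ (A x)]
    [DiffeologicalSpace (Sigma G)] [DiffeologicalSpace (Sigma A)]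
    {L : ∀ ⦃x z⦄, i x = z → G z →ₗ[ℝ] A x}

theorem Restricts.isSmoothSection (hL : Restricts i L) (hi : DSmooth i) {s : ∀ z, G z}
    (hs : IsSmoothSection s) : IsSmoothSection (restrictSection L s) := fun _ p hp =>
  (hL.plot_iff (fun _ => rfl) hp).1 (hs.plotOver (hi _ p hp))

theorem Restricts.isSectionPlot (hL : Restricts i L) (hi : DSmooth i) {k : ℕ}
    {q : Eu k → ∀ z, G z} (hq : IsSectionPlot q) :
    IsSectionPlot (fun z => restrictSection L (q z)) := fun n r p hr hp =>
  (hL.plot_iff (fun _ => rfl) hp).1 (hq n r (i ∘ p) hr (hi _ p hp))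

theorem IsSectionPlot.isSmoothSection {k : ℕ} {q : Eu k → ∀ z, G z} (hq : IsSectionPlot q)
    (z : Eu k) : IsSmoothSection (q z) := fun n p hp =>
  hq n (fun _ => z) p contDiff_const hp

/-- Pullbacks of pseudo-bundles commute with tensor products. -/
theorem Restricts.tens {G' : Z → Type*} {A' : X → Type*} [∀ z, AddCommGroup (G' z)]
    [∀ z, Module ℝ (G' z)] [∀ x, AddCommGroup (A' x)] [∀ x, Module ℝ (A' x)]
    [DiffeologicalSpace (Sigma G')] [DiffeologicalSpace (Sigma A')]
    {L' : ∀ ⦃x z⦄, i x = z → G' z →ₗ[ℝ] A' x} (hi : DSmooth i) (hL : Restricts i L)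
    (hL' : Restricts i L') :
    Restricts i (G := Tens G G') (A := Tens A A') (fun _ _ h => Tens.map (L h) (L' h)) where
  bijective h := Tens.map_bijective (hL.bijective h) (hL'.bijective h)
  plot_iff := by
    intro n p b h s hp
    have hb : IsPlot b := by
      have : b = i ∘ p := funext fun z => (h z).symm
      rw [this]
      exact hi _ p hp
    refine ⟨fun hs => Tens.plotOver_map hp _ _ ?_ ?_ hs, fun hs => ?_⟩
    · exact fun χ hχ t ht => (hL.plot_iff (fun z => h (χ z)) (isPlot_reparam hp hχ)).1 ht
    · exact fun χ hχ t ht => (hL'.plot_iff (fun z => h (χ z)) (isPlot_reparam hp hχ)).1 ht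
    · let φ := fun z => LinearEquiv.ofBijective _ (hL.bijective (h z))
      let ψ := fun z => LinearEquiv.ofBijective _ (hL'.bijective (h z))
      have hφ : ∀ z a, L (h z) ((φ z).symm a) = a := fun z a => (φ z).apply_symm_apply a
      have hψ : ∀ z a, L' (h z) ((ψ z).symm a) = a := fun z a => (ψ z).apply_symm_apply a
      have key := Tens.plotOver_map (E' := G) (F' := G') hb (fun z => (φ z).symm.toLinearMap)
        (fun z => (ψ z).symm.toLinearMap) ?_ ?_ hs
      · refine (congrArg (PlotOver (Tens G G') b) (funext fun z => ?_)).mp key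
        refine (TensorProduct.congr (φ z) (ψ z)).symm_apply_apply (s z)
      · intro χ hχ t ht
        refine (hL.plot_iff (fun z => h (χ z)) (isPlot_reparam hp hχ)).2 ?_
        simpa only [LinearEquiv.coe_coe, hφ] using ht
      · intro χ hχ t ht
        refine (hL'.plot_iff (fun z => h (χ z)) (isPlot_reparam hp hχ)).2 ?_
        simpa only [LinearEquiv.coe_coe, hψ] using ht

theorem Restricts.plotOver_add (hL : Restricts i L) (hA : IsPseudoBundle A) {n : ℕ}
    {p : Eu n → X} {b : Eu n → Z} (h : ∀ z, i (p z) = b z) (hp : IsPlot p) {s t : ∀ z, G (b z)}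
    (hs : PlotOver G b s) (ht : PlotOver G b t) : PlotOver G b (fun z => s z + t z) := by
  refine (hL.plot_iff h hp).2 ?_
  simp only [map_add]
  exact hA.add n p _ _ ((hL.plot_iff h hp).1 hs) ((hL.plot_iff h hp).1 ht)

theorem Restricts.plotOver_smul (hL : Restricts i L) (hA : IsPseudoBundle A) {n : ℕ}
    {p : Eu n → X} {b : Eu n → Z} (h : ∀ z, i (p z) = b z) (hp : IsPlot p) {a : Eu n → ℝ}
    (ha : ContDiff ℝ ∞ a) {s : ∀ z, G (b z)} (hs : PlotOver G b s) :
    PlotOver G b (fun z => a z • s z) := by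
  refine (hL.plot_iff h hp).2 ?_
  simp only [map_smul]
  exact hA.smul n p _ _ ha ((hL.plot_iff h hp).1 hs)

theorem Restricts.plotOver_zero (hL : Restricts i L) (hA : IsPseudoBundle A) {n : ℕ}
    {p : Eu n → X} {b : Eu n → Z} (h : ∀ z, i (p z) = b z) (hp : IsPlot p) :
    PlotOver G b (fun _ => 0) := by
  refine (hL.plot_iff h hp).2 ?_
  simp only [map_zero]
  exact hA.zero n p hp

end Families

/-! ### Restriction of connections -/

section Connections

variable {i : X → Z} {G : Z → Type v} {A : X → Type w} [∀ z, AddCommGroup (G z)]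
    [∀ z, Module ℝ (G z)] [∀ x, AddCommGroup (A x)] [∀ x, Module ℝ (A x)]
    [DiffeologicalSpace (Sigma G)] [DiffeologicalSpace (Sigma A)]
    {L : ∀ ⦃x z⦄, i x = z → G z →ₗ[ℝ] A x} (hi : DSmooth i)

/-- The operator `D` on sections of `G` restricts to the operator `D'` on sections of `A`, under the
identifications of `G (i x)` with `A x` and of `Λ¹(Z)` at `i x` with `Λ¹(X)` at `x`. -/
structure ConnectionRestricts (L : ∀ ⦃x z⦄, i x = z → G z →ₗ[ℝ] A x)
    (D : (∀ z, G z) → ∀ z, Tens (Lam Z) G z) (D' : (∀ x, A x) → ∀ x, Tens (Lam X) A x) :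
    Prop where
  lam : Restricts i (Lam.pulls hi)
  fam : Restricts i L
  map_eq : ∀ s : ∀ z, G z, IsSmoothSection s → ∀ {x z} (h : i x = z),
    Tens.map (Lam.pull i hi h) (L h) (D s z) = D' (restrictSection L s) x

variable {hi} {D : (∀ z, G z) → ∀ z, Tens (Lam Z) G z}
  {D' : (∀ x, A x) → ∀ x, Tens (Lam X) A x}

theorem ConnectionRestricts.injective (h : ConnectionRestricts hi L D D') {x : X} {z : Z}
    (hx : i x = z) :
    Function.Injective (Tens.map (E := Lam Z) (F := G) (Lam.pull i hi hx) (L hx)) :=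
  (Tens.map_bijective (h.lam.bijective hx) (h.fam.bijective hx)).1

theorem ConnectionRestricts.add (h : ConnectionRestricts hi L D D') (hD' : IsConnection D')
    {s t : ∀ z, G z} (hs : IsSmoothSection s) (ht : IsSmoothSection t)
    (hst : IsSmoothSection (fun z => s z + t z)) {x : X} {z : Z} (hx : i x = z) :
    D (fun z => s z + t z) z = D s z + D t z := by
  apply h.injective hx
  have e : restrictSection L (fun z => s z + t z) =
      fun x => restrictSection L s x + restrictSection L t x := funext fun x => map_add _ _ _
  rw [map_add, h.map_eq _ hst, h.map_eq _ hs, h.map_eq _ ht, e,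
    hD'.add _ _ (h.fam.isSmoothSection hi hs) (h.fam.isSmoothSection hi ht)]

theorem ConnectionRestricts.smul (h : ConnectionRestricts hi L D D') (hD' : IsConnection D')
    (a : ℝ) {s : ∀ z, G z} (hs : IsSmoothSection s)
    (has : IsSmoothSection (fun z => a • s z)) {x : X} {z : Z} (hx : i x = z) :
    D (fun z => a • s z) z = a • D s z := by
  apply h.injective hx
  have e : restrictSection L (fun z => a • s z) = fun x => a • restrictSection L s x :=
    funext fun x => map_smul _ _ _
  rw [map_smul, h.map_eq _ has, h.map_eq _ hs, e, hD'.smul _ _ (h.fam.isSmoothSection hi hs)]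

theorem ConnectionRestricts.leibniz (h : ConnectionRestricts hi L D D') (hD' : IsConnection D')
    {a : Z → ℝ} (ha : DSmooth a) {s : ∀ z, G z} (hs : IsSmoothSection s)
    (has : IsSmoothSection (fun z => a z • s z)) {x : X} {z : Z} (hx : i x = z) :
    D (fun z => a z • s z) z = Tens.tmul (dLam a z) (s z) + a z • D s z := by
  apply h.injective hx
  have e : restrictSection L (fun z => a z • s z) =
      fun x => (a ∘ i) x • restrictSection L s x := funext fun x => map_smul _ _ _
  rw [map_add, map_smul, Tens.map_tmul, Lam.pull_dLam hi ha, h.map_eq _ has, h.map_eq _ hs, e,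
    hD'.leibniz _ _ (ha.comp hi) (h.fam.isSmoothSection hi hs)]
  subst hx
  rfl

theorem ConnectionRestricts.plotOver (h : ConnectionRestricts hi L D D') (hD' : IsConnection D')
    {k : ℕ} {q : Eu k → ∀ z, G z} (hq : IsSectionPlot q) {n : ℕ} {r : Eu n → Eu k}
    {p : Eu n → X} {b : Eu n → Z} (hr : ContDiff ℝ ∞ r) (hp : IsPlot p)
    (hpb : ∀ z, i (p z) = b z) : PlotOver (Tens (Lam Z) G) b (fun z => D (q (r z)) (b z)) := by
  refine ((h.lam.tens hi h.fam).plot_iff hpb hp).2 ?_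
  simp only [h.map_eq _ (hq.isSmoothSection _)]
  exact hD'.smooth k _ (h.fam.isSectionPlot hi hq) n r p hr hp

theorem map_contract {x : X} {z : Z} (φ : Lam Z z →ₗ[ℝ] Lam X x) (ψ : G z →ₗ[ℝ] A x)
    (ℓ' : Module.Dual ℝ (Lam X x)) (T : Tens (Lam Z) G z) :
    ψ (contract (ℓ'.comp φ) T) = contract ℓ' (Tens.map φ ψ T) := by
  have : ψ.comp (contract (ℓ'.comp φ)) = (contract (E := A) ℓ').comp (Tens.map φ ψ) :=
    Tens.ext_hom fun a b => map_smul ψ (ℓ' (φ a)) b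
  exact LinearMap.congr_fun this T

theorem map_contractRight {x : X} {z : Z} (φ : Lam Z z →ₗ[ℝ] Lam X x) (ψ : G z →ₗ[ℝ] A x)
    (ℓ' : Module.Dual ℝ (A x)) (T : Tens (Lam Z) G z) :
    φ (contractRight (ℓ'.comp ψ) T) = contractRight ℓ' (Tens.map φ ψ T) := by
  have : φ.comp (contractRight (ℓ'.comp ψ)) =
      (contractRight (E := A) ℓ').comp (Tens.map φ ψ) :=
    Tens.ext_hom fun a b => map_smul φ (ℓ' (ψ b)) a
  exact LinearMap.congr_fun this T

/-- Restriction of covariant derivatives. -/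
theorem ConnectionRestricts.cov (h : ConnectionRestricts hi L D D')
    {t : ∀ z, Module.Dual ℝ (Lam Z z)} {t' : ∀ x, Module.Dual ℝ (Lam X x)}
    {x : X} {z : Z} (hx : i x = z) (ht : t z = (t' x).comp (Lam.pull i hi hx)) {s : ∀ z, G z}
    (hs : IsSmoothSection s) :
    L hx (cov D t s z) = DiffGlue.cov D' t' (restrictSection L s) x := by
  rw [DiffGlue.cov, DiffGlue.cov, ht, map_contract, h.map_eq _ hs]

end Connections

/-! ### Restriction of pseudo-metrics and of Levi-Civita connections -/

section LeviCivita

variable {i : X → Z} {hi : DSmooth i} {g : ∀ z, Lam Z z →ₗ[ℝ] Lam Z z →ₗ[ℝ] ℝ}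
  {g' : ∀ x, Lam X x →ₗ[ℝ] Lam X x →ₗ[ℝ] ℝ}
  {D : (∀ z, Lam Z z) → ∀ z, Tens (Lam Z) (Lam Z) z}
  {D' : (∀ x, Lam X x) → ∀ x, Tens (Lam X) (Lam X) x}

theorem ConnectionRestricts.metric
    (h : ConnectionRestricts hi (Lam.pulls hi) D D')
    (hg : ∀ ⦃x z⦄ (h : i x = z) (a b : Lam Z z),
      g z a b = g' x (Lam.pull i hi h a) (Lam.pull i hi h b))
    (hgs : IsPseudoMetric g) (hD' : IsMetricConnection g' D') {s t : ∀ z, Lam Z z}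
    (hs : IsSmoothSection s) (ht : IsSmoothSection t) {x : X} {z : Z} (hx : i x = z) :
    dLam (fun z => g z (s z) (t z)) z =
      contractRight ((g z).flip (t z)) (D s z) + contractRight (g z (s z)) (D t z) := by
  apply (h.lam.bijective hx).1
  subst hx
  rw [map_add, Lam.pull_dLam hi (hgs.dSmooth hs ht)]
  have e₁ : (g (i x)).flip (t (i x)) =
      ((g' x).flip (Lam.pull i hi rfl (t (i x)))).comp (Lam.pull i hi rfl) :=
    LinearMap.ext fun a => hg rfl _ _
  have e₂ : g (i x) (s (i x)) = (g' x (Lam.pull i hi rfl (s (i x)))).comp (Lam.pull i hi rfl) :=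
    LinearMap.ext fun a => hg rfl _ _
  have e₃ : (fun z => g z (s z) (t z)) ∘ i = fun x => g' x
      (restrictSection (Lam.pulls hi) s x)
      (restrictSection (Lam.pulls hi) t x) := funext fun x => hg rfl _ _
  rw [e₁, e₂, map_contractRight _ (Lam.pull i hi rfl), map_contractRight _ (Lam.pull i hi rfl),
    h.map_eq _ hs, h.map_eq _ ht, e₃]
  exact hD' _ _ (h.fam.isSmoothSection hi hs) (h.fam.isSmoothSection hi ht) x

theorem act_comp (hg : ∀ ⦃x z⦄ (h : i x = z) (a b : Lam Z z),
      g z a b = g' x (Lam.pull i hi h a) (Lam.pull i hi h b)) (s : ∀ z, Lam Z z) {a : Z → ℝ}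
    (ha : DSmooth a) : act (fun z => g z (s z)) a ∘ i =
      act (fun x => g' x (restrictSection (Lam.pulls hi) s x)) (a ∘ i) := by
  funext x
  change g (i x) (s (i x)) (dLam a (i x)) = _
  rw [hg rfl, Lam.pull_dLam hi ha]
  rfl

theorem ConnectionRestricts.symmetric
    (h : ConnectionRestricts hi (Lam.pulls hi) D D')
    (hg : ∀ ⦃x z⦄ (h : i x = z) (a b : Lam Z z),
      g z a b = g' x (Lam.pull i hi h a) (Lam.pull i hi h b))
    (hgs : IsPseudoMetric g) (hD' : IsLeviCivita g' D') {s₁ s₂ : ∀ z, Lam Z z}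
    (hs₁ : IsSmoothSection s₁) (hs₂ : IsSmoothSection s₂) {a : Z → ℝ} (ha : DSmooth a) {x : X}
    {z : Z} (hx : i x = z) :
    act (fun z => g z (DiffGlue.cov D (fun z => g z (s₁ z)) s₂ z -
        DiffGlue.cov D (fun z => g z (s₂ z)) s₁ z)) a z =
      act (fun z => g z (s₁ z)) (act (fun z => g z (s₂ z)) a) z -
        act (fun z => g z (s₂ z)) (act (fun z => g z (s₁ z)) a) z := by
  subst hx
  -- The differential of a function has its meaning only if the function is smooth.
  have hact : ∀ {s : ∀ z, Lam Z z}, IsSmoothSection s → DSmooth (act (fun z => g z (s z)) a) :=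
    fun hs => hgs.dSmooth hs (isSmoothSection_dLam ha)
  have key := hD'.symmetric _ _ (h.fam.isSmoothSection hi hs₁) (h.fam.isSmoothSection hi hs₂)
    (a ∘ i) (ha.comp hi) x
  rw [← act_comp hg s₁ ha, ← act_comp hg s₂ ha, ← act_comp hg s₁ (hact hs₂),
    ← act_comp hg s₂ (hact hs₁)] at key
  refine Eq.trans ?_ key
  have hcov : ∀ {s t : ∀ z, Lam Z z}, IsSmoothSection t →
      Lam.pull i hi rfl (DiffGlue.cov D (fun z => g z (s z)) t (i x)) =
        DiffGlue.cov D' (fun x => g' x (restrictSection (Lam.pulls hi) s x))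
          (restrictSection (Lam.pulls hi) t) x := fun {s t} ht =>
    h.cov (t := fun z => g z (s z)) rfl (LinearMap.ext fun b => hg rfl _ _) ht
  change g (i x) _ (dLam a (i x)) = g' x _ (dLam (a ∘ i) x)
  rw [hg rfl, Lam.pull_dLam hi ha, map_sub, hcov hs₂, hcov hs₁]

end LeviCivita

/-! ### Restriction of smooth duals -/

/-- An element of `E^* ⊗ E^*` is determined by the corresponding bilinear form, if the fibre of `E`
is finite-dimensional. -/
theorem eq_of_evalPair_eq {E : X → Type v} [∀ x, AddCommGroup (E x)] [∀ x, Module ℝ (E x)]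
    [DiffeologicalSpace (Sigma E)] {x : X} [FiniteDimensional ℝ (E x)]
    {T T' : Tens (DualFam E) (DualFam E) x} (h : ∀ a b, evalPair T a b = evalPair T' a b) :
    T = T' := by
  have hinj : Function.Injective (DualFam.toDual (E := E) x) := Subtype.val_injective
  have key : ∀ (T : Tens (DualFam E) (DualFam E) x) (a b : E x), evalPair T a b =
      TensorProduct.dualDistrib ℝ (E x) (E x)
        (TensorProduct.map (DualFam.toDual x) (DualFam.toDual x) T) (a ⊗ₜ b) := by
    intro T a b
    have : (LinearMap.mul' ℝ ℝ).comp (TensorProduct.map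
          ((LinearMap.applyₗ (R := ℝ) a).comp (DualFam.toDual x))
          ((LinearMap.applyₗ (R := ℝ) b).comp (DualFam.toDual x))) =
        (LinearMap.applyₗ (R := ℝ) (a ⊗ₜ[ℝ] b)).comp
          ((TensorProduct.dualDistrib ℝ (E x) (E x)).comp
            (TensorProduct.map (DualFam.toDual x) (DualFam.toDual x))) :=
      TensorProduct.ext' fun _ _ => rfl
    exact LinearMap.congr_fun this T
  have hmap : Function.Injective
      (TensorProduct.map (DualFam.toDual (E := E) x) (DualFam.toDual (E := E) x)) :=
    TensorProduct.map_injective_of_flat_flat _ _ hinj hinj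
  apply hmap
  apply (TensorProduct.dualDistribEquiv ℝ (E x) (E x)).injective
  change TensorProduct.dualDistrib ℝ (E x) (E x) _ = TensorProduct.dualDistrib ℝ (E x) (E x) _
  exact TensorProduct.ext' fun a b => by rw [← key, ← key, h]

section Dual

variable {i : X → Z} {hi : DSmooth i} [∀ x, FiniteDimensional ℝ (Lam X x)]
  [∀ z, FiniteDimensional ℝ (Lam Z z)]

theorem DualFam.exists_toDual_eq (x : X) (ℓ : Module.Dual ℝ (Lam X x)) :
    ∃ t : DualFam (Lam X) x, DualFam.toDual x t = ℓ :=
  ⟨⟨ℓ, by rw [Lam.smoothDual_eq_top]; trivial⟩, rfl⟩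

/-- A smooth section of the dual of `Λ¹(Z)` restricts to one of the dual of `Λ¹(X)`. -/
theorem Restricts.exists_dual_section (h : Restricts i (Lam.pulls hi))
    {t : ∀ z, DualFam (Lam Z) z} (ht : IsSmoothSection t) :
    ∃ t' : ∀ x, DualFam (Lam X) x, IsSmoothSection t' ∧ ∀ {x z} (hx : i x = z),
      DualFam.toDual z (t z) = (DualFam.toDual x (t' x)).comp (Lam.pull i hi hx) := by
  let e := fun x => LinearEquiv.ofBijective _ (h.bijective (x := x) rfl)
  have he : ∀ x a, Lam.pull i hi rfl ((e x).symm a) = a := fun x a => (e x).apply_symm_apply a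
  choose t' ht' using fun x => DualFam.exists_toDual_eq x
    ((DualFam.toDual (i x) (t (i x))).comp (e x).symm.toLinearMap)
  refine ⟨t', fun n p hp => ⟨hp, fun k r s hr hs => ?_⟩, ?_⟩
  · have hs' : PlotOver (Lam Z) (fun z => i (p (r z))) (fun z => (e (p (r z))).symm (s z)) := by
      refine (h.plot_iff (fun z => rfl) (isPlot_reparam hp hr)).2 ?_
      exact (congrArg (PlotOver (Lam X) _) (funext fun z => he _ _)).mpr hs
    have key := (ht n (i ∘ p) (hi _ p hp)).2 k r _ hr hs'
    refine (congrArg (ContDiff ℝ ∞) (funext fun z => ?_)).mpr key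
    exact LinearMap.congr_fun (ht' (p (r z))) (s z)
  · rintro x z rfl
    rw [ht']
    exact LinearMap.ext fun a => congrArg _ ((e x).symm_apply_apply a).symm

/-- The transpose of `Λ¹(Z) → Λ¹(X)`, as a map of smooth duals. -/
def Lam.dualPull (hi : DSmooth i) {x : X} {z : Z} (h : i x = z) :
    DualFam (Lam X) x →ₗ[ℝ] DualFam (Lam Z) z :=
  LinearMap.codRestrict (smoothDual (Lam Z) z)
    ((Lam.pull i hi h).dualMap.comp (DualFam.toDual x)) fun _ => by
      rw [Lam.smoothDual_eq_top]; trivial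

theorem Lam.plotOver_dualPull (hL : Restricts i (Lam.pulls hi)) {n : ℕ}
    {p : Eu n → X} {b : Eu n → Z} (hb : IsPlot b) (h : ∀ z, i (p z) = b z)
    {ℓ : ∀ z, DualFam (Lam X) (p z)} (hℓ : PlotOver (DualFam (Lam X)) p ℓ) :
    PlotOver (DualFam (Lam Z)) b (fun z => Lam.dualPull hi (h z) (ℓ z)) :=
  ⟨hb, fun k r _ hr hs => hℓ.2 k r _ hr
    ((hL.plot_iff (fun z => h (r z)) (isPlot_reparam hℓ.1 hr)).1 hs)⟩

theorem evalPair_map_dualPull {x : X} {z : Z} (h : i x = z)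
    (T : Tens (DualFam (Lam X)) (DualFam (Lam X)) x) (a b : Lam Z z) :
    evalPair (Tens.map (Lam.dualPull hi h) (Lam.dualPull hi h) T) a b =
      evalPair T (Lam.pull i hi h a) (Lam.pull i hi h b) := by
  have : ((LinearMap.mul' ℝ ℝ).comp (TensorProduct.map
        ((LinearMap.applyₗ (R := ℝ) a).comp (DualFam.toDual z))
        ((LinearMap.applyₗ (R := ℝ) b).comp (DualFam.toDual z)))).comp
          (TensorProduct.map (Lam.dualPull hi h) (Lam.dualPull hi h)) =
      (LinearMap.mul' ℝ ℝ).comp (TensorProduct.map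
        ((LinearMap.applyₗ (R := ℝ) (Lam.pull i hi h a)).comp (DualFam.toDual x))
        ((LinearMap.applyₗ (R := ℝ) (Lam.pull i hi h b)).comp (DualFam.toDual x))) :=
    TensorProduct.ext' fun _ _ => rfl
  exact LinearMap.congr_fun this T

end Dual

end

/-! ### Restriction of Clifford connections -/

section

variable {X : Type u₁} {Z : Type u₂} [DiffeologicalSpace X] [DiffeologicalSpace Z] {i : X → Z}
  {G : Z → Type v} {A : X → Type w} [∀ z, AddCommGroup (G z)]
  [∀ z, Module ℝ (G z)] [∀ x, AddCommGroup (A x)] [∀ x, Module ℝ (A x)]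
  [DiffeologicalSpace (Sigma G)] [DiffeologicalSpace (Sigma A)]

/-- The data of a Clifford connection on `G → Z` restrict along `i : X → Z` to those on `A → X`. -/
structure CliffordRestricts (hi : DSmooth i) (L : ∀ ⦃x z⦄, i x = z → G z →ₗ[ℝ] A x)
    (g : ∀ z, Lam Z z →ₗ[ℝ] Lam Z z →ₗ[ℝ] ℝ) (g' : ∀ x, Lam X x →ₗ[ℝ] Lam X x →ₗ[ℝ] ℝ)
    (DΛ : (∀ z, Lam Z z) → ∀ z, Tens (Lam Z) (Lam Z) z)
    (DΛ' : (∀ x, Lam X x) → ∀ x, Tens (Lam X) (Lam X) x)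
    (c : ∀ z, Lam Z z →ₗ[ℝ] Module.End ℝ (G z)) (c' : ∀ x, Lam X x →ₗ[ℝ] Module.End ℝ (A x))
    (D : (∀ z, G z) → ∀ z, Tens (Lam Z) G z) (D' : (∀ x, A x) → ∀ x, Tens (Lam X) A x) :
    Prop where
  lamConn : ConnectionRestricts hi (Lam.pulls hi) DΛ DΛ'
  conn : ConnectionRestricts hi L D D'
  metric : ∀ ⦃x z⦄ (h : i x = z) (a b : Lam Z z),
    g z a b = g' x (Lam.pull i hi h a) (Lam.pull i hi h b)
  action : ∀ ⦃x z⦄ (h : i x = z) (a : Lam Z z) (e : G z),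
    L h (c z a e) = c' x (Lam.pull i hi h a) (L h e)

variable {hi : DSmooth i} {L : ∀ ⦃x z⦄, i x = z → G z →ₗ[ℝ] A x}
  {g : ∀ z, Lam Z z →ₗ[ℝ] Lam Z z →ₗ[ℝ] ℝ} {g' : ∀ x, Lam X x →ₗ[ℝ] Lam X x →ₗ[ℝ] ℝ}
  {DΛ : (∀ z, Lam Z z) → ∀ z, Tens (Lam Z) (Lam Z) z}
  {DΛ' : (∀ x, Lam X x) → ∀ x, Tens (Lam X) (Lam X) x}
  {c : ∀ z, Lam Z z →ₗ[ℝ] Module.End ℝ (G z)} {c' : ∀ x, Lam X x →ₗ[ℝ] Module.End ℝ (A x)}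
  {D : (∀ z, G z) → ∀ z, Tens (Lam Z) G z} {D' : (∀ x, A x) → ∀ x, Tens (Lam X) A x}

theorem CliffordRestricts.finiteDimensional_lam
    (h : CliffordRestricts hi L g g' DΛ DΛ' c c' D D') {x : X} {z : Z} (hx : i x = z)
    [FiniteDimensional ℝ (Lam X x)] : FiniteDimensional ℝ (Lam Z z) :=
  .of_injective (Lam.pull i hi hx) (h.lamConn.lam.bijective hx).1

theorem CliffordRestricts.finiteDimensional
    (h : CliffordRestricts hi L g g' DΛ DΛ' c c' D D') {x : X} {z : Z} (hx : i x = z)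
    [FiniteDimensional ℝ (A x)] : FiniteDimensional ℝ (G z) :=
  .of_injective (L hx) (h.conn.fam.bijective hx).1

theorem CliffordRestricts.ker_eq_bot (h : CliffordRestricts hi L g g' DΛ DΛ' c c' D D') {x : X}
    {z : Z} (hx : i x = z) (hg' : LinearMap.ker (g' x) = ⊥) : LinearMap.ker (g z) = ⊥ := by
  have hb := h.lamConn.lam.bijective hx
  rw [LinearMap.ker_eq_bot'] at hg' ⊢
  intro a ha
  apply hb.1
  rw [map_zero]
  refine hg' _ (LinearMap.ext fun b' => ?_)
  obtain ⟨b, rfl⟩ := hb.2 b'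
  change g' x (Lam.pull i hi hx a) (Lam.pull i hi hx b) = 0
  rw [← h.metric hx, ha, LinearMap.zero_apply]

theorem CliffordRestricts.sq (h : CliffordRestricts hi L g g' DΛ DΛ' c c' D D')
    (hc' : IsCliffordAction g' c') {x : X} {z : Z} (hx : i x = z) (a : Lam Z z) (e : G z) :
    c z a (c z a e) = -g z a a • e := by
  apply (h.conn.fam.bijective hx).1
  rw [h.action, h.action, hc'.sq, map_smul, h.metric hx]

theorem CliffordRestricts.plotOver_action (h : CliffordRestricts hi L g g' DΛ DΛ' c c' D D')
    (hc' : IsCliffordAction g' c') {n : ℕ} {p : Eu n → X} {b : Eu n → Z}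
    (hpb : ∀ z, i (p z) = b z) (hp : IsPlot p) {a : ∀ z, Lam Z (b z)} {e : ∀ z, G (b z)}
    (ha : PlotOver (Lam Z) b a) (he : PlotOver G b e) :
    PlotOver G b (fun z => c (b z) (a z) (e z)) := by
  refine (h.conn.fam.plot_iff hpb hp).2 ?_
  simp only [h.action (hpb _)]
  exact hc'.plotOver hp ((h.lamConn.lam.plot_iff hpb hp).1 ha) ((h.conn.fam.plot_iff hpb hp).1 he)

theorem CliffordRestricts.clifford [∀ z, FiniteDimensional ℝ (Lam Z z)]
    (h : CliffordRestricts hi L g g' DΛ DΛ' c c' D D') (h' : IsCliffordConnection g' DΛ' c' D')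
    {t : ∀ z, DualFam (Lam Z) z} {s : ∀ z, Lam Z z} {r : ∀ z, G z} (ht : IsSmoothSection t)
    (hs : IsSmoothSection s) (hr : IsSmoothSection r)
    (hsr : IsSmoothSection (fun z => c z (s z) (r z))) {x : X} {z : Z} (hx : i x = z) :
    cov D (fun z => DualFam.toDual z (t z)) (fun z => c z (s z) (r z)) z =
      c z (cov DΛ (fun z => DualFam.toDual z (t z)) s z) (r z) +
      c z (s z) (cov D (fun z => DualFam.toDual z (t z)) r z) := by
  have := h'.finite_lam
  obtain ⟨t', ht', htt'⟩ := h.lamConn.lam.exists_dual_section ht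
  apply (h.conn.fam.bijective hx).1
  have e : restrictSection L (fun z => c z (s z) (r z)) =
      fun x => c' x (restrictSection (Lam.pulls hi) s x) (restrictSection L r x) :=
    funext fun x => h.action rfl _ _
  have key := h'.clifford t' _ _ ht' (h.lamConn.lam.isSmoothSection hi hs)
    (h.conn.fam.isSmoothSection hi hr) x
  rw [map_add, h.action hx, h.action hx,
    h.conn.cov (t' := fun x => DualFam.toDual x (t' x)) hx (htt' hx) hsr,
    h.conn.cov (t' := fun x => DualFam.toDual x (t' x)) hx (htt' hx) hr,
    h.lamConn.cov (t' := fun x => DualFam.toDual x (t' x)) hx (htt' hx) hs, e, key]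
  subst hx
  rfl

end

theorem Lam.isPseudoBundle (X : Type u) [DiffeologicalSpace X] : IsPseudoBundle (Lam X) where
  proj _ _ hp := Lam.isPlot_base hp
  add n b s t hs ht := by
    refine .of_cutoff fun x => ?_
    obtain ⟨χ, hχ, hχ', -, η, hη, hs'⟩ := Lam.exists_cutoff_of_plotOver hs x
    obtain ⟨ξ, hξ, hξ', hb, θ, hθ, ht'⟩ := Lam.exists_cutoff_of_plotOver (ht.comp hχ) x
    refine ⟨χ ∘ ξ, hχ.comp hξ, ?_, ?_⟩
    · filter_upwards [hχ', hξ'] with y hy hy'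
      simp [hy, hy']
    · have key := Lam.plotOver_mk (η := fun z => η (ξ z) + θ z) hb fun n p =>
        ((hη n p).comp ((hξ.comp contDiff_fst).prodMk contDiff_snd)).add (hθ n p)
      refine (congrArg (PlotOver (Lam X) _) (funext fun z => ?_)).mpr key
      rw [map_add, ← hs', ← ht']
      rfl
  smul n b a s ha hs := by
    refine .of_cutoff fun x => ?_
    obtain ⟨χ, hχ, hχ', hb, η, hη, hs'⟩ := Lam.exists_cutoff_of_plotOver hs x
    refine ⟨χ, hχ, hχ', ?_⟩
    have key := Lam.plotOver_mk (η := fun z => a (χ z) • η z) hb fun n p =>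
      ((ha.comp hχ).comp contDiff_fst).smul (hη n p)
    refine (congrArg (PlotOver (Lam X) _) (funext fun z => ?_)).mpr key
    rw [map_smul, ← hs']
  zero n p hp := by
    have key := Lam.plotOver_mk (η := fun _ => 0) hp isPlot_const
    exact (congrArg (PlotOver (Lam X) p) (funext fun z => map_zero (Lam.mk (p z)))).mp key

theorem IsPseudoBundle.isSmoothSection_add {X : Type u} [DiffeologicalSpace X] {E : X → Type v}
    [∀ x, AddCommGroup (E x)] [∀ x, Module ℝ (E x)] [DiffeologicalSpace (Sigma E)]
    (hE : IsPseudoBundle E) {s t : ∀ x, E x} (hs : IsSmoothSection s) (ht : IsSmoothSection t) :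
    IsSmoothSection (fun x => s x + t x) :=
  fun n p hp => hE.add n p _ _ (hs.plotOver hp) (ht.plotOver hp)

theorem IsPseudoBundle.isSmoothSection_smul {X : Type u} [DiffeologicalSpace X] {E : X → Type v}
    [∀ x, AddCommGroup (E x)] [∀ x, Module ℝ (E x)] [DiffeologicalSpace (Sigma E)]
    (hE : IsPseudoBundle E) {a : X → ℝ} {s : ∀ x, E x} (ha : DSmooth a)
    (hs : IsSmoothSection s) : IsSmoothSection (fun x => a x • s x) :=
  fun n p hp => hE.smul n p _ _ (isPlot_iff_contDiff.1 (ha n p hp)) (hs.plotOver hp)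

/-! ### Descent along a covering pair of maps -/

section

variable {X₁ : Type u₁} {X₂ : Type u₂} {Z : Type u} [DiffeologicalSpace X₁]
  [DiffeologicalSpace X₂] [DiffeologicalSpace Z]

/-- The smooth maps `i₁` and `i₂` cover `Z`: every plot of `Z` lifts locally along one of them. -/
structure IsCover (i₁ : X₁ → Z) (i₂ : X₂ → Z) : Prop where
  smooth₁ : DSmooth i₁
  smooth₂ : DSmooth i₂
  exists_cutoff : ∀ {n : ℕ} {b : Eu n → Z}, IsPlot b → ∀ x, ∃ χ : Eu n → Eu n,
    ContDiff ℝ ∞ χ ∧ (∀ᶠ y in 𝓝 x, χ y = y) ∧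
      ((∃ p, IsPlot p ∧ ∀ z, i₁ (p z) = b (χ z)) ∨ ∃ p, IsPlot p ∧ ∀ z, i₂ (p z) = b (χ z))

variable {i₁ : X₁ → Z} {i₂ : X₂ → Z}

theorem IsCover.surjective (h : IsCover i₁ i₂) (z : Z) : (∃ x, i₁ x = z) ∨ ∃ x, i₂ x = z := by
  obtain ⟨χ, -, -, ⟨p, -, hp⟩ | ⟨p, -, hp⟩⟩ := h.exists_cutoff (isPlot_const (n := 0) (x := z)) 0
  · exact .inl ⟨p 0, hp 0⟩
  · exact .inr ⟨p 0, hp 0⟩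

theorem IsCover.plotOver (h : IsCover i₁ i₂) {G : Z → Type v} [DiffeologicalSpace (Sigma G)]
    {n : ℕ} {b : Eu n → Z} (hb : IsPlot b) {s : ∀ z, G (b z)}
    (h₁ : ∀ χ : Eu n → Eu n, ContDiff ℝ ∞ χ → ∀ p, IsPlot p → (∀ z, i₁ (p z) = b (χ z)) →
      PlotOver G (fun z => b (χ z)) (fun z => s (χ z)))
    (h₂ : ∀ χ : Eu n → Eu n, ContDiff ℝ ∞ χ → ∀ p, IsPlot p → (∀ z, i₂ (p z) = b (χ z)) →
      PlotOver G (fun z => b (χ z)) (fun z => s (χ z))) : PlotOver G b s := by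
  refine .of_cutoff fun x => ?_
  obtain ⟨χ, hχ, hχ', ⟨p, hp, hpb⟩ | ⟨p, hp, hpb⟩⟩ := h.exists_cutoff hb x
  · exact ⟨χ, hχ, hχ', h₁ χ hχ p hp hpb⟩
  · exact ⟨χ, hχ, hχ', h₂ χ hχ p hp hpb⟩

variable {G : Z → Type v} {A₁ : X₁ → Type w} {A₂ : X₂ → Type*} [∀ z, AddCommGroup (G z)]
  [∀ z, Module ℝ (G z)] [∀ x, AddCommGroup (A₁ x)] [∀ x, Module ℝ (A₁ x)]
  [∀ x, AddCommGroup (A₂ x)] [∀ x, Module ℝ (A₂ x)] [DiffeologicalSpace (Sigma G)]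
  [DiffeologicalSpace (Sigma A₁)] [DiffeologicalSpace (Sigma A₂)]
  {L₁ : ∀ ⦃x z⦄, i₁ x = z → G z →ₗ[ℝ] A₁ x} {L₂ : ∀ ⦃x z⦄, i₂ x = z → G z →ₗ[ℝ] A₂ x}

theorem IsCover.isPseudoBundle (h : IsCover i₁ i₂) (h₁ : Restricts i₁ L₁) (h₂ : Restricts i₂ L₂)
    (hA₁ : IsPseudoBundle A₁) (hA₂ : IsPseudoBundle A₂)
    (hproj : DSmooth (Sigma.fst : Sigma G → Z)) :
    IsPseudoBundle G where
  proj := hproj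
  add n _ _ _ hs ht := h.plotOver (hproj n _ hs)
    (fun _ hχ _ hp hpb => h₁.plotOver_add hA₁ hpb hp (hs.comp hχ) (ht.comp hχ))
    (fun _ hχ _ hp hpb => h₂.plotOver_add hA₂ hpb hp (hs.comp hχ) (ht.comp hχ))
  smul n _ _ _ ha hs := h.plotOver (hproj n _ hs)
    (fun _ hχ _ hp hpb => h₁.plotOver_smul hA₁ hpb hp (ha.comp hχ) (hs.comp hχ))
    (fun _ hχ _ hp hpb => h₂.plotOver_smul hA₂ hpb hp (ha.comp hχ) (hs.comp hχ))
  zero _ _ hb := h.plotOver (s := fun _ => 0) hb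
    (fun _ _ _ hp hpb => h₁.plotOver_zero hA₁ hpb hp)
    (fun _ _ _ hp hpb => h₂.plotOver_zero hA₂ hpb hp)

theorem IsCover.isConnection (h : IsCover i₁ i₂) (hG : IsPseudoBundle G)
    {D : (∀ z, G z) → ∀ z, Tens (Lam Z) G z} {D₁ : (∀ x, A₁ x) → ∀ x, Tens (Lam X₁) A₁ x}
    {D₂ : (∀ x, A₂ x) → ∀ x, Tens (Lam X₂) A₂ x}
    (h₁ : ConnectionRestricts h.smooth₁ L₁ D D₁) (h₂ : ConnectionRestricts h.smooth₂ L₂ D D₂)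
    (hD₁ : IsConnection D₁) (hD₂ : IsConnection D₂) : IsConnection D where
  smooth k q hq n r b hr hb := h.plotOver hb
    (fun _ hχ _ hp hpb => h₁.plotOver hD₁ hq (hr.comp hχ) hp hpb)
    (fun _ hχ _ hp hpb => h₂.plotOver hD₂ hq (hr.comp hχ) hp hpb)
  add s t hs ht z := by
    have hst := hG.isSmoothSection_add hs ht
    obtain ⟨x, hx⟩ | ⟨x, hx⟩ := h.surjective z
    · exact h₁.add hD₁ hs ht hst hx
    · exact h₂.add hD₂ hs ht hst hx
  smul a s hs z := by
    have has := hG.isSmoothSection_smul (dSmooth_const (y := a)) hs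
    obtain ⟨x, hx⟩ | ⟨x, hx⟩ := h.surjective z
    · exact h₁.smul hD₁ a hs has hx
    · exact h₂.smul hD₂ a hs has hx
  leibniz a s ha hs z := by
    have has := hG.isSmoothSection_smul ha hs
    obtain ⟨x, hx⟩ | ⟨x, hx⟩ := h.surjective z
    · exact h₁.leibniz hD₁ ha hs has hx
    · exact h₂.leibniz hD₂ ha hs has hx

variable {g : ∀ z, Lam Z z →ₗ[ℝ] Lam Z z →ₗ[ℝ] ℝ}
  {g₁ : ∀ x, Lam X₁ x →ₗ[ℝ] Lam X₁ x →ₗ[ℝ] ℝ} {g₂ : ∀ x, Lam X₂ x →ₗ[ℝ] Lam X₂ x →ₗ[ℝ] ℝ}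

/-- The elements of `Λ¹(Z)^* ⊗ Λ¹(Z)^*` that represent `g` form a smooth section, since they are
the transports of those that represent `g₁` and `g₂`. -/
theorem IsCover.exists_smooth_metric (h : IsCover i₁ i₂) [∀ x, FiniteDimensional ℝ (Lam X₁ x)]
    [∀ x, FiniteDimensional ℝ (Lam X₂ x)] [∀ z, FiniteDimensional ℝ (Lam Z z)]
    (hL₁ : Restricts i₁ (Lam.pulls h.smooth₁)) (hL₂ : Restricts i₂ (Lam.pulls h.smooth₂))
    (hg₁ : IsPseudoMetric g₁) (hg₂ : IsPseudoMetric g₂)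
    (hgg₁ : ∀ ⦃x z⦄ (hx : i₁ x = z) (a b : Lam Z z),
      g z a b = g₁ x (Lam.pull i₁ h.smooth₁ hx a) (Lam.pull i₁ h.smooth₁ hx b))
    (hgg₂ : ∀ ⦃x z⦄ (hx : i₂ x = z) (a b : Lam Z z),
      g z a b = g₂ x (Lam.pull i₂ h.smooth₂ hx a) (Lam.pull i₂ h.smooth₂ hx b)) :
    ∃ T : ∀ z, Tens (DualFam (Lam Z)) (DualFam (Lam Z)) z, IsSmoothSection T ∧
      ∀ z a b, g z a b = evalPair (T z) a b := by
  obtain ⟨T₁, hT₁, hgT₁⟩ := hg₁.smooth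
  obtain ⟨T₂, hT₂, hgT₂⟩ := hg₂.smooth
  have e₁ : ∀ ⦃x z⦄ (hx : i₁ x = z) (a b : Lam Z z), g z a b = evalPair
      (Tens.map (Lam.dualPull h.smooth₁ hx) (Lam.dualPull h.smooth₁ hx) (T₁ x)) a b :=
    fun x z hx a b => by rw [evalPair_map_dualPull, ← hgT₁, hgg₁ hx]
  have e₂ : ∀ ⦃x z⦄ (hx : i₂ x = z) (a b : Lam Z z), g z a b = evalPair
      (Tens.map (Lam.dualPull h.smooth₂ hx) (Lam.dualPull h.smooth₂ hx) (T₂ x)) a b :=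
    fun x z hx a b => by rw [evalPair_map_dualPull, ← hgT₂, hgg₂ hx]
  have hex : ∀ z, ∃ T : Tens (DualFam (Lam Z)) (DualFam (Lam Z)) z,
      ∀ a b, g z a b = evalPair T a b := by
    intro z
    obtain ⟨x, hx⟩ | ⟨x, hx⟩ := h.surjective z
    · exact ⟨_, e₁ hx⟩
    · exact ⟨_, e₂ hx⟩
  -- `T z` does not depend on the lift of `z`, since it is determined by `g z`.
  choose T hT using hex
  refine ⟨T, fun n b hb => h.plotOver (s := fun z => T (b z)) hb ?_ ?_, hT⟩
  · intro χ hχ p hp hpb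
    have hbχ : IsPlot (fun z => b (χ z)) := isPlot_reparam hb hχ
    have key := Tens.plotOver_map hbχ (fun z => Lam.dualPull h.smooth₁ (hpb z))
      (fun z => Lam.dualPull h.smooth₁ (hpb z))
      (fun ξ hξ _ hℓ => Lam.plotOver_dualPull hL₁ (isPlot_reparam hbχ hξ) (fun z => hpb (ξ z)) hℓ)
      (fun ξ hξ _ hℓ => Lam.plotOver_dualPull hL₁ (isPlot_reparam hbχ hξ) (fun z => hpb (ξ z)) hℓ)
      (hT₁.plotOver hp)
    refine (congrArg (PlotOver (Tens (DualFam (Lam Z)) (DualFam (Lam Z))) (fun z => b (χ z)))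
      (funext fun z => ?_)).mpr key
    exact eq_of_evalPair_eq fun a a' => (hT _ _ _).symm.trans (e₁ (hpb z) a a')
  · intro χ hχ p hp hpb
    have hbχ : IsPlot (fun z => b (χ z)) := isPlot_reparam hb hχ
    have key := Tens.plotOver_map hbχ (fun z => Lam.dualPull h.smooth₂ (hpb z))
      (fun z => Lam.dualPull h.smooth₂ (hpb z))
      (fun ξ hξ _ hℓ => Lam.plotOver_dualPull hL₂ (isPlot_reparam hbχ hξ) (fun z => hpb (ξ z)) hℓ)
      (fun ξ hξ _ hℓ => Lam.plotOver_dualPull hL₂ (isPlot_reparam hbχ hξ) (fun z => hpb (ξ z)) hℓ)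
      (hT₂.plotOver hp)
    refine (congrArg (PlotOver (Tens (DualFam (Lam Z)) (DualFam (Lam Z))) (fun z => b (χ z)))
      (funext fun z => ?_)).mpr key
    exact eq_of_evalPair_eq fun a a' => (hT _ _ _).symm.trans (e₂ (hpb z) a a')

/-- A Clifford connection on `Z` may be recognized on the members of a covering pair of maps. -/
theorem IsCover.isCliffordConnection (h : IsCover i₁ i₂)
    {DΛ : (∀ z, Lam Z z) → ∀ z, Tens (Lam Z) (Lam Z) z}
    {DΛ₁ : (∀ x, Lam X₁ x) → ∀ x, Tens (Lam X₁) (Lam X₁) x}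
    {DΛ₂ : (∀ x, Lam X₂ x) → ∀ x, Tens (Lam X₂) (Lam X₂) x}
    {c : ∀ z, Lam Z z →ₗ[ℝ] Module.End ℝ (G z)}
    {c₁ : ∀ x, Lam X₁ x →ₗ[ℝ] Module.End ℝ (A₁ x)}
    {c₂ : ∀ x, Lam X₂ x →ₗ[ℝ] Module.End ℝ (A₂ x)}
    {D : (∀ z, G z) → ∀ z, Tens (Lam Z) G z} {D₁ : (∀ x, A₁ x) → ∀ x, Tens (Lam X₁) A₁ x}
    {D₂ : (∀ x, A₂ x) → ∀ x, Tens (Lam X₂) A₂ x}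
    (hproj : DSmooth (Sigma.fst : Sigma G → Z))
    (h₁ : CliffordRestricts h.smooth₁ L₁ g g₁ DΛ DΛ₁ c c₁ D D₁)
    (h₂ : CliffordRestricts h.smooth₂ L₂ g g₂ DΛ DΛ₂ c c₂ D D₂)
    (hD₁ : IsCliffordConnection g₁ DΛ₁ c₁ D₁) (hD₂ : IsCliffordConnection g₂ DΛ₂ c₂ D₂) :
    IsCliffordConnection g DΛ c D := by
  have := hD₁.finite_lam
  have := hD₂.finite_lam
  have := hD₁.finite
  have := hD₂.finite
  have hfin : ∀ z, FiniteDimensional ℝ (Lam Z z) := by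
    intro z
    obtain ⟨x, hx⟩ | ⟨x, hx⟩ := h.surjective z
    · exact h₁.finiteDimensional_lam hx
    · exact h₂.finiteDimensional_lam hx
  have hmetric : IsPseudoMetric g :=
    { smooth := h.exists_smooth_metric h₁.lamConn.lam h₂.lamConn.lam hD₁.metric hD₂.metric
        h₁.metric h₂.metric
      symm := by
        intro z a b
        obtain ⟨x, hx⟩ | ⟨x, hx⟩ := h.surjective z
        · rw [h₁.metric hx, h₁.metric hx, hD₁.metric.symm]
        · rw [h₂.metric hx, h₂.metric hx, hD₂.metric.symm]
      nonneg := by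
        intro z a
        obtain ⟨x, hx⟩ | ⟨x, hx⟩ := h.surjective z
        · rw [h₁.metric hx]
          exact hD₁.metric.nonneg _ _
        · rw [h₂.metric hx]
          exact hD₂.metric.nonneg _ _
      rank := by
        intro z
        have hker : LinearMap.ker (g z) = ⊥ := by
          obtain ⟨x, hx⟩ | ⟨x, hx⟩ := h.surjective z
          · exact h₁.ker_eq_bot hx (hD₁.metric.ker_eq_bot x)
          · exact h₂.ker_eq_bot hx (hD₂.metric.ker_eq_bot x)
        rw [hker, finrank_bot, Lam.finrank_dualFam, zero_add] }
  have hG : IsPseudoBundle G :=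
    h.isPseudoBundle h₁.conn.fam h₂.conn.fam hD₁.bundle hD₂.bundle hproj
  have hact : ∀ (n : ℕ) (b : Eu n → Z) (a : ∀ z, Lam Z (b z)) (e : ∀ z, G (b z)), IsPlot b →
      PlotOver (Lam Z) b a → PlotOver G b e → PlotOver G b (fun z => c (b z) (a z) (e z)) :=
    fun n b a e hb ha he => h.plotOver hb
      (fun _ hχ _ hp hpb => h₁.plotOver_action hD₁.action hpb hp (ha.comp hχ) (he.comp hχ))
      (fun _ hχ _ hp hpb => h₂.plotOver_action hD₂.action hpb hp (ha.comp hχ) (he.comp hχ))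
  refine
    { finite_lam := hfin
      metric := hmetric
      leviCivita := ⟨?_, ?_, ?_⟩
      bundle := hG
      finite := ?_
      action := hG.isCliffordAction ?_ hact
      connection := h.isConnection hG h₁.conn h₂.conn hD₁.connection hD₂.connection
      clifford := ?_ }
  · exact h.isConnection (Lam.isPseudoBundle Z) h₁.lamConn h₂.lamConn hD₁.leviCivita.connection
      hD₂.leviCivita.connection
  · intro s t hs ht z
    obtain ⟨x, hx⟩ | ⟨x, hx⟩ := h.surjective z
    · exact h₁.lamConn.metric h₁.metric hmetric hD₁.leviCivita.metric hs ht hx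
    · exact h₂.lamConn.metric h₂.metric hmetric hD₂.leviCivita.metric hs ht hx
  · intro s₁ s₂ hs₁ hs₂ a ha z
    obtain ⟨x, hx⟩ | ⟨x, hx⟩ := h.surjective z
    · exact h₁.lamConn.symmetric h₁.metric hmetric hD₁.leviCivita hs₁ hs₂ ha hx
    · exact h₂.lamConn.symmetric h₂.metric hmetric hD₂.leviCivita hs₁ hs₂ ha hx
  · intro z
    obtain ⟨x, hx⟩ | ⟨x, hx⟩ := h.surjective z
    · exact h₁.finiteDimensional hx
    · exact h₂.finiteDimensional hx
  · intro z a e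
    obtain ⟨x, hx⟩ | ⟨x, hx⟩ := h.surjective z
    · exact h₁.sq hD₁.action hx a e
    · exact h₂.sq hD₂.action hx a e
  · intro t s r ht hs hr z
    have hsr : IsSmoothSection (fun z => c z (s z) (r z)) := fun n b hb =>
      hact n b _ _ hb (hs.plotOver hb) (hr.plotOver hb)
    obtain ⟨x, hx⟩ | ⟨x, hx⟩ := h.surjective z
    · exact h₁.clifford hD₁ ht hs hr hsr hx
    · exact h₂.clifford hD₂ ht hs hr hsr hx

end

/-! ### Plots of the glued space -/

section Glue

variable {X₁ : Type u₁} {X₂ : Type u₂} {Y : Set X₁} {f : Y → X₂}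

theorem Glue.i₁_injective (hf : Function.Injective f) : Function.Injective (Glue.i₁ f) := by
  intro x x' h
  by_cases hx : x ∈ Y <;> by_cases hx' : x' ∈ Y <;> simp [Glue.i₁, hx, hx'] at h
  · exact congrArg Subtype.val (hf h)
  · exact h

theorem Glue.i₂_injective : Function.Injective (Glue.i₂ f) := fun _ _ h => Glue.right.inj h

theorem Glue.exists_of_i₁_eq_i₂ {x : X₁} {z : X₂} (h : Glue.i₁ f x = Glue.i₂ f z) :
    ∃ hx : x ∈ Y, f ⟨x, hx⟩ = z := by
  by_cases hx : x ∈ Y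
  · exact ⟨hx, by simpa [Glue.i₁, Glue.i₂, hx] using h⟩
  · simp [Glue.i₁, Glue.i₂, hx] at h

variable [DiffeologicalSpace X₁] [DiffeologicalSpace X₂]

theorem Glue.isCover (f : Y → X₂) : IsCover (Glue.i₁ f) (Glue.i₂ f) where
  smooth₁ := Glue.dSmooth_i₁ f
  smooth₂ := Glue.dSmooth_i₂ f
  exists_cutoff := by
    intro n b hb x
    obtain ⟨χ, hχ, hχ', ⟨p, hp, he⟩ | ⟨p, hp, he⟩⟩ :=
      exists_cutoff_ofLocal (by unfold instGlue; rfl) hb x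
    · exact ⟨χ, hχ, hχ', .inl ⟨p, hp, fun z => (congrFun he z).symm⟩⟩
    · exact ⟨χ, hχ, hχ', .inr ⟨p, hp, fun z => (congrFun he z).symm⟩⟩

theorem Glue.exists_lift {n : ℕ} (q : Plot (Glue f) n) (z : Eu n) :
    (∃ p : Plot X₁ n, q.1 =ᶠ[𝓝 z] Glue.i₁ f ∘ p.1) ∨
      ∃ p : Plot X₂ n, q.1 =ᶠ[𝓝 z] Glue.i₂ f ∘ p.1 := by
  obtain ⟨χ, -, hχ', ⟨p, hp, he⟩ | ⟨p, hp, he⟩⟩ := (Glue.isCover f).exists_cutoff q.2 z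
  · refine .inl ⟨⟨p, hp⟩, ?_⟩
    filter_upwards [hχ'] with y hy
    change q.1 y = Glue.i₁ f (p y)
    rw [he, hy]
  · refine .inr ⟨⟨p, hp⟩, ?_⟩
    filter_upwards [hχ'] with y hy
    change q.1 y = Glue.i₂ f (p y)
    rw [he, hy]

/-! ### Gluing of 1-forms -/

/-- Two 1-forms which agree on `Y` have the same value on plots of `X₁` and `X₂` with the same germ
in the glued space. -/
theorem Form.eq_of_germ_eq {hf : DSmooth f} {ω₁ : Form X₁} {ω₂ : Form X₂}
    (hω : Form.pull Subtype.val (dSmooth_val Y) ω₁ = Form.pull f hf ω₂) {n : ℕ} {p₁ : Plot X₁ n}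
    {p₂ : Plot X₂ n} {z : Eu n} (h : Glue.i₁ f ∘ p₁.1 =ᶠ[𝓝 z] Glue.i₂ f ∘ p₂.1) :
    ω₁.1 n p₁ z = ω₂.1 n p₂ z := by
  obtain ⟨χ, hχ, hχ', he⟩ := exists_cutoff_of_eventually h
  choose hY hfY using fun y => Glue.exists_of_i₁_eq_i₂ (he y)
  let r : Plot Y n := ⟨fun y => ⟨p₁.1 (χ y), hY y⟩, isPlot_reparam p₁.2 hχ⟩
  have e₁ : ω₁.1 n (p₁.comp χ hχ) z = ω₂.1 n (p₂.comp χ hχ) z := by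
    have e₂ : p₂.comp χ hχ = ⟨f ∘ r.1, hf _ _ r.2⟩ := Subtype.ext (funext fun y => (hfY y).symm)
    rw [e₂]
    exact congrArg (fun η : Form Y => η.1 n r z) hω
  have hc₁ : ω₁.1 n (p₁.comp χ hχ) z = ω₁.1 n p₁ z :=
    Form.congr_of_eventuallyEq ω₁ (hχ'.mono fun _ hy => congrArg p₁.1 hy)
  have hc₂ : ω₂.1 n (p₂.comp χ hχ) z = ω₂.1 n p₂ z :=
    Form.congr_of_eventuallyEq ω₂ (hχ'.mono fun _ hy => congrArg p₂.1 hy)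
  rw [← hc₁, ← hc₂, e₁]

open Classical in
/-- The value on a plot of the glued space of the 1-form given by two 1-forms: near each point, the
plot is lifted to `X₁` or to `X₂`. One of the two lifts exists, so that the value `0` never occurs.
-/
def Form.glueVal (ω₁ : Form X₁) (ω₂ : Form X₂) : PreForm (Glue f) := fun n q z =>
  if h : ∃ p : Plot X₁ n, q.1 =ᶠ[𝓝 z] Glue.i₁ f ∘ p.1 then ω₁.1 n h.choose z
  else if h : ∃ p : Plot X₂ n, q.1 =ᶠ[𝓝 z] Glue.i₂ f ∘ p.1 then ω₂.1 n h.choose z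
  else 0

theorem Form.glueVal_left (hf : Function.Injective f) (ω₁ : Form X₁) (ω₂ : Form X₂) {n : ℕ}
    {q : Plot (Glue f) n} {z : Eu n} {p : Plot X₁ n} (h : q.1 =ᶠ[𝓝 z] Glue.i₁ f ∘ p.1) :
    Form.glueVal ω₁ ω₂ n q z = ω₁.1 n p z := by
  have hex : ∃ p : Plot X₁ n, q.1 =ᶠ[𝓝 z] Glue.i₁ f ∘ p.1 := ⟨p, h⟩
  rw [Form.glueVal, dif_pos hex]
  apply Form.congr_of_eventuallyEq ω₁
  filter_upwards [hex.choose_spec, h] with y hy hy'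
  exact Glue.i₁_injective hf (hy.symm.trans hy')

theorem Form.glueVal_right {hf : DSmooth f} {ω₁ : Form X₁} {ω₂ : Form X₂}
    (hω : Form.pull Subtype.val (dSmooth_val Y) ω₁ = Form.pull f hf ω₂) {n : ℕ}
    {q : Plot (Glue f) n} {z : Eu n} {p : Plot X₂ n} (h : q.1 =ᶠ[𝓝 z] Glue.i₂ f ∘ p.1) :
    Form.glueVal ω₁ ω₂ n q z = ω₂.1 n p z := by
  rw [Form.glueVal]
  split_ifs with h₁ h₂
  · exact Form.eq_of_germ_eq hω (h₁.choose_spec.symm.trans h)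
  · apply Form.congr_of_eventuallyEq ω₂
    filter_upwards [h₂.choose_spec, h] with y hy hy'
    exact Glue.i₂_injective (hy.symm.trans hy')
  · exact absurd ⟨p, h⟩ h₂

theorem Form.contDiff_glueVal (hf : IsGluingMap f) {k : ℕ} {η₁ : Eu k → Form X₁}
    {η₂ : Eu k → Form X₂} (h₁ : IsPlot η₁) (h₂ : IsPlot η₂)
    (h : ∀ s, Form.pull Subtype.val (dSmooth_val Y) (η₁ s) = Form.pull f hf.dSmooth (η₂ s))
    {n : ℕ} (q : Plot (Glue f) n) :
    ContDiff ℝ ∞ (fun z : Eu k × Eu n => Form.glueVal (η₁ z.1) (η₂ z.1) n q z.2) := by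
  rw [contDiff_iff_contDiffAt]
  rintro ⟨s, r⟩
  have hsnd : Filter.Tendsto Prod.snd (𝓝 (s, r)) (𝓝 r) := continuous_snd.continuousAt
  obtain ⟨p, hp⟩ | ⟨p, hp⟩ := Glue.exists_lift q r
  · refine ((h₁ n p).contDiffAt (x := (s, r))).congr_of_eventuallyEq ?_
    filter_upwards [hsnd.eventually hp.eventually_nhds] with z hz
    exact Form.glueVal_left hf.injective _ _ hz
  · refine ((h₂ n p).contDiffAt (x := (s, r))).congr_of_eventuallyEq ?_
    filter_upwards [hsnd.eventually hp.eventually_nhds] with z hz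
    exact Form.glueVal_right (h z.1) hz

/-- The 1-form on the glued space given by 1-forms on `X₁` and `X₂` which agree on `Y`. -/
def Form.glue (hf : IsGluingMap f) (ω₁ : Form X₁) (ω₂ : Form X₂)
    (hω : Form.pull Subtype.val (dSmooth_val Y) ω₁ = Form.pull f hf.dSmooth ω₂) :
    Form (Glue f) :=
  ⟨Form.glueVal ω₁ ω₂, fun n q =>
    (Form.contDiff_glueVal hf (k := 0) (η₁ := fun _ => ω₁) (η₂ := fun _ => ω₂) isPlot_const
      isPlot_const (fun _ => hω) q).comp (contDiff_const.prodMk contDiff_id : ContDiff ℝ ∞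
        fun z : Eu n => ((0 : Eu 0), z)), by
    intro n m q g hg z
    have hgz : Filter.Tendsto g (𝓝 z) (𝓝 (g z)) := hg.continuous.continuousAt
    obtain ⟨p, hp⟩ | ⟨p, hp⟩ := Glue.exists_lift q (g z)
    · rw [Form.glueVal_left hf.injective ω₁ ω₂ hp, ← ω₁.2.2 n m p g hg z]
      exact Form.glueVal_left hf.injective _ _ (hgz.eventually hp)
    · rw [Form.glueVal_right hω hp, ← ω₂.2.2 n m p g hg z]
      exact Form.glueVal_right hω (hgz.eventually hp)⟩

theorem Form.isPlot_glue (hf : IsGluingMap f) {k : ℕ} {η₁ : Eu k → Form X₁}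
    {η₂ : Eu k → Form X₂} (h₁ : IsPlot η₁) (h₂ : IsPlot η₂)
    (h : ∀ s, Form.pull Subtype.val (dSmooth_val Y) (η₁ s) = Form.pull f hf.dSmooth (η₂ s)) :
    IsPlot (fun s => Form.glue hf (η₁ s) (η₂ s) (h s)) :=
  fun _ q => Form.contDiff_glueVal hf h₁ h₂ h q

theorem Form.pull_i₁_glue (hf : IsGluingMap f) (ω₁ : Form X₁) (ω₂ : Form X₂)
    (hω : Form.pull Subtype.val (dSmooth_val Y) ω₁ = Form.pull f hf.dSmooth ω₂) :
    Form.pull (Glue.i₁ f) (Glue.dSmooth_i₁ f) (Form.glue hf ω₁ ω₂ hω) = ω₁ :=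
  Subtype.ext (funext fun _ => funext fun p => funext fun _ =>
    Form.glueVal_left (p := p) hf.injective _ _ Filter.EventuallyEq.rfl)

theorem Form.pull_i₂_glue (hf : IsGluingMap f) (ω₁ : Form X₁) (ω₂ : Form X₂)
    (hω : Form.pull Subtype.val (dSmooth_val Y) ω₁ = Form.pull f hf.dSmooth ω₂) :
    Form.pull (Glue.i₂ f) (Glue.dSmooth_i₂ f) (Form.glue hf ω₁ ω₂ hω) = ω₂ :=
  Subtype.ext (funext fun _ => funext fun p => funext fun _ =>
    Form.glueVal_right (p := p) hω Filter.EventuallyEq.rfl)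

/-! ### The fibres of `Λ¹` of the glued space -/

theorem OmegaCondition.exists_right {hf : DSmooth f} (hΩ : OmegaCondition hf) {n : ℕ}
    {η : Eu n → Form X₁} (hη : IsPlot η) (x : Eu n) :
    ∃ χ : Eu n → Eu n, ContDiff ℝ ∞ χ ∧ (∀ᶠ y in 𝓝 x, χ y = y) ∧ ∃ θ : Eu n → Form X₂,
      IsPlot θ ∧ ∀ z, Form.pull Subtype.val (dSmooth_val Y) (η (χ z)) = Form.pull f hf (θ z) := by
  obtain ⟨U, hU, hxU, θ, hθ, he⟩ := (hΩ n fun z => Form.pull Subtype.val (dSmooth_val Y) (η z)).1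
    (fun _ => ⟨univ, isOpen_univ, mem_univ _, η, hη, fun _ _ => rfl⟩) x
  obtain ⟨χ, hχ, hχ', hχU⟩ := exists_cutoff_of_eventually (hU.mem_nhds hxU)
  exact ⟨χ, hχ, hχ', θ ∘ χ, isPlot_reparam hθ hχ, fun z => he _ (hχU z)⟩

theorem OmegaCondition.exists_left {hf : DSmooth f} (hΩ : OmegaCondition hf) {n : ℕ}
    {η : Eu n → Form X₂} (hη : IsPlot η) (x : Eu n) :
    ∃ χ : Eu n → Eu n, ContDiff ℝ ∞ χ ∧ (∀ᶠ y in 𝓝 x, χ y = y) ∧ ∃ θ : Eu n → Form X₁,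
      IsPlot θ ∧ ∀ z, Form.pull Subtype.val (dSmooth_val Y) (θ z) = Form.pull f hf (η (χ z)) := by
  obtain ⟨U, hU, hxU, θ, hθ, he⟩ := (hΩ n fun z => Form.pull f hf (η z)).2
    (fun _ => ⟨univ, isOpen_univ, mem_univ _, η, hη, fun _ _ => rfl⟩) x
  obtain ⟨χ, hχ, hχ', hχU⟩ := exists_cutoff_of_eventually (hU.mem_nhds hxU)
  exact ⟨χ, hχ, hχ', θ ∘ χ, isPlot_reparam hθ hχ, fun z => (he _ (hχU z)).symm⟩

theorem OmegaCondition.exists_form_right {hf : DSmooth f} (hΩ : OmegaCondition hf)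
    (ω₁ : Form X₁) : ∃ ω₂, Form.pull Subtype.val (dSmooth_val Y) ω₁ = Form.pull f hf ω₂ :=
  let ⟨_, _, _, θ, _, h⟩ := hΩ.exists_right (n := 0) (η := fun _ => ω₁) isPlot_const 0
  ⟨θ 0, h 0⟩

theorem OmegaCondition.exists_form_left {hf : DSmooth f} (hΩ : OmegaCondition hf)
    (ω₂ : Form X₂) : ∃ ω₁, Form.pull Subtype.val (dSmooth_val Y) ω₁ = Form.pull f hf ω₂ :=
  let ⟨_, _, _, θ, _, h⟩ := hΩ.exists_left (n := 0) (η := fun _ => ω₂) isPlot_const 0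
  ⟨θ 0, h 0⟩

section Metrics

variable {hf : DSmooth f} {g₁ : ∀ x, Lam X₁ x →ₗ[ℝ] Lam X₁ x →ₗ[ℝ] ℝ}
  {g₂ : ∀ x, Lam X₂ x →ₗ[ℝ] Lam X₂ x →ₗ[ℝ] ℝ}

/-- The kernel of `resY₁ y` lies in that of `g₁`: its elements are compatible with `0`, and every
element of `Λ¹_y(X₁)` is compatible with some element of `Λ¹_{f(y)}(X₂)`. -/
theorem CompatibleMetrics.resY₁_injective (hg : CompatibleMetrics hf g₁ g₂)
    (hΩ : OmegaCondition hf) (hg₁ : ∀ x, LinearMap.ker (g₁ x) = ⊥) (y : Y) :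
    Function.Injective (resY₁ y) := by
  refine (injective_iff_map_eq_zero _).2 fun α hα => ?_
  refine LinearMap.ker_eq_bot'.1 (hg₁ y) α (LinearMap.ext fun β => ?_)
  obtain ⟨ω₁, rfl⟩ := Lam.mk_surjective _ β
  obtain ⟨ω₂, hω⟩ := hΩ.exists_form_right ω₁
  rw [hg y α _ 0 (Lam.mk (f y) ω₂) (hα.trans (map_zero _).symm)
    (show CompatibleValues hf y (Lam.mk _ ω₁) (Lam.mk _ ω₂) from congrArg (Lam.mk y) hω), map_zero]
  rfl

theorem CompatibleMetrics.resY₂_injective (hg : CompatibleMetrics hf g₁ g₂)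
    (hΩ : OmegaCondition hf) (hg₂ : ∀ x, LinearMap.ker (g₂ x) = ⊥) (y : Y) :
    Function.Injective (resY₂ hf y) := by
  refine (injective_iff_map_eq_zero _).2 fun α hα => ?_
  refine LinearMap.ker_eq_bot'.1 (hg₂ (f y)) α (LinearMap.ext fun β => ?_)
  obtain ⟨ω₂, rfl⟩ := Lam.mk_surjective _ β
  obtain ⟨ω₁, hω⟩ := hΩ.exists_form_left ω₂
  rw [← hg y 0 (Lam.mk (y : X₁) ω₁) α _ ((map_zero _).trans hα.symm)
    (show CompatibleValues hf y (Lam.mk _ ω₁) (Lam.mk _ ω₂) from congrArg (Lam.mk y) hω),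
    map_zero]
  rfl

end Metrics

/-- The two components of an element of `Λ¹(X₁ ∪_f X₂)` over `f(Y)` are compatible. -/
theorem compatibleValues_rho (hf : DSmooth f) (y : Y) {z : Glue f} (h₁ : Glue.i₁ f y = z)
    (h₂ : Glue.i₂ f (f y) = z) (α : Lam (Glue f) z) :
    CompatibleValues hf y (rho₁ f h₁ α) (rho₂ f h₂ α) := by
  obtain ⟨η, rfl⟩ := Lam.mk_surjective _ α
  refine congrArg (Lam.mk y) (Subtype.ext (funext fun n => funext fun p => funext fun t => ?_))
  refine congrArg (fun q => η.1 n q t) (Subtype.ext (funext fun x => ?_))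
  exact Glue.i₁_of_mem f (p.1 x)

/-- A class in `Λ¹(X₁ ∪_f X₂)` at `i₁ x` vanishes once its component along `Λ¹(X₁)` does: at a
point of `Y`, the component along `Λ¹(X₂)` is then compatible with `0`, hence also zero. -/
theorem rho₁_injective (hf : IsGluingMap f)
    (hres : ∀ y, Function.Injective (resY₂ hf.dSmooth y)) {x : X₁} {z : Glue f}
    (h : Glue.i₁ f x = z) : Function.Injective (rho₁ f h) := by
  refine (injective_iff_map_eq_zero _).2 fun α hα => ?_
  obtain ⟨η, rfl⟩ := Lam.mk_surjective _ α
  have hα' := Lam.mk_eq_zero_iff.1 hα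
  refine Lam.mk_eq_zero_iff.2 fun n q hq => ?_
  obtain ⟨p, hp⟩ | ⟨p, hp⟩ := Glue.exists_lift q 0
  · rw [Form.congr_of_eventuallyEq η (q := ⟨_, Glue.dSmooth_i₁ f _ _ p.2⟩) hp]
    exact hα' n p (Glue.i₁_injective hf.injective (hp.self_of_nhds.symm.trans (hq.trans h.symm)))
  · have hx : Glue.i₁ f x = Glue.i₂ f (p.1 0) := h.trans (hq.symm.trans hp.self_of_nhds)
    obtain ⟨hY, hfx⟩ := Glue.exists_of_i₁_eq_i₂ hx
    have h₂ : Glue.i₂ f (f ⟨x, hY⟩) = z := by rw [hfx, ← hx, h]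
    have hc := compatibleValues_rho hf.dSmooth ⟨x, hY⟩ h h₂ (Lam.mk z η)
    rw [CompatibleValues, hα, map_zero, eq_comm] at hc
    have hβ := Lam.mk_eq_zero_iff.1 ((injective_iff_map_eq_zero _).1 (hres ⟨x, hY⟩) _ hc)
    rw [Form.congr_of_eventuallyEq η (q := ⟨_, Glue.dSmooth_i₂ f _ _ p.2⟩) hp]
    exact hβ n p hfx.symm

theorem rho₂_injective (hf : IsGluingMap f) (hres : ∀ y : Y, Function.Injective (resY₁ y))
    {x : X₂} {z : Glue f} (h : Glue.i₂ f x = z) : Function.Injective (rho₂ f h) := by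
  refine (injective_iff_map_eq_zero _).2 fun α hα => ?_
  obtain ⟨η, rfl⟩ := Lam.mk_surjective _ α
  have hα' := Lam.mk_eq_zero_iff.1 hα
  refine Lam.mk_eq_zero_iff.2 fun n q hq => ?_
  obtain ⟨p, hp⟩ | ⟨p, hp⟩ := Glue.exists_lift q 0
  · have hx : Glue.i₁ f (p.1 0) = Glue.i₂ f x := hp.self_of_nhds.symm.trans (hq.trans h.symm)
    obtain ⟨hY, hfx⟩ := Glue.exists_of_i₁_eq_i₂ hx
    subst hfx
    have h₁ : Glue.i₁ f (p.1 0) = z := hx.trans h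
    have hc := compatibleValues_rho hf.dSmooth ⟨p.1 0, hY⟩ h₁ h (Lam.mk z η)
    rw [CompatibleValues, hα, map_zero] at hc
    have hβ := Lam.mk_eq_zero_iff.1 ((injective_iff_map_eq_zero _).1 (hres ⟨p.1 0, hY⟩) _ hc)
    rw [Form.congr_of_eventuallyEq η (q := ⟨_, Glue.dSmooth_i₁ f _ _ p.2⟩) hp]
    exact hβ n p rfl
  · rw [Form.congr_of_eventuallyEq η (q := ⟨_, Glue.dSmooth_i₂ f _ _ p.2⟩) hp]
    exact hα' n p (Glue.i₂_injective (hp.self_of_nhds.symm.trans (hq.trans h.symm)))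

/-- Along `X₁ → X₁ ∪_f X₂`, the pseudo-bundle `Λ¹(X₁ ∪_f X₂)` restricts to `Λ¹(X₁)`: a plot of
1-forms on `X₁` extends locally to one on the glued space, by the condition on `Ω¹`. -/
theorem restricts_rho₁ (hf : IsGluingMap f) (hΩ : OmegaCondition hf.dSmooth)
    (hres : ∀ y, Function.Injective (resY₂ hf.dSmooth y)) :
    Restricts (Glue.i₁ f) (Lam.pulls (Glue.dSmooth_i₁ f)) where
  bijective {x z} h := by
    refine ⟨rho₁_injective hf hres h, fun α => ?_⟩
    obtain ⟨ω₁, rfl⟩ := Lam.mk_surjective _ α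
    obtain ⟨ω₂, hω⟩ := hΩ.exists_form_right ω₁
    refine ⟨Lam.mk z (Form.glue hf ω₁ ω₂ hω), ?_⟩
    rw [Lam.pull_mk, Form.pull_i₁_glue]
  plot_iff := by
    intro n p b h s hp
    refine ⟨fun hs => Lam.plotOver_pull _ h hp hs, fun hs => .of_cutoff fun x => ?_⟩
    obtain ⟨χ, hχ, hχ', hpχ, η, hη, he⟩ := Lam.exists_cutoff_of_plotOver hs x
    obtain ⟨ξ, hξ, hξ', θ, hθ, hω⟩ := hΩ.exists_right hη x
    refine ⟨χ ∘ ξ, hχ.comp hξ, ?_, ?_⟩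
    · filter_upwards [hχ', hξ'] with y hy hy'
      simp [hy, hy']
    · have hb : IsPlot (fun z => b (χ (ξ z))) := by
        have : (fun z => b (χ (ξ z))) = Glue.i₁ f ∘ (fun z => p (χ z)) ∘ ξ :=
          funext fun z => (h _).symm
        rw [this]
        exact Glue.dSmooth_i₁ f _ _ (isPlot_reparam hpχ hξ)
      have key := Lam.plotOver_mk hb (Form.isPlot_glue hf (isPlot_reparam hη hξ) hθ hω)
      refine (congrArg (PlotOver (Lam (Glue f)) _) (funext fun z => ?_)).mpr key
      apply rho₁_injective hf hres (h (χ (ξ z)))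
      refine (he (ξ z)).trans ?_
      rw [rho₁, Lam.pull_mk, Form.pull_i₁_glue]
      rfl

theorem restricts_rho₂ (hf : IsGluingMap f) (hΩ : OmegaCondition hf.dSmooth)
    (hres : ∀ y : Y, Function.Injective (resY₁ y)) :
    Restricts (Glue.i₂ f) (Lam.pulls (Glue.dSmooth_i₂ f)) where
  bijective {x z} h := by
    refine ⟨rho₂_injective hf hres h, fun α => ?_⟩
    obtain ⟨ω₂, rfl⟩ := Lam.mk_surjective _ α
    obtain ⟨ω₁, hω⟩ := hΩ.exists_form_left ω₂
    refine ⟨Lam.mk z (Form.glue hf ω₁ ω₂ hω), ?_⟩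
    rw [Lam.pull_mk, Form.pull_i₂_glue]
  plot_iff := by
    intro n p b h s hp
    refine ⟨fun hs => Lam.plotOver_pull _ h hp hs, fun hs => .of_cutoff fun x => ?_⟩
    obtain ⟨χ, hχ, hχ', hpχ, η, hη, he⟩ := Lam.exists_cutoff_of_plotOver hs x
    obtain ⟨ξ, hξ, hξ', θ, hθ, hω⟩ := hΩ.exists_left hη x
    refine ⟨χ ∘ ξ, hχ.comp hξ, ?_, ?_⟩
    · filter_upwards [hχ', hξ'] with y hy hy'
      simp [hy, hy']
    · have hb : IsPlot (fun z => b (χ (ξ z))) := by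
        have : (fun z => b (χ (ξ z))) = Glue.i₂ f ∘ (fun z => p (χ z)) ∘ ξ :=
          funext fun z => (h _).symm
        rw [this]
        exact Glue.dSmooth_i₂ f _ _ (isPlot_reparam hpχ hξ)
      have key := Lam.plotOver_mk hb (Form.isPlot_glue hf hθ (isPlot_reparam hη hξ) hω)
      refine (congrArg (PlotOver (Lam (Glue f)) _) (funext fun z => ?_)).mpr key
      apply rho₂_injective hf hres (h (χ (ξ z)))
      refine (he (ξ z)).trans ?_
      rw [rho₂, Lam.pull_mk, Form.pull_i₂_glue]
      rfl

end Glue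

/-! ### The glued pseudo-bundle -/

section GlueFam

variable {X₁ : Type u₁} {X₂ : Type u₂} [DiffeologicalSpace X₁] [DiffeologicalSpace X₂] {Y : Set X₁}
  {f : Y → X₂} {E₁ : X₁ → Type v} {E₂ : X₂ → Type v}
  [∀ x, AddCommGroup (E₁ x)] [∀ x, Module ℝ (E₁ x)]
  [∀ x, AddCommGroup (E₂ x)] [∀ x, Module ℝ (E₂ x)] (F : ∀ y : Y, E₁ y ≃ₗ[ℝ] E₂ (f y))

open Classical in
/-- The identification of the fibre of `E₁ ∪_F E₂` at `z = i₁ x` with that of `E₁` at `x`: it is the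
inverse of `F` over `Y`. -/
def GlueFam.toLeft ⦃x : X₁⦄ ⦃z : Glue f⦄ (h : Glue.i₁ f x = z) : GlueFam f F z ≃ₗ[ℝ] E₁ x :=
  if hx : x ∈ Y then
    (LinearEquiv.cast (M := GlueFam f F) (h.symm.trans (Glue.i₁_of_mem f ⟨x, hx⟩))).trans
      (F ⟨x, hx⟩).symm
  else LinearEquiv.cast (M := GlueFam f F) (h.symm.trans (Glue.i₁_of_notMem f hx))

/-- The identification of the fibre of `E₁ ∪_F E₂` at `z = i₂ x` with that of `E₂` at `x`. -/
def GlueFam.toRight ⦃x : X₂⦄ ⦃z : Glue f⦄ (h : Glue.i₂ f x = z) : GlueFam f F z ≃ₗ[ℝ] E₂ x :=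
  LinearEquiv.cast (M := GlueFam f F) h.symm

theorem GlueFam.toLeft_of_mem (y : Y) (h : Glue.i₁ f y = Glue.right (f y)) :
    GlueFam.toLeft F h = (F y).symm :=
  (dif_pos y.2).trans rfl

theorem GlueFam.toLeft_of_notMem {x : X₁} (hx : x ∉ Y) (h : Glue.i₁ f x = Glue.left x hx) :
    GlueFam.toLeft F h = LinearEquiv.refl ℝ (E₁ x) :=
  (dif_neg hx).trans rfl

/-- The natural map `E₁ → E₁ ∪_F E₂` is inverse to `GlueFam.toLeft`. -/
theorem GlueFam.j₁_toLeft {x : X₁} {z : Glue f} (h : Glue.i₁ f x = z) (a : GlueFam f F z) :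
    GlueFam.j₁ f F ⟨x, GlueFam.toLeft F h a⟩ = ⟨z, a⟩ := by
  by_cases hx : x ∈ Y
  · have hz : z = Glue.right (f ⟨x, hx⟩) := h.symm.trans (Glue.i₁_of_mem f ⟨x, hx⟩)
    subst hz
    rw [GlueFam.toLeft_of_mem F ⟨x, hx⟩ h, GlueFam.j₁, dif_pos hx]
    exact congrArg (Sigma.mk _) ((F ⟨x, hx⟩).apply_symm_apply a)
  · have hz : z = Glue.left x hx := h.symm.trans (Glue.i₁_of_notMem f hx)
    subst hz
    rw [GlueFam.toLeft_of_notMem F hx h, GlueFam.j₁, dif_neg hx]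
    rfl

theorem GlueFam.j₂_toRight {x : X₂} {z : Glue f} (h : Glue.i₂ f x = z) (a : GlueFam f F z) :
    GlueFam.j₂ f F ⟨x, GlueFam.toRight F h a⟩ = ⟨z, a⟩ := by
  subst h
  rfl

theorem GlueFam.fst_j₁ (e : Sigma E₁) : (GlueFam.j₁ f F e).1 = Glue.i₁ f e.1 := by
  by_cases hx : e.1 ∈ Y <;> simp [GlueFam.j₁, Glue.i₁, hx]

theorem GlueFam.j₁_injective (hf : Function.Injective f) :
    Function.Injective (GlueFam.j₁ f F) := by
  rintro ⟨x, a⟩ ⟨x', a'⟩ h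
  have hx : x = x' := Glue.i₁_injective hf <| by
    rw [← GlueFam.fst_j₁ F ⟨x, a⟩, ← GlueFam.fst_j₁ F ⟨x', a'⟩, h]
  subst hx
  congr 1
  by_cases hx : x ∈ Y
  · simp only [GlueFam.j₁, dif_pos hx] at h
    exact (F ⟨x, hx⟩).injective (eq_of_heq (Sigma.mk.inj h).2)
  · simp only [GlueFam.j₁, dif_neg hx] at h
    exact eq_of_heq (Sigma.mk.inj h).2

theorem GlueFam.j₂_injective : Function.Injective (GlueFam.j₂ f F) := by
  rintro ⟨x, a⟩ ⟨x', a'⟩ h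
  obtain ⟨h₁, h₂⟩ := Sigma.mk.inj h
  cases h₁
  cases h₂
  rfl

theorem GlueFam.exists_of_j₁_eq_j₂ {x : X₁} {a : E₁ x} {e : Sigma E₂}
    (h : GlueFam.j₁ f F ⟨x, a⟩ = GlueFam.j₂ f F e) :
    ∃ hx : x ∈ Y, (⟨f ⟨x, hx⟩, F ⟨x, hx⟩ a⟩ : Sigma E₂) = e := by
  have h₁ : Glue.i₁ f x = Glue.i₂ f e.1 := by
    rw [← GlueFam.fst_j₁ F ⟨x, a⟩, h]
    rfl
  obtain ⟨hx, -⟩ := Glue.exists_of_i₁_eq_i₂ h₁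
  refine ⟨hx, GlueFam.j₂_injective F ?_⟩
  rw [← h, GlueFam.j₁, dif_pos hx]
  rfl

variable [DiffeologicalSpace (Sigma E₁)] [DiffeologicalSpace (Sigma E₂)]

theorem GlueFam.isPlot_j₁ {n : ℕ} {e : Eu n → Sigma E₁} (he : IsPlot e) :
    IsPlot (GlueFam.j₁ f F ∘ e) :=
  fun _ => ⟨univ, isOpen_univ, mem_univ _, _, .inl ⟨e, he, rfl⟩, fun _ _ => rfl⟩

theorem GlueFam.isPlot_j₂ {n : ℕ} {e : Eu n → Sigma E₂} (he : IsPlot e) :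
    IsPlot (GlueFam.j₂ f F ∘ e) :=
  fun _ => ⟨univ, isOpen_univ, mem_univ _, _, .inr ⟨e, he, rfl⟩, fun _ _ => rfl⟩

theorem GlueFam.exists_cutoff {n : ℕ} {e : Eu n → Sigma (GlueFam f F)} (he : IsPlot e)
    (x : Eu n) :
    ∃ χ : Eu n → Eu n, ContDiff ℝ ∞ χ ∧ (∀ᶠ y in 𝓝 x, χ y = y) ∧
      ((∃ p : Eu n → Sigma E₁, IsPlot p ∧ e ∘ χ = GlueFam.j₁ f F ∘ p) ∨
        ∃ p : Eu n → Sigma E₂, IsPlot p ∧ e ∘ χ = GlueFam.j₂ f F ∘ p) :=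
  exists_cutoff_ofLocal (by unfold instGlueFam; rfl) he x

theorem GlueFam.dSmooth_proj (h₁ : IsPseudoBundle E₁) (h₂ : IsPseudoBundle E₂) :
    DSmooth (Sigma.fst : Sigma (GlueFam f F) → Glue f) := by
  refine fun n e he => isPlot_of_cutoff fun x => ?_
  obtain ⟨χ, hχ, hχ', ⟨p, hp, h⟩ | ⟨p, hp, h⟩⟩ := GlueFam.exists_cutoff F he x
  · refine ⟨χ, hχ, hχ', ?_⟩
    have : (Sigma.fst ∘ e) ∘ χ = Glue.i₁ f ∘ Sigma.fst ∘ p := funext fun z =>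
      (congrArg Sigma.fst (congrFun h z)).trans (GlueFam.fst_j₁ F (p z))
    rw [this]
    exact Glue.dSmooth_i₁ f _ _ (h₁.proj _ _ hp)
  · refine ⟨χ, hχ, hχ', ?_⟩
    have : (Sigma.fst ∘ e) ∘ χ = Glue.i₂ f ∘ Sigma.fst ∘ p := funext fun z =>
      congrArg Sigma.fst (congrFun h z)
    rw [this]
    exact Glue.dSmooth_i₂ f _ _ (h₂.proj _ _ hp)

theorem GlueFam.restricts_toLeft (hf : IsGluingMap f) (hF : IsGluingLift f F) :
    Restricts (Glue.i₁ f) (fun _ _ h => (GlueFam.toLeft F h).toLinearMap) where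
  bijective h := (GlueFam.toLeft F h).bijective
  plot_iff := by
    intro n p b h s hp
    have hj : ∀ z, GlueFam.j₁ f F ⟨p z, GlueFam.toLeft F (h z) (s z)⟩ = ⟨b z, s z⟩ :=
      fun z => GlueFam.j₁_toLeft F (h z) (s z)
    refine ⟨fun hs => .of_cutoff fun x => ?_, fun hs => ?_⟩
    · obtain ⟨χ, hχ, hχ', ⟨e, he, hes⟩ | ⟨e, he, hes⟩⟩ := GlueFam.exists_cutoff F hs x
      · refine ⟨χ, hχ, hχ', (congrArg IsPlot (funext fun z => ?_)).mpr he⟩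
        exact GlueFam.j₁_injective F hf.injective ((hj _).trans (congrFun hes z))
      · choose hY hYe using fun z =>
          GlueFam.exists_of_j₁_eq_j₂ F ((hj (χ z)).trans (congrFun hes z))
        refine ⟨χ, hχ, hχ', (hF n (fun z => ⟨p (χ z), hY z⟩) _).2 ?_⟩
        exact (congrArg IsPlot (funext hYe)).mpr he
    · exact (congrArg IsPlot (funext hj)).mp (GlueFam.isPlot_j₁ F hs)

theorem GlueFam.restricts_toRight (hF : IsGluingLift f F) :
    Restricts (Glue.i₂ f) (fun _ _ h => (GlueFam.toRight F h).toLinearMap) where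
  bijective h := (GlueFam.toRight F h).bijective
  plot_iff := by
    intro n p b h s hp
    have hj : ∀ z, GlueFam.j₂ f F ⟨p z, GlueFam.toRight F (h z) (s z)⟩ = ⟨b z, s z⟩ :=
      fun z => GlueFam.j₂_toRight F (h z) (s z)
    refine ⟨fun hs => .of_cutoff fun x => ?_, fun hs => ?_⟩
    · obtain ⟨χ, hχ, hχ', ⟨e, he, hes⟩ | ⟨e, he, hes⟩⟩ := GlueFam.exists_cutoff F hs x
      · choose hY hYe using fun z => GlueFam.exists_of_j₁_eq_j₂ F (x := (e z).1) (a := (e z).2)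
          ((congrFun hes z).symm.trans (hj (χ z)).symm)
        refine ⟨χ, hχ, hχ', ?_⟩
        have key := (hF n (fun z => ⟨(e z).1, hY z⟩) (fun z => (e z).2)).1 he
        exact (congrArg IsPlot (funext hYe)).mp key
      · refine ⟨χ, hχ, hχ', (congrArg IsPlot (funext fun z => ?_)).mpr he⟩
        exact GlueFam.j₂_injective F ((hj _).trans (congrFun hes z))
    · exact (congrArg IsPlot (funext hj)).mp (GlueFam.isPlot_j₂ F hs)

theorem GlueFam.restrictSection_toLeft (s : ∀ z, GlueFam f F z) :
    restrictSection (fun _ _ h => (GlueFam.toLeft F h).toLinearMap) s = part₁ f F s := by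
  have key : ∀ {x z} (h : Glue.i₁ f x = z),
      GlueFam.toLeft F rfl (s (Glue.i₁ f x)) = GlueFam.toLeft F h (s z) := by
    rintro x z rfl
    rfl
  funext x
  by_cases hx : x ∈ Y
  · refine Eq.trans ?_ (dif_pos hx).symm
    refine (key (Glue.i₁_of_mem f ⟨x, hx⟩)).trans ?_
    rw [GlueFam.toLeft_of_mem F ⟨x, hx⟩]
    rfl
  · refine Eq.trans ?_ (dif_neg hx).symm
    refine (key (Glue.i₁_of_notMem f hx)).trans ?_
    rw [GlueFam.toLeft_of_notMem F hx]
    rfl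

end GlueFam

/-! ### Restriction of the induced objects -/

section Induced

variable {X₁ : Type u₁} {X₂ : Type u₂} [DiffeologicalSpace X₁] [DiffeologicalSpace X₂] {Y : Set X₁}
  {f : Y → X₂}

section Metric

variable {g₁ : ∀ x, Lam X₁ x →ₗ[ℝ] Lam X₁ x →ₗ[ℝ] ℝ} {g₂ : ∀ x, Lam X₂ x →ₗ[ℝ] Lam X₂ x →ₗ[ℝ] ℝ}

theorem glueMetric_of_mem (hf : Function.Injective f) (y : Y)
    (a b : Lam (Glue f) (Glue.right (f y))) :
    glueMetric f g₁ g₂ (Glue.right (f y)) a b =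
      1 / 2 * g₁ y (rho₁ f (Glue.i₁_of_mem f y) a) (rho₁ f (Glue.i₁_of_mem f y) b) +
      1 / 2 * g₂ (f y) (rho₂ f (z := Glue.right (f y)) rfl a)
        (rho₂ f (z := Glue.right (f y)) rfl b) := by
  have hex : ∃ y' : Y, Glue.i₁ f y' = Glue.right (f y) := ⟨y, Glue.i₁_of_mem f y⟩
  rw [glueMetric, dif_pos hex]
  -- The point of `Y` chosen in the definition is `y`, because `i₁` is injective.
  have key : ∀ (y' : Y) (h' : Glue.i₁ f y' = Glue.right (f y)),
      g₁ y' (rho₁ f h' a) (rho₁ f h' b) =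
        g₁ y (rho₁ f (Glue.i₁_of_mem f y) a) (rho₁ f (Glue.i₁_of_mem f y) b) := by
    intro y' h'
    have : y' = y := Subtype.ext (Glue.i₁_injective hf (h'.trans (Glue.i₁_of_mem f y).symm))
    subst this
    rfl
  rw [← key _ hex.choose_spec]
  rfl

theorem glueMetric_eq_left (hf : IsGluingMap f) (hg : CompatibleMetrics hf.dSmooth g₁ g₂) ⦃x : X₁⦄
    ⦃z : Glue f⦄ (h : Glue.i₁ f x = z) (a b : Lam (Glue f) z) :
    glueMetric f g₁ g₂ z a b = g₁ x (rho₁ f h a) (rho₁ f h b) := by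
  by_cases hx : x ∈ Y
  · have hz : z = Glue.right (f ⟨x, hx⟩) := h.symm.trans (Glue.i₁_of_mem f ⟨x, hx⟩)
    subst hz
    rw [glueMetric_of_mem hf.injective ⟨x, hx⟩, ← hg ⟨x, hx⟩ _ _ _ _
      (compatibleValues_rho hf.dSmooth ⟨x, hx⟩ h rfl a)
      (compatibleValues_rho hf.dSmooth ⟨x, hx⟩ h rfl b)]
    ring
  · have hz : z = Glue.left x hx := h.symm.trans (Glue.i₁_of_notMem f hx)
    subst hz
    rfl

theorem glueMetric_eq_right (hf : IsGluingMap f) (hg : CompatibleMetrics hf.dSmooth g₁ g₂)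
    ⦃x : X₂⦄ ⦃z : Glue f⦄ (h : Glue.i₂ f x = z) (a b : Lam (Glue f) z) :
    glueMetric f g₁ g₂ z a b = g₂ x (rho₂ f h a) (rho₂ f h b) := by
  subst h
  by_cases hx : ∃ y : Y, Glue.i₁ f y = Glue.right x
  · obtain ⟨y, hy⟩ := hx
    obtain ⟨-, rfl⟩ := Glue.exists_of_i₁_eq_i₂ hy
    refine (glueMetric_of_mem hf.injective y a b).trans ?_
    rw [hg y _ _ _ _ (compatibleValues_rho hf.dSmooth y (Glue.i₁_of_mem f y) rfl a)
      (compatibleValues_rho hf.dSmooth y (Glue.i₁_of_mem f y) rfl b)]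
    exact (add_mul _ _ _).symm.trans ((congrArg (· * _) (add_halves 1)).trans (one_mul _))
  · change glueMetric f g₁ g₂ (Glue.right x) a b = _
    rw [glueMetric, dif_neg hx]
    rfl

end Metric

/-- A pair of values on `X₁` and on `X₂` which agree over `Y` comes from a value on the glued
space. -/
theorem Glue.exists_value {G : Glue f → Type*} {A₁ : X₁ → Type*} {A₂ : X₂ → Type*}
    [∀ z, AddCommGroup (G z)] [∀ z, Module ℝ (G z)] [∀ x, AddCommGroup (A₁ x)]
    [∀ x, Module ℝ (A₁ x)] [∀ x, AddCommGroup (A₂ x)] [∀ x, Module ℝ (A₂ x)]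
    {L₁ : ∀ ⦃x z⦄, Glue.i₁ f x = z → G z →ₗ[ℝ] A₁ x}
    {L₂ : ∀ ⦃x z⦄, Glue.i₂ f x = z → G z →ₗ[ℝ] A₂ x} (hf : Function.Injective f)
    (hL₁ : ∀ {x z} (h : Glue.i₁ f x = z), Function.Bijective (L₁ h))
    (hL₂ : ∀ {x z} (h : Glue.i₂ f x = z), Function.Bijective (L₂ h)) {M : Y → Type*}
    {K₁ : ∀ y : Y, A₁ y → M y} {K₂ : ∀ y : Y, A₂ (f y) → M y}
    (hK₁ : ∀ y : Y, Function.Injective (K₁ y))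
    (hK : ∀ (y : Y) {z} (h₁ : Glue.i₁ f y = z) (h₂ : Glue.i₂ f (f y) = z) (a : G z),
      K₁ y (L₁ h₁ a) = K₂ y (L₂ h₂ a))
    {v₁ : ∀ x, A₁ x} {v₂ : ∀ x, A₂ x} (hv : ∀ y : Y, K₁ y (v₁ y) = K₂ y (v₂ (f y))) (z : Glue f) :
    ∃ a : G z, (∀ {x} (h : Glue.i₁ f x = z), L₁ h a = v₁ x) ∧
      ∀ {x} (h : Glue.i₂ f x = z), L₂ h a = v₂ x := by
  have h₂₁ : ∀ x₂ (h₂ : Glue.i₂ f x₂ = z) (a : G z), L₂ h₂ a = v₂ x₂ →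
      ∀ {x} (h : Glue.i₁ f x = z), L₁ h a = v₁ x := by
    intro x₂ h₂ a ha x h
    obtain ⟨hY, rfl⟩ := Glue.exists_of_i₁_eq_i₂ (h.trans h₂.symm)
    apply hK₁ ⟨x, hY⟩
    rw [hv, ← ha]
    exact hK ⟨x, hY⟩ h h₂ a
  by_cases hz : ∃ x₂, Glue.i₂ f x₂ = z
  · obtain ⟨x₂, h₂⟩ := hz
    obtain ⟨a, ha⟩ := (hL₂ h₂).2 (v₂ x₂)
    refine ⟨a, h₂₁ x₂ h₂ a ha, fun {x} h => ?_⟩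
    obtain rfl := Glue.i₂_injective (h.trans h₂.symm)
    exact ha
  · obtain ⟨x₁, h₁⟩ := ((Glue.isCover f).surjective z).resolve_right hz
    obtain ⟨a, ha⟩ := (hL₁ h₁).2 (v₁ x₁)
    refine ⟨a, fun {x} h => ?_, fun {x} h => absurd ⟨x, h⟩ hz⟩
    obtain rfl := Glue.i₁_injective hf (h.trans h₁.symm)
    exact ha

section LamConnection

variable {DΛ₁ : (∀ x, Lam X₁ x) → ∀ x, Tens (Lam X₁) (Lam X₁) x}
  {DΛ₂ : (∀ x, Lam X₂ x) → ∀ x, Tens (Lam X₂) (Lam X₂) x}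

/-- Existence of the induced connection on `Λ¹`: over `f(Y)` the values of `DΛ₁` and `DΛ₂` agree in
`Λ¹(Y) ⊗ Λ¹(Y)`, into which both embed. -/
theorem exists_isInducedLamConnection (hf : IsGluingMap f)
    (hL₁ : Restricts (Glue.i₁ f) (Lam.pulls (Glue.dSmooth_i₁ f)))
    (hL₂ : Restricts (Glue.i₂ f) (Lam.pulls (Glue.dSmooth_i₂ f)))
    (hres : ∀ y : Y, Function.Injective (resY₁ y))
    (hDΛ : CompatibleLamConnections hf.dSmooth DΛ₁ DΛ₂) :
    ∃ DΛ, IsInducedLamConnection f DΛ₁ DΛ₂ DΛ := by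
  have hex : ∀ (s : ∀ z, Lam (Glue f) z) (z : Glue f), ∃ T : Tens (Lam (Glue f)) (Lam (Glue f)) z,
      IsSmoothSection s →
      (∀ {x} (h : Glue.i₁ f x = z), Tens.map (rho₁ f h) (rho₁ f h) T = DΛ₁ (lamPart₁ f s) x) ∧
      ∀ {x} (h : Glue.i₂ f x = z), Tens.map (rho₂ f h) (rho₂ f h) T = DΛ₂ (lamPart₂ f s) x := by
    intro s z
    by_cases hs : IsSmoothSection s
    · have key := Glue.exists_value hf.injective (L₁ := fun _ _ h => Tens.map (rho₁ f h) (rho₁ f h))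
        (L₂ := fun _ _ h => Tens.map (rho₂ f h) (rho₂ f h))
        (fun h => Tens.map_bijective (hL₁.bijective h) (hL₁.bijective h))
        (fun h => Tens.map_bijective (hL₂.bijective h) (hL₂.bijective h))
        (M := fun y : Y => Lam Y y ⊗[ℝ] Lam Y y)
        (K₁ := fun y => TensorProduct.map (resY₁ y) (resY₁ y))
        (K₂ := fun y => TensorProduct.map (resY₂ hf.dSmooth y) (resY₂ hf.dSmooth y))
        (fun y => TensorProduct.map_injective_of_flat_flat _ _ (hres y) (hres y)) ?_
        (v₁ := DΛ₁ (lamPart₁ f s)) (v₂ := DΛ₂ (lamPart₂ f s)) ?_ z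
      · obtain ⟨T, hT⟩ := key
        exact ⟨T, fun _ => hT⟩
      · intro y z h₁ h₂ T
        have : (TensorProduct.map (resY₁ y) (resY₁ y)).comp
              (TensorProduct.map (rho₁ f h₁) (rho₁ f h₁)) =
            (TensorProduct.map (resY₂ hf.dSmooth y) (resY₂ hf.dSmooth y)).comp
              (TensorProduct.map (rho₂ f h₂) (rho₂ f h₂)) :=
          TensorProduct.ext' fun a b => congrArg₂ (· ⊗ₜ[ℝ] ·)
            (compatibleValues_rho hf.dSmooth y h₁ h₂ a) (compatibleValues_rho hf.dSmooth y h₁ h₂ b)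
        exact LinearMap.congr_fun this T
      · refine hDΛ _ _ (hL₁.isSmoothSection (Glue.dSmooth_i₁ f) hs)
          (hL₂.isSmoothSection (Glue.dSmooth_i₂ f) hs) fun y => ?_
        have key : ∀ {z} (h : Glue.i₁ f y = z),
            resY₁ y (lamPart₁ f s y) = resY₁ y (rho₁ f h (s z)) := by
          rintro z rfl
          rfl
        exact (key (Glue.i₁_of_mem f y)).trans
          (compatibleValues_rho hf.dSmooth y (Glue.i₁_of_mem f y) rfl (s (Glue.right (f y))))
    -- The values on sections that are not smooth are arbitrary.
    · exact ⟨0, fun h => absurd h hs⟩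
  choose DΛ hDΛ using hex
  exact ⟨DΛ, fun s hs x h => (hDΛ s _ hs).1 _, fun s hs z _ => (hDΛ s _ hs).2 rfl,
    fun s hs y => ⟨(hDΛ s _ hs).1 _, (hDΛ s _ hs).2 rfl⟩⟩

theorem IsInducedLamConnection.restricts_left {DΛ} (h : IsInducedLamConnection f DΛ₁ DΛ₂ DΛ)
    (hL₁ : Restricts (Glue.i₁ f) (Lam.pulls (Glue.dSmooth_i₁ f))) :
    ConnectionRestricts (Glue.dSmooth_i₁ f) (Lam.pulls (Glue.dSmooth_i₁ f)) DΛ DΛ₁ where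
  lam := hL₁
  fam := hL₁
  map_eq s hs x z hx := by
    by_cases hY : x ∈ Y
    · have hz : z = Glue.right (f ⟨x, hY⟩) := hx.symm.trans (Glue.i₁_of_mem f ⟨x, hY⟩)
      subst hz
      exact (h.middle s hs ⟨x, hY⟩).1
    · have hz : z = Glue.left x hY := hx.symm.trans (Glue.i₁_of_notMem f hY)
      subst hz
      exact h.left s hs x hY

theorem IsInducedLamConnection.restricts_right {DΛ} (h : IsInducedLamConnection f DΛ₁ DΛ₂ DΛ)
    (hL₂ : Restricts (Glue.i₂ f) (Lam.pulls (Glue.dSmooth_i₂ f))) :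
    ConnectionRestricts (Glue.dSmooth_i₂ f) (Lam.pulls (Glue.dSmooth_i₂ f)) DΛ DΛ₂ where
  lam := hL₂
  fam := hL₂
  map_eq s hs x z hx := by
    subst hx
    by_cases hY : x ∈ range f
    · obtain ⟨y, rfl⟩ := hY
      exact (h.middle s hs y).2
    · exact h.right s hs x hY

end LamConnection

section Connection

variable {E₁ : X₁ → Type v} {E₂ : X₂ → Type v}
  [∀ x, AddCommGroup (E₁ x)] [∀ x, Module ℝ (E₁ x)] [DiffeologicalSpace (Sigma E₁)]
  [∀ x, AddCommGroup (E₂ x)] [∀ x, Module ℝ (E₂ x)] [DiffeologicalSpace (Sigma E₂)]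
  {F : ∀ y : Y, E₁ y ≃ₗ[ℝ] E₂ (f y)}
  {D₁ : (∀ x, E₁ x) → ∀ x, Tens (Lam X₁) E₁ x} {D₂ : (∀ x, E₂ x) → ∀ x, Tens (Lam X₂) E₂ x}

theorem GlueFam.apply_toLeft (y : Y) {z : Glue f} (h₁ : Glue.i₁ f y = z)
    (h₂ : Glue.i₂ f (f y) = z) (a : GlueFam f F z) :
    F y (GlueFam.toLeft F h₁ a) = GlueFam.toRight F h₂ a := by
  subst h₂
  refine (congrArg (F y) (LinearEquiv.congr_fun (GlueFam.toLeft_of_mem F y h₁) a)).trans ?_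
  exact (F y).apply_symm_apply a

/-- At a point of `f(Y)`, the component of `T` along `Λ¹(X₁)` may be compared with the value `S` on
`X₁` either in the fibre of `E₁` or in that of `E₂`. -/
theorem map_toLeft_eq_iff (y : Y) (T : Tens (Lam (Glue f)) (GlueFam f F) (Glue.right (f y)))
    (S : Tens (Lam X₁) E₁ y) (h : Glue.i₁ f y = Glue.right (f y)) :
    Tens.map (rho₁ f h) (GlueFam.toLeft F h).toLinearMap T = S ↔
      TensorProduct.map (rho₁ f h) (LinearMap.id (M := E₂ (f y))) T =
        TensorProduct.map LinearMap.id (F y).toLinearMap S := by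
  have e : (TensorProduct.map LinearMap.id (F y).toLinearMap).comp
      (TensorProduct.map (rho₁ f h) (F y).symm.toLinearMap) =
        TensorProduct.map (rho₁ f h) (LinearMap.id (M := E₂ (f y))) :=
    TensorProduct.ext' fun a b =>
      congrArg (rho₁ f h a ⊗ₜ[ℝ] ·) ((F y).apply_symm_apply b)
  have hinj : Function.Injective
      (TensorProduct.map (LinearMap.id (R := ℝ) (M := Lam X₁ y)) (F y).toLinearMap) :=
    TensorProduct.map_injective_of_flat_flat _ _ Function.injective_id (F y).injective
  rw [GlueFam.toLeft_of_mem F y h, ← e]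
  exact hinj.eq_iff.symm

/-- Existence of the induced connection: over `f(Y)` the values of `D₁` and `D₂` agree in
`Λ¹(Y) ⊗ E₂`, into which both embed. -/
theorem exists_isInducedConnection (hf : IsGluingMap f)
    (hL₁ : Restricts (Glue.i₁ f) (Lam.pulls (Glue.dSmooth_i₁ f)))
    (hL₂ : Restricts (Glue.i₂ f) (Lam.pulls (Glue.dSmooth_i₂ f)))
    (hres : ∀ y : Y, Function.Injective (resY₁ y)) (hF : IsGluingLift f F)
    (hD : CompatibleConnections hf.dSmooth F D₁ D₂) : ∃ D, IsInducedConnection f F D₁ D₂ D := by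
  have hex : ∀ (s : ∀ z, GlueFam f F z) (z : Glue f), ∃ T : Tens (Lam (Glue f)) (GlueFam f F) z,
      IsSmoothSection s →
      (∀ {x} (h : Glue.i₁ f x = z), Tens.map (rho₁ f h) (GlueFam.toLeft F h).toLinearMap T =
        D₁ (part₁ f F s) x) ∧
      ∀ {x} (h : Glue.i₂ f x = z), Tens.map (rho₂ f h) (GlueFam.toRight F h).toLinearMap T =
        D₂ (part₂ f F s) x := by
    intro s z
    by_cases hs : IsSmoothSection s
    · have key := Glue.exists_value hf.injective
        (L₁ := fun _ _ h => Tens.map (rho₁ f h) (GlueFam.toLeft F h).toLinearMap)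
        (L₂ := fun _ _ h => Tens.map (rho₂ f h) (GlueFam.toRight F h).toLinearMap)
        (fun h => Tens.map_bijective (hL₁.bijective h) (GlueFam.toLeft F h).bijective)
        (fun h => Tens.map_bijective (hL₂.bijective h) (GlueFam.toRight F h).bijective)
        (M := fun y : Y => Lam Y y ⊗[ℝ] E₂ (f y))
        (K₁ := fun y => TensorProduct.map (resY₁ y) (F y).toLinearMap)
        (K₂ := fun y => TensorProduct.map (resY₂ hf.dSmooth y) LinearMap.id)
        (fun y => TensorProduct.map_injective_of_flat_flat _ _ (hres y) (F y).injective) ?_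
        (v₁ := D₁ (part₁ f F s)) (v₂ := D₂ (part₂ f F s)) ?_ z
      · obtain ⟨T, hT⟩ := key
        exact ⟨T, fun _ => hT⟩
      · intro y z h₁ h₂ T
        have : (TensorProduct.map (resY₁ y) (F y).toLinearMap).comp
              (TensorProduct.map (rho₁ f h₁) (GlueFam.toLeft F h₁).toLinearMap) =
            (TensorProduct.map (resY₂ hf.dSmooth y) LinearMap.id).comp
              (TensorProduct.map (rho₂ f h₂) (GlueFam.toRight F h₂).toLinearMap) :=
          TensorProduct.ext' fun a b => congrArg₂ (· ⊗ₜ[ℝ] ·)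
            (compatibleValues_rho hf.dSmooth y h₁ h₂ a) (GlueFam.apply_toLeft y h₁ h₂ b)
        exact LinearMap.congr_fun this T
      · have h₁ := (GlueFam.restricts_toLeft F hf hF).isSmoothSection (Glue.dSmooth_i₁ f) hs
        have h₂ := (GlueFam.restricts_toRight F hF).isSmoothSection (Glue.dSmooth_i₂ f) hs
        rw [GlueFam.restrictSection_toLeft] at h₁
        refine hD _ _ h₁ h₂ fun y => ?_
        have key : part₁ f F s y = (F y).symm (s (Glue.right (f y))) := dif_pos y.2
        rw [key]
        exact ((F y).apply_symm_apply _).symm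
    -- The values on sections that are not smooth are arbitrary.
    · exact ⟨0, fun h => absurd h hs⟩
  choose D hD using hex
  refine ⟨D, fun s hs x h => ?_, fun s hs z _ => (hD s _ hs).2 rfl,
    fun s hs y => ⟨?_, (hD s _ hs).2 rfl⟩⟩
  · have key := (hD s _ hs).1 (Glue.i₁_of_notMem f h)
    rw [GlueFam.toLeft_of_notMem F h] at key
    exact key
  · exact (map_toLeft_eq_iff y _ _ (Glue.i₁_of_mem f y)).1 ((hD s _ hs).1 _)

theorem IsInducedConnection.restricts_left {D} (h : IsInducedConnection f F D₁ D₂ D)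
    (hf : IsGluingMap f) (hF : IsGluingLift f F)
    (hL₁ : Restricts (Glue.i₁ f) (Lam.pulls (Glue.dSmooth_i₁ f))) :
    ConnectionRestricts (Glue.dSmooth_i₁ f) (fun _ _ h => (GlueFam.toLeft F h).toLinearMap)
      D D₁ where
  lam := hL₁
  fam := GlueFam.restricts_toLeft F hf hF
  map_eq s hs x z hx := by
    rw [GlueFam.restrictSection_toLeft]
    by_cases hY : x ∈ Y
    · have hz : z = Glue.right (f ⟨x, hY⟩) := hx.symm.trans (Glue.i₁_of_mem f ⟨x, hY⟩)
      subst hz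
      exact (map_toLeft_eq_iff ⟨x, hY⟩ _ _ hx).2 (h.middle s hs ⟨x, hY⟩).1
    · have hz : z = Glue.left x hY := hx.symm.trans (Glue.i₁_of_notMem f hY)
      subst hz
      rw [GlueFam.toLeft_of_notMem F hY]
      exact h.left s hs x hY

theorem IsInducedConnection.restricts_right {D} (h : IsInducedConnection f F D₁ D₂ D)
    (hF : IsGluingLift f F) (hL₂ : Restricts (Glue.i₂ f) (Lam.pulls (Glue.dSmooth_i₂ f))) :
    ConnectionRestricts (Glue.dSmooth_i₂ f) (fun _ _ h => (GlueFam.toRight F h).toLinearMap)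
      D D₂ where
  lam := hL₂
  fam := GlueFam.restricts_toRight F hF
  map_eq s hs x z hx := by
    subst hx
    by_cases hY : x ∈ range f
    · obtain ⟨y, rfl⟩ := hY
      exact (h.middle s hs y).2
    · exact h.right s hs x hY

theorem toLeft_glueAction {c₁ : ∀ x, Lam X₁ x →ₗ[ℝ] Module.End ℝ (E₁ x)}
    {c₂ : ∀ x, Lam X₂ x →ₗ[ℝ] Module.End ℝ (E₂ x)} (hc : CompatibleActions f F c₁ c₂) ⦃x : X₁⦄
    ⦃z : Glue f⦄ (h : Glue.i₁ f x = z) (a : Lam (Glue f) z) (e : GlueFam f F z) :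
    GlueFam.toLeft F h (glueAction f F c₁ c₂ z a e) =
      c₁ x (rho₁ f h a) (GlueFam.toLeft F h e) := by
  by_cases hx : x ∈ Y
  · have hz : z = Glue.right (f ⟨x, hx⟩) := h.symm.trans (Glue.i₁_of_mem f ⟨x, hx⟩)
    subst hz
    rw [GlueFam.toLeft_of_mem F ⟨x, hx⟩ h]
    refine (LinearEquiv.symm_apply_eq (F ⟨x, hx⟩)).2 ?_
    refine Eq.trans ?_ (hc ⟨x, hx⟩ a ((F ⟨x, hx⟩).symm e))
    exact congrArg (c₂ (f ⟨x, hx⟩) (rho₂ f rfl a)) ((F ⟨x, hx⟩).apply_symm_apply e).symm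
  · have hz : z = Glue.left x hx := h.symm.trans (Glue.i₁_of_notMem f hx)
    subst hz
    rw [GlueFam.toLeft_of_notMem F hx h]
    rfl

theorem toRight_glueAction {c₁ : ∀ x, Lam X₁ x →ₗ[ℝ] Module.End ℝ (E₁ x)}
    {c₂ : ∀ x, Lam X₂ x →ₗ[ℝ] Module.End ℝ (E₂ x)} ⦃x : X₂⦄
    ⦃z : Glue f⦄ (h : Glue.i₂ f x = z) (a : Lam (Glue f) z) (e : GlueFam f F z) :
    GlueFam.toRight F h (glueAction f F c₁ c₂ z a e) =
      c₂ x (rho₂ f h a) (GlueFam.toRight F h e) := by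
  subst h
  rfl

end Connection

end Induced

end DiffGlue

end

theorem mainTheorem1 {X₁ : Type u₁} {X₂ : Type u₂} [DiffeologicalSpace X₁] [DiffeologicalSpace X₂]
    {Y : Set X₁} (f : Y → X₂) (hf : IsGluingMap f) (hΩ : OmegaCondition hf.dSmooth)
    {E₁ : X₁ → Type v} {E₂ : X₂ → Type v}
    [∀ x, AddCommGroup (E₁ x)] [∀ x, Module ℝ (E₁ x)] [DiffeologicalSpace (Sigma E₁)]
    [∀ x, AddCommGroup (E₂ x)] [∀ x, Module ℝ (E₂ x)] [DiffeologicalSpace (Sigma E₂)]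
    (F : ∀ y : Y, E₁ y ≃ₗ[ℝ] E₂ (f y)) (hF : IsGluingLift f F)
    (g₁ : ∀ x, Lam X₁ x →ₗ[ℝ] Lam X₁ x →ₗ[ℝ] ℝ) (g₂ : ∀ x, Lam X₂ x →ₗ[ℝ] Lam X₂ x →ₗ[ℝ] ℝ)
    (DΛ₁ : (∀ x, Lam X₁ x) → ∀ x, Tens (Lam X₁) (Lam X₁) x)
    (DΛ₂ : (∀ x, Lam X₂ x) → ∀ x, Tens (Lam X₂) (Lam X₂) x)
    (c₁ : ∀ x, Lam X₁ x →ₗ[ℝ] Module.End ℝ (E₁ x))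
    (c₂ : ∀ x, Lam X₂ x →ₗ[ℝ] Module.End ℝ (E₂ x))
    (D₁ : (∀ x, E₁ x) → ∀ x, Tens (Lam X₁) E₁ x)
    (D₂ : (∀ x, E₂ x) → ∀ x, Tens (Lam X₂) E₂ x)
    (h₁ : IsCliffordConnection g₁ DΛ₁ c₁ D₁) (h₂ : IsCliffordConnection g₂ DΛ₂ c₂ D₂)
    (hg : CompatibleMetrics hf.dSmooth g₁ g₂) (hc : CompatibleActions f F c₁ c₂)
    (hD : CompatibleConnections hf.dSmooth F D₁ D₂)
    (hDΛ : CompatibleLamConnections hf.dSmooth DΛ₁ DΛ₂) :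
    (∃ DΛ D, IsInducedLamConnection f DΛ₁ DΛ₂ DΛ ∧ IsInducedConnection f F D₁ D₂ D) ∧
    ∀ DΛ D, IsInducedLamConnection f DΛ₁ DΛ₂ DΛ → IsInducedConnection f F D₁ D₂ D →
      IsCliffordConnection (glueMetric f g₁ g₂) DΛ (glueAction f F c₁ c₂) D := by
  have hker₁ := fun x => have := h₁.finite_lam; h₁.metric.ker_eq_bot x
  have hker₂ := fun x => have := h₂.finite_lam; h₂.metric.ker_eq_bot x
  have hres₁ := hg.resY₁_injective hΩ hker₁
  have hL₁ := restricts_rho₁ hf hΩ (hg.resY₂_injective hΩ hker₂)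
  have hL₂ := restricts_rho₂ hf hΩ hres₁
  constructor
  · obtain ⟨DΛ, hDΛ⟩ := exists_isInducedLamConnection hf hL₁ hL₂ hres₁ hDΛ
    obtain ⟨D, hD⟩ := exists_isInducedConnection hf hL₁ hL₂ hres₁ hF hD
    exact ⟨DΛ, D, hDΛ, hD⟩
  · intro DΛ D hDΛ hD
    refine (Glue.isCover f).isCliffordConnection (GlueFam.dSmooth_proj F h₁.bundle h₂.bundle)
      ⟨hDΛ.restricts_left hL₁, hD.restricts_left hf hF hL₁, glueMetric_eq_left hf hg,
        toLeft_glueAction hc⟩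
      ⟨hDΛ.restricts_right hL₂, hD.restricts_right hF hL₂, glueMetric_eq_right hf hg,
        toRight_glueAction⟩ h₁ h₂
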